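/- **Setting.** Let $1\le m\le n$, let $A\in\mathbb R^{n\times n}$ have all its eigenvalues in the open unit disc, let $B\in\mathbb R^{n\times m}$ have rank $m$, let $(A,B)$ be reachable, and put $G(z)=(zI-A)^{-1}B$. Integrals $\int$ are over the unit circle $\mathbb T$ with respect to normalized Lebesgue measure, and $*$ is the conjugate transpose on $\mathbb T$. Let $\mathcal S_+^{m\times m}$ be the set of (measurable) bounded and coercive spectral densities on $\mathbb T$ of $\mathbb R^m$-valued processes: Hermitian-valued functions $\Phi$ with $\Phi(\bar z)=\Phi(z)^T$ and $\alpha I<\Phi\le\beta I$ a.e. for some $0<\alpha\le\beta$; densities equal a.e. are identified. Let $\Psi\in\mathcal S_+^{m\times m}$ be rational (without poles on $\mathbb T$), let $W$ be a square spectral factor of $\Psi$, that is $WW^*=\Psi$ on $\mathbb T$ (for instance the stable minimum phase one), and put $G_1=GW$. Let $\Gamma(\Phi)=\int G\Phi G^*$ on the real linear space generated by the continuous spectral densities of $\mathbb R^m$-valued processes, and let $$\mathcal L_+^\Gamma=\{\Lambda=\Lambda^T\in\operatorname{Range}\Gamma\;:\; I+G_1^*\Lambda G_1>0\ \text{ on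 }\mathbb T\}.$$ Let $\Sigma=\Sigma^T>0$ be a real $n\times n$ matrix. The dual functional on $\mathcal L_+^\Gamma$ is $$J_\Psi(\Lambda)=\int\left[\operatorname{tr}(\Lambda\Sigma)-\log\det(I+G_1^*\Lambda G_1)\right],$$ which for $\Sigma=I$ is $\int\left[\operatorname{tr}\Lambda-\operatorname{tr}\log(I+G_1^*\Lambda G_1)\right]$. On the closure of $\mathcal L_+^\Gamma$ it is extended, with values in $(-\infty,+\infty]$, by $$J_\Psi^\infty(\Lambda)=\lim_{k\to\infty}\int\left[\operatorname{tr}(\Lambda\Sigma)-\log\det\left(I+G_1^*\Lambda G_1+\tfrac1k I\right)\right].$$ The spectrum approximation problem is to minimize $$d_{RER}(\Phi,\Psi)=\tfrac12\int\left\{\log\det(\Phi^{-1}\Psi)+\operatorname{tr}\left[\Psi^{-1}(\Phi-\Psi)\right]\right\}$$ over all $\Phi\in\mathcal S_+^{m\times m}$ with $\int G\Phi G^*=\Sigma$. **Theorem.** Assume that there is $H\in\mathbb R^{m\times n}$ with $\Sigma-A\Sigma A^T=BH+H^TB^T$. Then: 1. $\mathcal L_+^\Gamma$ is an open subset of $\operatorname{Range}\Gamma$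 and is unbounded. 2. $J_\Psi$ has a unique minimizer $\Lambda^\circ$ over $\mathcal L_+^\Gamma$. It lies in the interior of $\mathcal L_+^\Gamma$ (relative to $\operatorname{Range}\Gamma$) and not on the boundary; moreover $J_\Psi(\Lambda^\circ)<J^\infty_\Psi(\Lambda)$ for every $\Lambda\ne\Lambda^\circ$ in the closure of $\mathcal L_+^\Gamma$. 3. $\Phi^\circ=[\Psi^{-1}+G^*\Lambda^\circ G]^{-1}$ satisfies $\int G\Phi^\circ G^*=\Sigma$ and is the unique solution of the spectrum approximation problem. -/

import Mathlib

open MeasureTheory Matrix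

open scoped ComplexOrder

namespace RER

noncomputable section

/-- The unit circle carries its Borel σ-algebra. -/
instance : MeasurableSpace Circle := borel Circle

instance : BorelSpace Circle := ⟨rfl⟩

/-- Normalized Lebesgue (arc length) measure on the unit circle `𝕋`. -/
def circleMeasure : Measure Circle :=
  Measure.map Circle.exp
    (ENNReal.ofReal (1 / (2 * Real.pi)) • volume.restrict (Set.Ioc (-Real.pi) Real.pi))

/-- The complex matrix with the same entries as the real matrix `M`. -/
def toC {p q : ℕ} (M : Matrix (Fin p) (Fin q) ℝ) : Matrix (Fin p) (Fin q) ℂ :=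
  M.map (fun x : ℝ => (x : ℂ))

/-- `A` is a stability matrix: all its (complex) eigenvalues lie in the open unit disc. -/
def IsStable {n : ℕ} (A : Matrix (Fin n) (Fin n) ℝ) : Prop :=
  ∀ μ ∈ spectrum ℂ (toC A), ‖μ‖ < 1

/-- `(A, B)` is reachable: the columns of `B, AB, …, Aⁿ⁻¹B` span `ℝⁿ`. -/
def IsReachable {n m : ℕ} (A : Matrix (Fin n) (Fin n) ℝ) (B : Matrix (Fin n) (Fin m) ℝ) : Prop :=
  ⨆ k : Fin n, LinearMap.range (A ^ (k : ℕ) * B).mulVecLin = ⊤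

/-- The transfer function `G(z) = (zI - A)⁻¹ B`, on the unit circle. -/
def G {n m : ℕ} (A : Matrix (Fin n) (Fin n) ℝ) (B : Matrix (Fin n) (Fin m) ℝ) (z : Circle) :
    Matrix (Fin n) (Fin m) ℂ :=
  ((z : ℂ) • (1 : Matrix (Fin n) (Fin n) ℂ) - toC A)⁻¹ * toC B

/-- The entrywise integral `∫ G Φ G^*` over the unit circle, for normalized Lebesgue measure. -/
def moment {n m : ℕ} (A : Matrix (Fin n) (Fin n) ℝ) (B : Matrix (Fin n) (Fin m) ℝ)
    (Φ : Circle → Matrix (Fin m) (Fin m) ℂ) : Matrix (Fin n) (Fin n) ℂ :=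
  Matrix.of fun i j => ∫ z, (G A B z * Φ z * (G A B z)ᴴ) i j ∂circleMeasure

/-- Bounded and coercive spectral densities of `ℝᵐ`-valued processes. The identity
`Φ(z⁻¹) = Φ(z)ᵀ` (with `z⁻¹ = conj z` on the circle) says that the process is real. -/
structure IsBddCoerciveDensity {m : ℕ} (Φ : Circle → Matrix (Fin m) (Fin m) ℂ) : Prop where
  aemeasurable : ∀ i j, AEMeasurable (fun z => Φ z i j) circleMeasure
  real : ∀ᵐ z ∂circleMeasure, Φ z⁻¹ = (Φ z)ᵀ
  bounded : ∃ β : ℝ, ∀ᵐ z ∂circleMeasure,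
    ((β : ℂ) • (1 : Matrix (Fin m) (Fin m) ℂ) - Φ z).PosSemidef
  coercive : ∃ α : ℝ, 0 < α ∧ ∀ᵐ z ∂circleMeasure,
    (Φ z - (α : ℂ) • (1 : Matrix (Fin m) (Fin m) ℂ)).PosDef

/-- Continuous spectral densities of `ℝᵐ`-valued processes. -/
structure IsContDensity {m : ℕ} (Φ : Circle → Matrix (Fin m) (Fin m) ℂ) : Prop where
  continuous : Continuous Φ
  real : ∀ z, Φ z⁻¹ = (Φ z)ᵀ
  posSemidef : ∀ z, (Φ z).PosSemidef

/-- The real linear space generated by the continuous spectral densities. -/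
def contDensitySpan (m : ℕ) : Submodule ℝ (Circle → Matrix (Fin m) (Fin m) ℂ) :=
  Submodule.span ℝ {Φ | IsContDensity Φ}

/-- The range of the operator `Γ : Φ ↦ ∫ G Φ G^*` on the space generated by the continuous
spectral densities, as a set of real matrices. -/
def rangeGamma {n m : ℕ} (A : Matrix (Fin n) (Fin n) ℝ) (B : Matrix (Fin n) (Fin m) ℝ) :
    Set (Matrix (Fin n) (Fin n) ℝ) :=
  {M | ∃ Φ ∈ contDensitySpan m, toC M = moment A B Φ}

/-- `Ψ` is rational: on the circle its entries are quotients of polynomials, without poles there. -/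
def IsRational {m : ℕ} (Ψ : Circle → Matrix (Fin m) (Fin m) ℂ) : Prop :=
  ∃ (P : Matrix (Fin m) (Fin m) (Polynomial ℂ)) (q : Polynomial ℂ), ∀ z : Circle,
    q.eval (z : ℂ) ≠ 0 ∧ ∀ i j, Ψ z i j = (P i j).eval (z : ℂ) / q.eval (z : ℂ)

/-- `W` is a square spectral factor of `Ψ`. -/
def IsSpectralFactor {m : ℕ} (W Ψ : Circle → Matrix (Fin m) (Fin m) ℂ) : Prop :=
  ∀ z, W z * (W z)ᴴ = Ψ z

/-- `Q_Λ = I + G₁^* Λ G₁` with `G₁ = G W`. -/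
def Q {n m : ℕ} (A : Matrix (Fin n) (Fin n) ℝ) (B : Matrix (Fin n) (Fin m) ℝ)
    (W : Circle → Matrix (Fin m) (Fin m) ℂ) (Λ : Matrix (Fin n) (Fin n) ℝ) (z : Circle) :
    Matrix (Fin m) (Fin m) ℂ :=
  1 + (G A B z * W z)ᴴ * toC Λ * (G A B z * W z)

/-- The set `𝓛₊` of symmetric `Λ` with `I + G₁^* Λ G₁ > 0` on the unit circle. -/
def Lplus {n m : ℕ} (A : Matrix (Fin n) (Fin n) ℝ) (B : Matrix (Fin n) (Fin m) ℝ)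
    (W : Circle → Matrix (Fin m) (Fin m) ℂ) : Set (Matrix (Fin n) (Fin n) ℝ) :=
  {Λ | Λ.IsSymm ∧ ∀ z, (Q A B W Λ z).PosDef}

/-- `𝓛₊^Γ = 𝓛₊ ∩ Range Γ`, as a subset of the space `Range Γ`. -/
def LplusGamma {n m : ℕ} (A : Matrix (Fin n) (Fin n) ℝ) (B : Matrix (Fin n) (Fin m) ℝ)
    (W : Circle → Matrix (Fin m) (Fin m) ℂ) : Set (rangeGamma A B) :=
  {Λ | (Λ : Matrix (Fin n) (Fin n) ℝ) ∈ Lplus A B W}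

/-- The dual functional `∫ (tr (Λ S) - log det (I + G₁^* Λ G₁))`, where `S` is the prescribed
state covariance. -/
def J {n m : ℕ} (A : Matrix (Fin n) (Fin n) ℝ) (B : Matrix (Fin n) (Fin m) ℝ)
    (S : Matrix (Fin n) (Fin n) ℝ) (W : Circle → Matrix (Fin m) (Fin m) ℂ)
    (Λ : Matrix (Fin n) (Fin n) ℝ) : ℝ :=
  ∫ z, ((Λ * S).trace - Real.log (Q A B W Λ z).det.re) ∂circleMeasure

/-- The regularized functional `∫ (tr (Λ S) - log det (I + G₁^* Λ G₁ + ε I))`. -/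
def Jreg {n m : ℕ} (A : Matrix (Fin n) (Fin n) ℝ) (B : Matrix (Fin n) (Fin m) ℝ)
    (S : Matrix (Fin n) (Fin n) ℝ) (W : Circle → Matrix (Fin m) (Fin m) ℂ) (ε : ℝ)
    (Λ : Matrix (Fin n) (Fin n) ℝ) : ℝ :=
  ∫ z, ((Λ * S).trace -
    Real.log (Q A B W Λ z + (ε : ℂ) • (1 : Matrix (Fin m) (Fin m) ℂ)).det.re) ∂circleMeasure

/-- The extended-real-valued extension of the dual functional to the closure of `𝓛₊^Γ`: the limit
(supremum) of the increasing sequence of functionals regularized with `ε = 1/(k+1)`. -/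
def Jinf {n m : ℕ} (A : Matrix (Fin n) (Fin n) ℝ) (B : Matrix (Fin n) (Fin m) ℝ)
    (S : Matrix (Fin n) (Fin n) ℝ) (W : Circle → Matrix (Fin m) (Fin m) ℂ)
    (Λ : Matrix (Fin n) (Fin n) ℝ) : EReal :=
  ⨆ k : ℕ, ((Jreg A B S W (1 / ((k : ℝ) + 1)) Λ : ℝ) : EReal)

/-- The relative entropy rate pseudo-distance between spectral densities. -/
def dRER {m : ℕ} (Φ Ψ : Circle → Matrix (Fin m) (Fin m) ℂ) : ℝ :=
  (1 / 2) * ∫ z, (Real.log ((Φ z)⁻¹ * Ψ z).det.re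
    + ((Ψ z)⁻¹ * (Φ z - Ψ z)).trace.re) ∂circleMeasure

/-- The feasible set: bounded coercive spectral densities with `∫ G Φ G^* = S`. -/
def feasible {n m : ℕ} (A : Matrix (Fin n) (Fin n) ℝ) (B : Matrix (Fin n) (Fin m) ℝ)
    (S : Matrix (Fin n) (Fin n) ℝ) : Set (Circle → Matrix (Fin m) (Fin m) ℂ) :=
  {Φ | IsBddCoerciveDensity Φ ∧ moment A B Φ = toC S}

/-- `Φ` solves the spectrum approximation problem: it minimizes `dRER · Ψ` over the feasible set. -/
def IsSolution {n m : ℕ} (A : Matrix (Fin n) (Fin n) ℝ) (B : Matrix (Fin n) (Fin m) ℝ)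
    (S : Matrix (Fin n) (Fin n) ℝ) (Ψ Φ : Circle → Matrix (Fin m) (Fin m) ℂ) : Prop :=
  Φ ∈ feasible A B S ∧ ∀ Φ' ∈ feasible A B S, dRER Φ Ψ ≤ dRER Φ' Ψ

/-- `Φ°(Λ) = (Ψ⁻¹ + G^* Λ G)⁻¹`. -/
def PhiOpt {n m : ℕ} (A : Matrix (Fin n) (Fin n) ℝ) (B : Matrix (Fin n) (Fin m) ℝ)
    (Ψ : Circle → Matrix (Fin m) (Fin m) ℂ) (Λ : Matrix (Fin n) (Fin n) ℝ) (z : Circle) :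
    Matrix (Fin m) (Fin m) ℂ :=
  ((Ψ z)⁻¹ + (G A B z)ᴴ * toC Λ * G A B z)⁻¹

end

end RER

/-!
A state feedback built from `S` turns the Lyapunov-type condition into a continuous positive
definite density with moment `S`: with `F = -(BᵀS⁻¹B)⁻¹BᵀS⁻¹A` and `R = (BᵀS⁻¹B)⁻¹` the closed loop
`A + BF` is stable and `S - (A + BF) S (A + BF)ᵀ = B R Bᵀ`.

Up to the constant `∫ log det Ψ`, the dual functional is `tr (ΛS) - ∫ log det (Ψ⁻¹ + G*ΛG)`, a
convex function whose tangents come from the first-order inequality for `log det`. Comparing with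
the density above shows that its sublevel sets are bounded, so minimizing sequences accumulate at
a point `Λ` of the closed domain, a priori on the boundary, which solves a Minty variational
inequality. Testing it along the ray `(1 - t) Λ` bounds `∫ tr ((Ψ⁻¹ + (1 - t) G*ΛG)⁻¹ Ψ⁻¹)`
uniformly in `t`. If `Ψ⁻¹ + G*ΛG` were singular at some point of the circle, one of its quadratic
forms would be differentiable and nonnegative with a zero, hence small near that zero, and the
integral would diverge logarithmically. So `Λ` is interior and the gradient of the dual functional
vanishes there, which is the moment equation `∫ G Φ° G* = S`. Strict concavity of `log det` gives
optimality and uniqueness, for the dual and for the primal problem.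
-/

namespace RER

noncomputable section

section QuadraticForms

variable {ι : Type*} [Fintype ι]

/-- The quadratic form `v ↦ Re (v^* X v)` of a complex matrix `X`; for Hermitian `X` the real part
loses nothing. -/
def quad (X : Matrix ι ι ℂ) (v : ι → ℂ) : ℝ := (star v ⬝ᵥ (X *ᵥ v)).re

theorem quad_add (X Y : Matrix ι ι ℂ) (v : ι → ℂ) : quad (X + Y) v = quad X v + quad Y v := by
  simp [quad, add_mulVec, dotProduct_add]

theorem quad_sub (X Y : Matrix ι ι ℂ) (v : ι → ℂ) : quad (X - Y) v = quad X v - quad Y v := by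
  simp [quad, sub_mulVec, dotProduct_sub]

theorem quad_smul (c : ℝ) (X : Matrix ι ι ℂ) (v : ι → ℂ) :
    quad ((c : ℂ) • X) v = c * quad X v := by
  simp only [quad, smul_mulVec, dotProduct_smul, smul_eq_mul, Complex.re_ofReal_mul]

theorem quad_smul_vec (X : Matrix ι ι ℂ) (c : ℂ) (v : ι → ℂ) :
    quad X (c • v) = ‖c‖ ^ 2 * quad X v := by
  rw [quad, mulVec_smul, star_smul, smul_dotProduct, dotProduct_smul, smul_smul, smul_eq_mul,
    RCLike.star_def, ← Complex.normSq_eq_conj_mul_self, Complex.re_ofReal_mul,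
    Complex.normSq_eq_norm_sq, quad]

theorem quad_mul_mul_conjTranspose {κ : Type*} [Fintype κ] (C : Matrix ι κ ℂ) (X : Matrix κ κ ℂ)
    (v : ι → ℂ) : quad (C * X * Cᴴ) v = quad X (Cᴴ *ᵥ v) := by
  rw [quad, quad, star_mulVec, conjTranspose_conjTranspose, ← dotProduct_mulVec, mulVec_mulVec,
    mulVec_mulVec, Matrix.mul_assoc]

theorem trace_mul_vecMulVec_star_re (X : Matrix ι ι ℂ) (v : ι → ℂ) :
    (X * vecMulVec v (star v)).trace.re = quad X v := by
  rw [mul_vecMulVec, trace_vecMulVec, dotProduct_comm, quad]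

theorem continuous_quad {T : Type*} [TopologicalSpace T] {F : T → Matrix ι ι ℂ} {v : T → ι → ℂ}
    (hF : Continuous F) (hv : Continuous v) : Continuous fun t => quad (F t) (v t) :=
  Complex.continuous_re.comp (hv.star.dotProduct (hF.matrix_mulVec hv))

theorem posSemidef_iff_quad {X : Matrix ι ι ℂ} (hX : X.IsHermitian) :
    X.PosSemidef ↔ ∀ v, 0 ≤ quad X v :=
  ⟨fun h v => h.re_dotProduct_nonneg v, fun h => .of_dotProduct_mulVec_nonneg hX fun v =>
    Complex.nonneg_iff.mpr ⟨h v, (hX.im_star_dotProduct_mulVec_self v).symm⟩⟩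

theorem posDef_iff_quad {X : Matrix ι ι ℂ} (hX : X.IsHermitian) :
    X.PosDef ↔ ∀ v ≠ 0, 0 < quad X v :=
  ⟨fun h _ hv => h.re_dotProduct_pos hv, fun h => .of_dotProduct_mulVec_pos hX fun v hv =>
    Complex.pos_iff.mpr ⟨h v hv, (hX.im_star_dotProduct_mulVec_self v).symm⟩⟩

theorem exists_smul_sphere {v : ι → ℂ} (hv : v ≠ 0) :
    ∃ (c : ℝ) (u : Metric.sphere (0 : ι → ℂ) 1), 0 < c ∧ v = (c : ℂ) • (u : ι → ℂ) := by
  have hc : ((‖v‖ : ℝ) : ℂ) ≠ 0 := by exact_mod_cast norm_ne_zero_iff.mpr hv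
  refine ⟨‖v‖, ⟨((‖v‖ : ℝ) : ℂ)⁻¹ • v, ?_⟩, norm_pos_iff.mpr hv, (smul_inv_smul₀ hc v).symm⟩
  rw [mem_sphere_zero_iff_norm, norm_smul, norm_inv, Complex.norm_real, norm_norm,
    inv_mul_cancel₀ (norm_ne_zero_iff.mpr hv)]

theorem posDef_iff_quad_sphere {X : Matrix ι ι ℂ} (hX : X.IsHermitian) :
    X.PosDef ↔ ∀ u : Metric.sphere (0 : ι → ℂ) 1, 0 < quad X u := by
  refine ⟨fun h u => (posDef_iff_quad hX).mp h u (ne_zero_of_mem_unit_sphere u),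
    fun h => (posDef_iff_quad hX).mpr fun v hv => ?_⟩
  obtain ⟨c, u, hc, rfl⟩ := exists_smul_sphere hv
  rw [quad_smul_vec]
  exact mul_pos (pow_pos (norm_pos_iff.mpr (by exact_mod_cast hc.ne')) 2) (h u)

theorem posSemidef_of_quad_sphere {X : Matrix ι ι ℂ} (hX : X.IsHermitian)
    (h : ∀ u : Metric.sphere (0 : ι → ℂ) 1, 0 ≤ quad X u) : X.PosSemidef := by
  refine (posSemidef_iff_quad hX).mpr fun v => ?_
  rcases eq_or_ne v 0 with rfl | hv
  · simp [quad]
  obtain ⟨c, u, -, rfl⟩ := exists_smul_sphere hv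
  rw [quad_smul_vec]
  exact mul_nonneg (by positivity) (h u)

theorem isClosed_posSemidef {κ : Type*} [Finite κ] :
    IsClosed {X : Matrix κ κ ℂ | X.PosSemidef} := by
  cases nonempty_fintype κ
  have h : {X : Matrix κ κ ℂ | X.PosSemidef} = {X | Xᴴ = X} ∩ ⋂ v, {X | 0 ≤ quad X v} := by
    ext X
    simp only [Set.mem_inter_iff, Set.mem_iInter, Set.mem_ofPred_eq]
    exact ⟨fun h => ⟨h.1, (posSemidef_iff_quad h.1).mp h⟩,
      fun h => (posSemidef_iff_quad h.1).mpr h.2⟩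
  rw [h]
  exact (isClosed_eq continuous_id.matrix_conjTranspose continuous_id).inter
    (isClosed_iInter fun v => isClosed_le continuous_const
      (continuous_quad continuous_id continuous_const))

theorem isHermitian_ofReal_smul {κ : Type*} {X : Matrix κ κ ℂ} (hX : X.IsHermitian) (c : ℝ) :
    ((c : ℂ) • X).IsHermitian := by
  rw [IsHermitian, conjTranspose_smul, hX.eq, RCLike.star_def, Complex.conj_ofReal]

theorem exists_smul_sub_posSemidef {κ T : Type*} [Finite κ] [TopologicalSpace T]
    [CompactSpace T] {X Y : T → Matrix κ κ ℂ} (hX : Continuous X) (hXp : ∀ t, (X t).PosDef)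
    (hY : Continuous Y) (hYh : ∀ t, (Y t).IsHermitian) :
    ∃ c : ℝ, ∀ t, ((c : ℂ) • X t - Y t).PosSemidef := by
  cases nonempty_fintype κ
  have hpos : ∀ t (u : Metric.sphere (0 : κ → ℂ) 1), 0 < quad (X t) u := fun t =>
    (posDef_iff_quad_sphere (hXp t).1).mp (hXp t)
  have hu : Continuous fun p : T × Metric.sphere (0 : κ → ℂ) 1 => (p.2 : κ → ℂ) := by fun_prop
  have hquot : Continuous fun p : T × Metric.sphere (0 : κ → ℂ) 1 =>
      quad (Y p.1) p.2 / quad (X p.1) p.2 :=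
    (continuous_quad (hY.comp continuous_fst) hu).div
      (continuous_quad (hX.comp continuous_fst) hu) fun p => (hpos _ _).ne'
  obtain ⟨c, hc⟩ := (isCompact_range hquot).bddAbove
  refine ⟨c, fun t => posSemidef_of_quad_sphere
    ((isHermitian_ofReal_smul (hXp t).1 c).sub (hYh t)) fun u => ?_⟩
  rw [quad_sub, quad_smul, sub_nonneg, ← div_le_iff₀ (hpos t u)]
  exact hc ⟨(t, u), rfl⟩

theorem isOpen_setOf_forall_posDef {κ E T : Type*} [Finite κ] [TopologicalSpace E]
    [TopologicalSpace T] [CompactSpace T] {X : E × T → Matrix κ κ ℂ} (hX : Continuous X)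
    (hXh : ∀ p, (X p).IsHermitian) : IsOpen {x | ∀ t, (X (x, t)).PosDef} := by
  cases nonempty_fintype κ
  have hquad : Continuous fun p : E × (T × Metric.sphere (0 : κ → ℂ) 1) =>
      quad (X (p.1, p.2.1)) p.2.2 := continuous_quad (by fun_prop) (by fun_prop)
  have hcompl : {x | ∀ t, (X (x, t)).PosDef} = (Prod.fst ''
      {p : E × (T × Metric.sphere (0 : κ → ℂ) 1) | quad (X (p.1, p.2.1)) p.2.2 ≤ 0})ᶜ := by
    ext x
    simp [posDef_iff_quad_sphere (hXh _)]
  rw [hcompl, isOpen_compl_iff]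
  exact isClosedMap_fst_of_compactSpace _ (isClosed_le hquad continuous_const)

end QuadraticForms

section PositiveMatrices

variable {ι 𝕜 : Type*} [Fintype ι] [RCLike 𝕜]

theorem exists_eq_conjTranspose_mul_self {X : Matrix ι ι 𝕜} (hX : X.PosSemidef) :
    ∃ C : Matrix ι ι 𝕜, X = Cᴴ * C := by
  classical
  open scoped MatrixOrder in
  exact CStarAlgebra.nonneg_iff_eq_star_mul_self.mp (nonneg_iff_posSemidef.mpr hX)

theorem exists_isUnit_eq_conjTranspose_mul_self [DecidableEq ι] {X : Matrix ι ι 𝕜}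
    (hX : X.PosDef) : ∃ C : Matrix ι ι 𝕜, IsUnit C ∧ X = Cᴴ * C := by
  open scoped MatrixOrder in
  exact CStarAlgebra.isStrictlyPositive_iff_eq_star_mul_self.mp
    (isStrictlyPositive_iff_posDef.mpr hX)

theorem isUnit_det_of_posDef [DecidableEq ι] {X : Matrix ι ι 𝕜} (hX : X.PosDef) :
    IsUnit X.det :=
  (isUnit_iff_isUnit_det X).mp hX.isUnit

theorem trace_mul_nonneg {X Y : Matrix ι ι ℂ} (hX : X.PosSemidef) (hY : Y.PosSemidef) :
    0 ≤ (X * Y).trace.re := by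
  obtain ⟨C, rfl⟩ := exists_eq_conjTranspose_mul_self hX
  rw [Matrix.mul_assoc, trace_mul_comm]
  exact (Complex.nonneg_iff.mp (hY.mul_mul_conjTranspose_same C).trace_nonneg).1

theorem trace_mul_mono_right {X Y Z : Matrix ι ι ℂ} (hX : X.PosSemidef)
    (hYZ : (Z - Y).PosSemidef) : (X * Y).trace.re ≤ (X * Z).trace.re := by
  rw [← sub_nonneg, ← Complex.sub_re, ← trace_sub, ← Matrix.mul_sub]
  exact trace_mul_nonneg hX hYZ

theorem norm_apply_le_trace_re {X : Matrix ι ι ℂ} (hX : X.PosSemidef) (i j : ι) :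
    ‖X i j‖ ≤ X.trace.re := by
  obtain ⟨C, rfl⟩ := exists_eq_conjTranspose_mul_self hX
  have htrace : (Cᴴ * C).trace.re = ∑ k, ∑ l, ‖C l k‖ ^ 2 := by
    simp only [Matrix.trace, diag_apply, Matrix.mul_apply, conjTranspose_apply, Complex.re_sum,
      RCLike.star_def, ← Complex.normSq_eq_conj_mul_self, Complex.ofReal_re,
      Complex.normSq_eq_norm_sq]
  have hcolumn (k : ι) : ∑ l, ‖C l k‖ ^ 2 ≤ (Cᴴ * C).trace.re := htrace ▸
    Finset.single_le_sum (f := fun k => ∑ l, ‖C l k‖ ^ 2)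
      (fun _ _ => Finset.sum_nonneg fun _ _ => by positivity) (Finset.mem_univ k)
  calc ‖(Cᴴ * C) i j‖ ≤ ∑ l, ‖C l i‖ * ‖C l j‖ := by
        rw [Matrix.mul_apply]
        refine (norm_sum_le _ _).trans_eq (Finset.sum_congr rfl fun l _ => ?_)
        rw [norm_mul, conjTranspose_apply, norm_star]
    _ ≤ ∑ l, (‖C l i‖ ^ 2 + ‖C l j‖ ^ 2) / 2 := Finset.sum_le_sum fun l _ => by
        linarith [two_mul_le_add_sq ‖C l i‖ ‖C l j‖]
    _ = (∑ l, ‖C l i‖ ^ 2 + ∑ l, ‖C l j‖ ^ 2) / 2 := by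
        rw [← Finset.sum_add_distrib, Finset.sum_div]
    _ ≤ (Cᴴ * C).trace.re := by linarith [hcolumn i, hcolumn j]

variable [DecidableEq ι]

theorem cauchySchwarz_quad_inv {X : Matrix ι ι ℂ} (hX : X.PosDef) (u v : ι → ℂ) :
    (star u ⬝ᵥ v).re ^ 2 ≤ quad X u * quad X⁻¹ v := by
  have hdet := isUnit_det_of_posDef hX
  have hinv : X⁻¹ *ᵥ (X *ᵥ u) = u := by
    rw [mulVec_mulVec, nonsing_inv_mul _ hdet, one_mulVec]
  have huv : star (X *ᵥ u) ⬝ᵥ (X⁻¹ *ᵥ v) = star u ⬝ᵥ v := by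
    rw [star_mulVec, ← dotProduct_mulVec, mulVec_mulVec, hX.1.eq, mul_nonsing_inv _ hdet,
      one_mulVec]
  have huu : star (X *ᵥ u) ⬝ᵥ u = star u ⬝ᵥ (X *ᵥ u) := by
    rw [star_mulVec, ← dotProduct_mulVec, hX.1.eq]
  have hvu : (star v ⬝ᵥ u).re = (star u ⬝ᵥ v).re := by
    rw [star_dotProduct, RCLike.star_def, Complex.conj_re]
  have hquad : ∀ s : ℝ,
      0 ≤ quad X u * (s * s) + (-2 * (star u ⬝ᵥ v).re) * s + quad X⁻¹ v := fun s => by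
    have h := hX.inv.posSemidef.re_dotProduct_nonneg ((s : ℂ) • (X *ᵥ u) - v)
    simp only [mulVec_sub, mulVec_smul, hinv, star_sub, star_smul, sub_dotProduct, dotProduct_sub,
      smul_dotProduct, dotProduct_smul, huv, huu, RCLike.star_def, Complex.conj_ofReal,
      smul_eq_mul, RCLike.re_to_complex, Complex.sub_re, Complex.re_ofReal_mul, hvu] at h
    rw [quad, quad]
    linarith
  have := discrim_le_zero hquad
  rw [discrim] at this
  linarith

theorem sq_div_quad_le_trace_inv_mul {X Y : Matrix ι ι ℂ} {v : ι → ℂ} {κ : ℝ} (hX : X.PosDef)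
    (hv : v ≠ 0) (hκY : ((κ : ℂ) • Y - vecMulVec v (star v)).PosSemidef) :
    (star v ⬝ᵥ v).re ^ 2 / quad X v ≤ κ * (X⁻¹ * Y).trace.re := by
  have hq : 0 < quad X v := hX.re_dotProduct_pos hv
  calc (star v ⬝ᵥ v).re ^ 2 / quad X v ≤ quad X⁻¹ v :=
        (div_le_iff₀' hq).mpr (cauchySchwarz_quad_inv hX v v)
    _ = (X⁻¹ * vecMulVec v (star v)).trace.re := (trace_mul_vecMulVec_star_re _ _).symm
    _ ≤ (X⁻¹ * ((κ : ℂ) • Y)).trace.re := trace_mul_mono_right hX.inv.posSemidef hκY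
    _ = κ * (X⁻¹ * Y).trace.re := by
        rw [Matrix.mul_smul, trace_smul, smul_eq_mul, Complex.re_ofReal_mul]

end PositiveMatrices

section LogDet

variable {ι : Type*} [Fintype ι] [DecidableEq ι]

/-- The real logarithm of the determinant of a positive definite matrix. The determinant is then
a positive real number; other matrices get a junk value. -/
def logDet (X : Matrix ι ι ℂ) : ℝ := Real.log X.det.re

theorem det_re_pos {X : Matrix ι ι ℂ} (hX : X.PosDef) : 0 < X.det.re :=
  (Complex.pos_iff.mp hX.det_pos).1

theorem log_det_mul {X Y : Matrix ι ι ℂ} (hX : X.PosDef) (hY : Y.PosDef) :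
    Real.log (X * Y).det.re = logDet X + logDet Y := by
  rw [logDet, logDet, ← Real.log_mul (det_re_pos hX).ne' (det_re_pos hY).ne', det_mul,
    Complex.mul_re, ← (Complex.pos_iff.mp hX.det_pos).2, zero_mul, sub_zero]

theorem logDet_inv {X : Matrix ι ι ℂ} (hX : X.PosDef) : logDet X⁻¹ = -logDet X := by
  rw [eq_neg_iff_add_eq_zero, add_comm, ← log_det_mul hX hX.inv,
    mul_nonsing_inv _ (isUnit_det_of_posDef hX), det_one, Complex.one_re, Real.log_one]

theorem logDet_eq_sum_log_eigenvalues {X : Matrix ι ι ℂ} (hX : X.PosDef) :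
    logDet X = ∑ i, Real.log (hX.1.eigenvalues i) := by
  have hdet : X.det = ((∏ i, hX.1.eigenvalues i : ℝ) : ℂ) := by
    rw [hX.1.det_eq_prod_eigenvalues, Complex.ofReal_prod]
    rfl
  rw [logDet, hdet, Complex.ofReal_re, Real.log_prod fun i _ => (hX.eigenvalues_pos i).ne']

theorem trace_re_sub_card_eq_sum {X : Matrix ι ι ℂ} (hX : X.IsHermitian) :
    X.trace.re - Fintype.card ι = ∑ i, (hX.eigenvalues i - 1) := by
  rw [hX.trace_eq_sum_eigenvalues]
  simp

theorem eq_one_of_eigenvalues_eq_one {X : Matrix ι ι ℂ} (hX : X.IsHermitian)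
    (h : ∀ i, hX.eigenvalues i = 1) : X = 1 := by
  have hone : (RCLike.ofReal ∘ hX.eigenvalues : ι → ℂ) = fun _ => 1 :=
    funext fun i => by simp [h i]
  rw [hX.spectral_theorem, hone, diagonal_one, map_one]

theorem logDet_le_trace_sub_card {X : Matrix ι ι ℂ} (hX : X.PosDef) :
    logDet X ≤ X.trace.re - Fintype.card ι := by
  rw [logDet_eq_sum_log_eigenvalues hX, trace_re_sub_card_eq_sum hX.1]
  exact Finset.sum_le_sum fun i _ => Real.log_le_sub_one_of_pos (hX.eigenvalues_pos i)

theorem eq_one_of_logDet_eq_trace_sub_card {X : Matrix ι ι ℂ} (hX : X.PosDef)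
    (h : logDet X = X.trace.re - Fintype.card ι) : X = 1 := by
  rw [logDet_eq_sum_log_eigenvalues hX, trace_re_sub_card_eq_sum hX.1,
    Finset.sum_eq_sum_iff_of_le fun i _ =>
      Real.log_le_sub_one_of_pos (hX.eigenvalues_pos i)] at h
  refine eq_one_of_eigenvalues_eq_one hX.1 fun i => ?_
  by_contra hne
  exact (Real.log_lt_sub_one_of_pos (hX.eigenvalues_pos i) hne).ne (h i (Finset.mem_univ i))

theorem trace_inv_mul_sub {X : Matrix ι ι ℂ} (hX : X.PosDef) (Y : Matrix ι ι ℂ) :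
    (X⁻¹ * (Y - X)).trace.re = (X⁻¹ * Y).trace.re - Fintype.card ι := by
  rw [Matrix.mul_sub, nonsing_inv_mul _ (isUnit_det_of_posDef hX), trace_sub, trace_one,
    Complex.sub_re, Complex.natCast_re]

theorem exists_congruence {X Y : Matrix ι ι ℂ} (hX : X.PosDef) (hY : Y.PosDef) :
    ∃ C Z : Matrix ι ι ℂ, IsUnit C ∧ Z.PosDef ∧ X = Cᴴ * C ∧ Y = Cᴴ * Z * C := by
  obtain ⟨C, hC, rfl⟩ := exists_isUnit_eq_conjTranspose_mul_self hX
  have hdet := (isUnit_iff_isUnit_det C).mp hC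
  have hleft : Cᴴ * (C⁻¹)ᴴ = 1 := by
    rw [← conjTranspose_mul, nonsing_inv_mul _ hdet, conjTranspose_one]
  refine ⟨C, (C⁻¹)ᴴ * Y * C⁻¹, hC, hY.conjTranspose_mul_mul_same
    (mulVec_injective_of_isUnit (isUnit_nonsing_inv_iff.mpr hC)), rfl, ?_⟩
  rw [← Matrix.mul_assoc, ← Matrix.mul_assoc, hleft, Matrix.one_mul, Matrix.mul_assoc,
    nonsing_inv_mul _ hdet, Matrix.mul_one]

theorem logDet_congruence {C Z : Matrix ι ι ℂ} (hC : IsUnit C) (hZ : Z.PosDef) :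
    logDet (Cᴴ * Z * C) = logDet (Cᴴ * C) + logDet Z := by
  have hCC : (Cᴴ * C).PosDef := .conjTranspose_mul_self _ (mulVec_injective_of_isUnit hC)
  rw [← log_det_mul hCC hZ, logDet, det_mul, det_mul, det_mul, det_mul, mul_right_comm]

theorem trace_inv_mul_congruence {C : Matrix ι ι ℂ} (hC : IsUnit C) (Z : Matrix ι ι ℂ) :
    ((Cᴴ * C)⁻¹ * (Cᴴ * Z * C)).trace = Z.trace := by
  have hdet := (isUnit_iff_isUnit_det C).mp hC
  have hdet' : IsUnit Cᴴ.det := by rw [det_conjTranspose]; exact hdet.star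
  rw [Matrix.mul_inv_rev, Matrix.mul_assoc C⁻¹, Matrix.mul_assoc Cᴴ, ← Matrix.mul_assoc Cᴴ⁻¹,
    nonsing_inv_mul _ hdet', Matrix.one_mul, trace_mul_comm, Matrix.mul_assoc,
    mul_nonsing_inv _ hdet, Matrix.mul_one]

theorem logDet_le_add_trace {X Y : Matrix ι ι ℂ} (hX : X.PosDef) (hY : Y.PosDef) :
    logDet Y ≤ logDet X + (X⁻¹ * (Y - X)).trace.re := by
  rw [trace_inv_mul_sub hX]
  obtain ⟨C, Z, hC, hZ, rfl, rfl⟩ := exists_congruence hX hY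
  rw [logDet_congruence hC hZ, trace_inv_mul_congruence hC]
  exact (add_le_add_iff_left _).mpr (logDet_le_trace_sub_card hZ)

theorem eq_of_logDet_eq_add_trace {X Y : Matrix ι ι ℂ} (hX : X.PosDef) (hY : Y.PosDef)
    (h : logDet Y = logDet X + (X⁻¹ * (Y - X)).trace.re) : Y = X := by
  rw [trace_inv_mul_sub hX] at h
  obtain ⟨C, Z, hC, hZ, rfl, rfl⟩ := exists_congruence hX hY
  rw [logDet_congruence hC hZ, trace_inv_mul_congruence hC, add_right_inj] at h
  rw [eq_one_of_logDet_eq_trace_sub_card hZ h, Matrix.mul_one]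

theorem logDet_mono {X Y : Matrix ι ι ℂ} (hX : X.PosDef) (hY : Y.PosDef)
    (h : (Y - X).PosSemidef) : logDet X ≤ logDet Y := by
  have htangent := logDet_le_add_trace hY hX
  have hnonneg := trace_mul_nonneg hY.inv.posSemidef h
  rw [← neg_sub, Matrix.mul_neg, trace_neg, Complex.neg_re] at htangent
  linarith

end LogDet

section MatrixFunctions

variable {ι κ : Type*} [Fintype ι] [Fintype κ] [DecidableEq κ] {T : Type*} [TopologicalSpace T]

theorem continuous_inv_of_isUnit_det {F : T → Matrix κ κ ℂ} (hF : Continuous F)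
    (hdet : ∀ t, IsUnit (F t).det) : Continuous fun t => (F t)⁻¹ :=
  continuous_iff_continuousAt.mpr fun t =>
    (continuousAt_matrix_inv _ (NormedRing.inverse_continuousAt (hdet t).unit)).comp
      hF.continuousAt

theorem continuous_inv_of_posDef {F : T → Matrix κ κ ℂ} (hF : Continuous F)
    (hpos : ∀ t, (F t).PosDef) : Continuous fun t => (F t)⁻¹ :=
  continuous_inv_of_isUnit_det hF fun t => isUnit_det_of_posDef (hpos t)

theorem continuous_logDet {F : T → Matrix κ κ ℂ} (hF : Continuous F)
    (hpos : ∀ t, (F t).PosDef) : Continuous fun t => logDet (F t) :=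
  (Complex.continuous_re.comp hF.matrix_det).log fun t => (det_re_pos (hpos t)).ne'

variable {𝕜 𝔸 η η' : Type*} [NontriviallyNormedField 𝕜] [NormedField 𝔸] [NormedAlgebra 𝕜 𝔸] {x : 𝕜}

theorem differentiableAt_matrix_mul {F : 𝕜 → Matrix η ι 𝔸} {H : 𝕜 → Matrix ι η' 𝔸}
    (hF : ∀ i j, DifferentiableAt 𝕜 (fun t => F t i j) x)
    (hH : ∀ i j, DifferentiableAt 𝕜 (fun t => H t i j) x) (i j) :
    DifferentiableAt 𝕜 (fun t => (F t * H t) i j) x := by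
  simp only [Matrix.mul_apply]
  exact .fun_sum fun k _ => (hF i k).mul (hH k j)

theorem differentiableAt_matrix_det {F : 𝕜 → Matrix κ κ 𝔸}
    (hF : ∀ i j, DifferentiableAt 𝕜 (fun t => F t i j) x) :
    DifferentiableAt 𝕜 (fun t => (F t).det) x := by
  simp only [Matrix.det_apply']
  exact .fun_sum fun σ _ => (DifferentiableAt.fun_finsetProd fun k _ => hF _ _).const_mul _

theorem differentiableAt_matrix_inv {F : 𝕜 → Matrix κ κ 𝔸}
    (hF : ∀ i j, DifferentiableAt 𝕜 (fun t => F t i j) x) (hx : IsUnit (F x).det) (i j) :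
    DifferentiableAt 𝕜 (fun t => (F t)⁻¹ i j) x := by
  simp only [Matrix.inv_def, Matrix.smul_apply, Ring.inverse_eq_inv', smul_eq_mul,
    Matrix.adjugate_apply]
  refine ((differentiableAt_matrix_det hF).inv hx.ne_zero).mul
    (differentiableAt_matrix_det fun k l => ?_)
  by_cases hk : k = j
  · simp [hk]
  · simpa [Matrix.updateRow_ne hk] using hF k l

end MatrixFunctions

section EssentiallyBounded

variable {T : Type*} [MeasurableSpace T] {μ : Measure T} {η ι κ : Type*}

/-- Essentially bounded measurable matrix functions: those with all entries in `L^∞`. They form an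
algebra that contains both the continuous functions on a compact space and the bounded spectral
densities. -/
def EssBdd (F : T → Matrix ι κ ℂ) (μ : Measure T) : Prop :=
  ∀ i j, MemLp (fun t => F t i j) ⊤ μ

theorem EssBdd.sub {F H : T → Matrix ι κ ℂ} (hF : EssBdd F μ) (hH : EssBdd H μ) :
    EssBdd (fun t => F t - H t) μ := fun i j => (hF i j).sub (hH i j)

theorem EssBdd.mul [Fintype ι] {F : T → Matrix η ι ℂ} {H : T → Matrix ι κ ℂ} (hF : EssBdd F μ)
    (hH : EssBdd H μ) : EssBdd (fun t => F t * H t) μ := fun i j => by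
  simp only [Matrix.mul_apply]
  exact memLp_finsetSum _ fun k _ => (hH k j).mul (hF i k)

theorem EssBdd.of_continuous [TopologicalSpace T] [CompactSpace T] [OpensMeasurableSpace T]
    {F : T → Matrix ι κ ℂ} (hF : Continuous F) : EssBdd F μ := fun i j => by
  have hc : Continuous fun t => F t i j := hF.matrix_elem i j
  obtain ⟨C, hC⟩ := (isCompact_range hc.norm).bddAbove
  exact memLp_top_of_bound hc.aestronglyMeasurable C (.of_forall fun t => hC ⟨t, rfl⟩)

variable [IsFiniteMeasure μ]

theorem EssBdd.integrable {F : T → Matrix ι κ ℂ} (hF : EssBdd F μ) (i j) :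
    Integrable (fun t => F t i j) μ := (hF i j).integrable le_top

variable [Fintype κ]

theorem EssBdd.integrable_trace {F : T → Matrix κ κ ℂ} (hF : EssBdd F μ) :
    Integrable (fun t => (F t).trace) μ :=
  integrable_finsetSum _ fun i _ => hF.integrable i i

theorem EssBdd.integrable_trace_re {F : T → Matrix κ κ ℂ} (hF : EssBdd F μ) :
    Integrable (fun t => (F t).trace.re) μ := hF.integrable_trace.re

theorem EssBdd.trace_mul_integral [Fintype ι] {F : T → Matrix ι κ ℂ} (hF : EssBdd F μ)
    (C : Matrix κ ι ℂ) :
    (C * Matrix.of fun i j => ∫ t, F t i j ∂μ).trace = ∫ t, (C * F t).trace ∂μ := by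
  simp only [Matrix.trace, diag_apply, Matrix.mul_apply, of_apply]
  rw [integral_finsetSum]
  · refine Finset.sum_congr rfl fun i _ => ?_
    rw [integral_finsetSum _ fun k _ => (hF.integrable k i).const_mul _]
    exact Finset.sum_congr rfl fun k _ => (integral_const_mul _ _).symm
  · exact fun i _ => integrable_finsetSum _ fun k _ => (hF.integrable k i).const_mul _

end EssentiallyBounded

section IntegralsOnCompactSpaces

variable {T : Type*} [TopologicalSpace T] [MeasurableSpace T] {μ : Measure T}

theorem forall_of_ae_of_isClosed [μ.IsOpenPosMeasure] {p : T → Prop} (hp : IsClosed {t | p t})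
    (h : ∀ᵐ t ∂μ, p t) (t : T) : p t :=
  hp.closure_subset_iff.mpr subset_rfl ((Measure.dense_of_ae h).closure_eq ▸ Set.mem_univ t)

variable [CompactSpace T] [OpensMeasurableSpace T] [IsFiniteMeasure μ]

theorem integrable_of_continuous {E : Type*} [NormedAddCommGroup E] {f : T → E}
    (hf : Continuous f) : Integrable f μ :=
  hf.integrable_of_hasCompactSupport (HasCompactSupport.of_compactSpace f)

theorem eq_zero_of_integral_nonpos [μ.IsOpenPosMeasure] {f : T → ℝ} (hf : Continuous f)
    (hnonneg : ∀ t, 0 ≤ f t) (h : ∫ t, f t ∂μ ≤ 0) (t : T) : f t = 0 := by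
  have hae := (integral_eq_zero_iff_of_nonneg hnonneg (integrable_of_continuous hf)).mp
    (le_antisymm h (integral_nonneg hnonneg))
  exact congrFun ((hf.ae_eq_iff_eq μ continuous_zero).mp hae) t

variable {κ : Type*} [Fintype κ] [DecidableEq κ] {X Y : T → Matrix κ κ ℂ}

theorem integrable_trace_inv_mul_sub (hX : Continuous X) (hXp : ∀ t, (X t).PosDef)
    (hY : EssBdd Y μ) : Integrable (fun t => ((X t)⁻¹ * (Y t - X t)).trace.re) μ :=
  ((EssBdd.of_continuous (continuous_inv_of_posDef hX hXp)).mul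
    (hY.sub (.of_continuous hX))).integrable_trace_re

theorem integral_logDet_le (hX : Continuous X) (hXp : ∀ t, (X t).PosDef) (hY : EssBdd Y μ)
    (hYp : ∀ᵐ t ∂μ, (Y t).PosDef) (hYl : Integrable (fun t => logDet (Y t)) μ) :
    ∫ t, logDet (Y t) ∂μ
      ≤ ∫ t, logDet (X t) ∂μ + ∫ t, ((X t)⁻¹ * (Y t - X t)).trace.re ∂μ := by
  have hXl : Integrable (fun t => logDet (X t)) μ :=
    integrable_of_continuous (continuous_logDet hX hXp)
  have htr := integrable_trace_inv_mul_sub hX hXp hY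
  rw [← integral_add hXl htr]
  refine integral_mono_ae hYl (hXl.add htr) ?_
  filter_upwards [hYp] with t ht using logDet_le_add_trace (hXp t) ht

theorem ae_eq_of_integral_logDet_eq (hX : Continuous X) (hXp : ∀ t, (X t).PosDef)
    (hY : EssBdd Y μ) (hYp : ∀ᵐ t ∂μ, (Y t).PosDef)
    (hYl : Integrable (fun t => logDet (Y t)) μ)
    (h : ∫ t, logDet (Y t) ∂μ
      = ∫ t, logDet (X t) ∂μ + ∫ t, ((X t)⁻¹ * (Y t - X t)).trace.re ∂μ) : Y =ᵐ[μ] X := by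
  have hXl : Integrable (fun t => logDet (X t)) μ :=
    integrable_of_continuous (continuous_logDet hX hXp)
  have htr := integrable_trace_inv_mul_sub hX hXp hY
  have hle : (fun t => logDet (Y t)) ≤ᵐ[μ]
      (fun t => logDet (X t)) + fun t => ((X t)⁻¹ * (Y t - X t)).trace.re := by
    filter_upwards [hYp] with t ht using logDet_le_add_trace (hXp t) ht
  rw [← integral_add' hXl htr] at h
  filter_upwards [(integral_eq_iff_of_ae_le hYl (hXl.add htr) hle).mp h, hYp] with t heq ht
    using eq_of_logDet_eq_add_trace (hXp t) ht heq

end IntegralsOnCompactSpaces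

section CircleMeasure

open Set

theorem circleMeasure_apply {s : Set Circle} (hs : MeasurableSet s) :
    circleMeasure s = ENNReal.ofReal (1 / (2 * Real.pi)) *
      volume (Circle.exp ⁻¹' s ∩ Ioc (-Real.pi) Real.pi) := by
  have hexp := Circle.exp.continuous.measurable
  rw [circleMeasure, Measure.map_apply hexp hs, Measure.smul_apply,
    Measure.restrict_apply (hexp hs), smul_eq_mul]

instance : IsProbabilityMeasure circleMeasure where
  measure_univ := by
    rw [circleMeasure_apply MeasurableSet.univ, preimage_univ, univ_inter, Real.volume_Ioc,
      ← ENNReal.ofReal_mul (by positivity), ← ENNReal.ofReal_one]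
    congr 1
    field_simp
    ring

instance : circleMeasure.IsOpenPosMeasure := by
  refine ⟨fun U hU ⟨z, hz⟩ => ?_⟩
  have hz' : Complex.arg z ∈ Circle.exp ⁻¹' U := by simpa using hz
  obtain ⟨a, ha, haU⟩ := exists_Ioc_subset_of_mem_nhds
    ((hU.preimage Circle.exp.continuous).mem_nhds hz')
    ⟨-Real.pi, Complex.neg_pi_lt_arg z⟩
  have hsub : Ioc (max a (-Real.pi)) (Complex.arg z) ⊆
      Circle.exp ⁻¹' U ∩ Ioc (-Real.pi) Real.pi := fun x hx =>
    ⟨haU ⟨(le_max_left _ _).trans_lt hx.1, hx.2⟩,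
      (le_max_right _ _).trans_lt hx.1, hx.2.trans (Complex.arg_le_pi _)⟩
  have hpos : volume (Ioc (max a (-Real.pi)) (Complex.arg z)) ≠ 0 := by
    simpa using ⟨ha, Complex.neg_pi_lt_arg z⟩
  rw [circleMeasure_apply hU.measurableSet]
  exact mul_ne_zero (by simpa using Real.pi_pos) fun h => hpos (measure_mono_null hsub h)

theorem measurePreserving_inv_circle :
    MeasurePreserving (fun z : Circle => z⁻¹) circleMeasure circleMeasure := by
  have hinv : Measurable fun z : Circle => z⁻¹ := continuous_inv.measurable
  refine ⟨hinv, Measure.ext fun s hs => ?_⟩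
  have hreflect : Circle.exp ⁻¹' ((fun z : Circle => z⁻¹) ⁻¹' s) ∩ Ioc (-Real.pi) Real.pi
      = Neg.neg ⁻¹' (Circle.exp ⁻¹' s ∩ Ico (-Real.pi) Real.pi) := by
    ext x
    simp only [mem_inter_iff, mem_preimage, Circle.exp_neg, mem_Ioc, mem_Ico]
    grind
  rw [Measure.map_apply hinv hs, circleMeasure_apply hs, circleMeasure_apply (hinv hs), hreflect,
    (Measure.measurePreserving_neg volume).measure_preimage
      ((Circle.exp.continuous.measurable hs).inter measurableSet_Ico).nullMeasurableSet]
  exact congrArg _ (measure_congr ((Filter.EventuallyEq.refl _ _).inter Ico_ae_eq_Ioc))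

variable {E : Type*} [NormedAddCommGroup E]

theorem integral_circleMeasure [NormedSpace ℝ E] {f : Circle → E} (hf : Continuous f) :
    ∫ z, f z ∂circleMeasure
      = (1 / (2 * Real.pi)) • ∫ θ in (-Real.pi)..Real.pi, f (Circle.exp θ) := by
  rw [circleMeasure, integral_map Circle.exp.continuous.aemeasurable
    hf.aestronglyMeasurable, integral_smul_measure,
    intervalIntegral.integral_of_le (by linarith [Real.pi_pos]),
    ENNReal.toReal_ofReal (by positivity)]

theorem integral_inv_circle [NormedSpace ℝ E] (f : Circle → E) :
    ∫ z, f z⁻¹ ∂circleMeasure = ∫ z, f z ∂circleMeasure :=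
  measurePreserving_inv_circle.integral_comp (Homeomorph.inv Circle).measurableEmbedding f

theorem integral_circle_eq_center [NormedSpace ℂ E] [CompleteSpace E] {f : ℂ → E}
    (hf : ∀ w : ℂ, ‖w‖ ≤ 1 → DifferentiableAt ℂ f w) :
    ∫ z : Circle, f z ∂circleMeasure = f 0 := by
  have hc : Continuous fun z : Circle => f z :=
    continuous_iff_continuousAt.mpr fun z =>
      ContinuousAt.comp (f := fun z : Circle => (z : ℂ)) (hf z z.norm_coe.le).continuousAt
        (by fun_prop)
  have hmean : Real.circleAverage f 0 1 = f 0 :=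
    circleAverage_of_differentiable_on_off_countable countable_empty
      (fun w hw => (hf w (by simpa using hw)).continuousAt.continuousWithinAt)
      (fun w hw => hf w (by simpa using (mem_ball_zero_iff.mp hw.1).le))
  have hper : Function.Periodic (fun θ : ℝ => f (Circle.exp θ)) (2 * Real.pi) := fun θ => by simp
  have hshift := hper.intervalIntegral_add_eq (-Real.pi) 0
  rw [show -Real.pi + 2 * Real.pi = Real.pi by ring, zero_add] at hshift
  rw [integral_circleMeasure hc, ← hmean, Real.circleAverage_def, hshift]
  simp [circleMap]

end CircleMeasure

section RealMatrices

variable {p q r : ℕ}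

theorem toC_mul (M : Matrix (Fin p) (Fin q) ℝ) (N : Matrix (Fin q) (Fin r) ℝ) :
    toC (M * N) = toC M * toC N :=
  Matrix.map_mul (f := Complex.ofRealHom)

theorem toC_add (M N : Matrix (Fin p) (Fin q) ℝ) : toC (M + N) = toC M + toC N := by
  ext; simp [toC]

theorem toC_sub (M N : Matrix (Fin p) (Fin q) ℝ) : toC (M - N) = toC M - toC N := by
  ext; simp [toC]

theorem toC_smul (c : ℝ) (M : Matrix (Fin p) (Fin q) ℝ) : toC (c • M) = (c : ℂ) • toC M := by
  ext; simp [toC]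

theorem toC_zero : toC (0 : Matrix (Fin p) (Fin q) ℝ) = 0 := by
  ext; simp [toC]

theorem toC_one : toC (1 : Matrix (Fin p) (Fin p) ℝ) = 1 :=
  Matrix.map_one _ Complex.ofReal_zero Complex.ofReal_one

theorem toC_transpose (M : Matrix (Fin p) (Fin q) ℝ) : toC Mᵀ = (toC M)ᴴ := by
  ext; simp [toC]

theorem isHermitian_toC {M : Matrix (Fin p) (Fin p) ℝ} (hM : M.IsSymm) : (toC M).IsHermitian := by
  rw [IsHermitian, ← toC_transpose, hM.eq]

theorem transpose_conjTranspose_toC (M : Matrix (Fin p) (Fin q) ℝ) : (toC M)ᴴᵀ = toC M := by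
  ext; simp [toC]

theorem toC_injective : Function.Injective (toC : Matrix (Fin p) (Fin q) ℝ → _) :=
  Matrix.map_injective Complex.ofReal_injective

theorem trace_toC_re (M : Matrix (Fin p) (Fin p) ℝ) : (toC M).trace.re = M.trace := by
  simp [toC, Matrix.trace]

theorem continuous_toC : Continuous (toC : Matrix (Fin p) (Fin q) ℝ → _) :=
  continuous_id.matrix_map Complex.continuous_ofReal

theorem isUnit_det_toC {M : Matrix (Fin p) (Fin p) ℝ} (hM : IsUnit M.det) :
    IsUnit (toC M).det := by
  rw [show (toC M).det = M.det from (Complex.ofRealHom.map_det M).symm]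
  exact hM.map Complex.ofRealHom

theorem posSemidef_toC {M : Matrix (Fin p) (Fin p) ℝ} (hM : M.PosSemidef) :
    (toC M).PosSemidef := by
  obtain ⟨C, rfl⟩ := exists_eq_conjTranspose_mul_self hM
  rw [conjTranspose_eq_transpose_of_trivial, toC_mul, toC_transpose]
  exact posSemidef_conjTranspose_mul_self _

theorem posDef_toC {M : Matrix (Fin p) (Fin p) ℝ} (hM : M.PosDef) : (toC M).PosDef := by
  refine (posSemidef_toC hM.posSemidef).posDef_iff_isUnit.mpr ?_
  exact (Matrix.isUnit_iff_isUnit_det _).mpr (isUnit_det_toC (isUnit_det_of_posDef hM))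

end RealMatrices

section ConjugateSymmetry

variable {p q r : ℕ}

/-- Conjugate symmetric matrix functions on the circle, those with `F (z⁻¹)` the entrywise conjugate
of `F z`: the Fourier coefficients are real. The entrywise conjugate of `M` is written `Mᴴᵀ`. -/
def ConjSymm (F : Circle → Matrix (Fin p) (Fin q) ℂ) : Prop := ∀ z, F z⁻¹ = (F z)ᴴᵀ

theorem ConjSymm.mul {F : Circle → Matrix (Fin p) (Fin q) ℂ}
    {H : Circle → Matrix (Fin q) (Fin r) ℂ} (hF : ConjSymm F) (hH : ConjSymm H) :
    ConjSymm fun z => F z * H z := fun z => by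
  beta_reduce; rw [hF z, hH z, conjTranspose_mul, transpose_mul]

theorem ConjSymm.add {F H : Circle → Matrix (Fin p) (Fin q) ℂ}
    (hF : ConjSymm F) (hH : ConjSymm H) : ConjSymm fun z => F z + H z := fun z => by
  beta_reduce; rw [hF z, hH z, conjTranspose_add, transpose_add]

theorem ConjSymm.sub {F H : Circle → Matrix (Fin p) (Fin q) ℂ}
    (hF : ConjSymm F) (hH : ConjSymm H) : ConjSymm fun z => F z - H z := fun z => by
  beta_reduce; rw [hF z, hH z, conjTranspose_sub, transpose_sub]

theorem ConjSymm.inv {F : Circle → Matrix (Fin p) (Fin p) ℂ} (hF : ConjSymm F) :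
    ConjSymm fun z => (F z)⁻¹ := fun z => by
  beta_reduce; rw [hF z, conjTranspose_nonsing_inv, transpose_nonsing_inv]

theorem ConjSymm.conjTranspose {F : Circle → Matrix (Fin p) (Fin q) ℂ} (hF : ConjSymm F) :
    ConjSymm fun z => (F z)ᴴ := fun z => by
  beta_reduce; rw [hF z]; ext i j; simp

theorem conjSymm_toC (M : Matrix (Fin p) (Fin q) ℝ) : ConjSymm fun _ => toC M :=
  fun _ => (transpose_conjTranspose_toC M).symm

theorem conjSymm_coe_smul_one :
    ConjSymm fun z : Circle => ((z : ℂ) • (1 : Matrix (Fin p) (Fin p) ℂ)) := fun z => by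
  beta_reduce; rw [Circle.coe_inv_eq_conj, conjTranspose_smul, transpose_smul]
  simp

theorem ConjSymm.exists_toC_eq_integral {F : Circle → Matrix (Fin p) (Fin q) ℂ}
    (hF : ConjSymm F) : ∃ M : Matrix (Fin p) (Fin q) ℝ,
      toC M = Matrix.of fun i j => ∫ z, F z i j ∂circleMeasure := by
  refine ⟨Matrix.of fun i j => (∫ z, F z i j ∂circleMeasure).re, ?_⟩
  ext i j
  have hentry (z : Circle) : F z⁻¹ i j = (starRingEnd ℂ) (F z i j) := by simp [hF z]
  have hreal : (starRingEnd ℂ) (∫ z, F z i j ∂circleMeasure) = ∫ z, F z i j ∂circleMeasure := by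
    rw [← integral_conj, ← integral_inv_circle fun z => F z i j]
    simp only [hentry]
  simpa [toC] using Complex.conj_eq_iff_re.mp hreal

end ConjugateSymmetry

section TransferFunction

variable {n m : ℕ} {A : Matrix (Fin n) (Fin n) ℝ} {B : Matrix (Fin n) (Fin m) ℝ}

/-- The resolvent `(zI - A)⁻¹` of a real matrix on the unit circle, so that `G(z)` is its product
with `B`. -/
def circleResolvent (A : Matrix (Fin n) (Fin n) ℝ) (z : Circle) : Matrix (Fin n) (Fin n) ℂ :=
  ((z : ℂ) • (1 : Matrix (Fin n) (Fin n) ℂ) - toC A)⁻¹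

theorem IsStable.isUnit_det_sub (hA : IsStable A) {w : ℂ} (hw : 1 ≤ ‖w‖) :
    IsUnit (w • (1 : Matrix (Fin n) (Fin n) ℂ) - toC A).det := by
  rw [← Matrix.isUnit_iff_isUnit_det]
  by_contra hsing
  refine absurd (hA w ?_) hw.not_gt
  rwa [spectrum.mem_iff, Algebra.algebraMap_eq_smul_one]

theorem IsStable.isUnit_det_circle_sub (hA : IsStable A) (z : Circle) :
    IsUnit ((z : ℂ) • (1 : Matrix (Fin n) (Fin n) ℂ) - toC A).det :=
  hA.isUnit_det_sub z.norm_coe.ge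

theorem continuous_circleResolvent (hA : IsStable A) : Continuous (circleResolvent A) :=
  continuous_inv_of_isUnit_det (by fun_prop) hA.isUnit_det_circle_sub

theorem continuous_G (hA : IsStable A) : Continuous (G A B) :=
  (continuous_circleResolvent hA).matrix_mul continuous_const

theorem conjSymm_circleResolvent : ConjSymm (circleResolvent A) :=
  (conjSymm_coe_smul_one.sub (conjSymm_toC A)).inv

theorem conjSymm_G : ConjSymm (G A B) := conjSymm_circleResolvent.mul (conjSymm_toC B)

/-- The function `G^* Λ G` on the unit circle. The map `Λ ↦ G^* Λ G` is the adjoint of the moment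
map `Φ ↦ ∫ G Φ G^*` for the trace pairings. -/
def gammaAdj (A : Matrix (Fin n) (Fin n) ℝ) (B : Matrix (Fin n) (Fin m) ℝ)
    (Λ : Matrix (Fin n) (Fin n) ℝ) (z : Circle) : Matrix (Fin m) (Fin m) ℂ :=
  (G A B z)ᴴ * toC Λ * G A B z

theorem continuous_gammaAdj (hA : IsStable A) (Λ : Matrix (Fin n) (Fin n) ℝ) :
    Continuous (gammaAdj A B Λ) :=
  ((continuous_G hA).matrix_conjTranspose.matrix_mul continuous_const).matrix_mul (continuous_G hA)

theorem conjSymm_gammaAdj (Λ : Matrix (Fin n) (Fin n) ℝ) : ConjSymm (gammaAdj A B Λ) :=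
  (conjSymm_G.conjTranspose.mul (conjSymm_toC Λ)).mul conjSymm_G

theorem isHermitian_gammaAdj {Λ : Matrix (Fin n) (Fin n) ℝ} (hΛ : Λ.IsSymm) (z : Circle) :
    (gammaAdj A B Λ z).IsHermitian :=
  isHermitian_conjTranspose_mul_mul _ (isHermitian_toC hΛ)

theorem gammaAdj_add (Λ Λ' : Matrix (Fin n) (Fin n) ℝ) (z : Circle) :
    gammaAdj A B (Λ + Λ') z = gammaAdj A B Λ z + gammaAdj A B Λ' z := by
  simp only [gammaAdj, toC_add, Matrix.mul_add, Matrix.add_mul]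

theorem gammaAdj_sub (Λ Λ' : Matrix (Fin n) (Fin n) ℝ) (z : Circle) :
    gammaAdj A B (Λ - Λ') z = gammaAdj A B Λ z - gammaAdj A B Λ' z := by
  simp only [gammaAdj, toC_sub, Matrix.mul_sub, Matrix.sub_mul]

theorem gammaAdj_smul (c : ℝ) (Λ : Matrix (Fin n) (Fin n) ℝ) (z : Circle) :
    gammaAdj A B (c • Λ) z = (c : ℂ) • gammaAdj A B Λ z := by
  simp only [gammaAdj, toC_smul, Matrix.mul_smul, Matrix.smul_mul]

end TransferFunction

section Moments

variable {n m : ℕ} {A : Matrix (Fin n) (Fin n) ℝ} {B : Matrix (Fin n) (Fin m) ℝ}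
  {Φ Φ' : Circle → Matrix (Fin m) (Fin m) ℂ}

theorem EssBdd.G_mul_mul_conjTranspose (hA : IsStable A) (hΦ : EssBdd Φ circleMeasure) :
    EssBdd (fun z => G A B z * Φ z * (G A B z)ᴴ) circleMeasure :=
  ((EssBdd.of_continuous (continuous_G hA)).mul hΦ).mul
    (.of_continuous (continuous_G hA).matrix_conjTranspose)

theorem EssBdd.gammaAdj_mul (hA : IsStable A) (hΦ : EssBdd Φ circleMeasure)
    (Λ : Matrix (Fin n) (Fin n) ℝ) : EssBdd (fun z => gammaAdj A B Λ z * Φ z) circleMeasure :=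
  (EssBdd.of_continuous (continuous_gammaAdj hA Λ)).mul hΦ

theorem trace_toC_mul_moment (hA : IsStable A) (hΦ : EssBdd Φ circleMeasure)
    (Λ : Matrix (Fin n) (Fin n) ℝ) :
    (toC Λ * moment A B Φ).trace.re
      = ∫ z, (gammaAdj A B Λ z * Φ z).trace.re ∂circleMeasure := by
  have hre : ∫ z, (gammaAdj A B Λ z * Φ z).trace.re ∂circleMeasure
      = (∫ z, (gammaAdj A B Λ z * Φ z).trace ∂circleMeasure).re :=
    integral_re (hΦ.gammaAdj_mul hA Λ).integrable_trace
  rw [moment, (hΦ.G_mul_mul_conjTranspose hA).trace_mul_integral, hre]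
  congr 2
  funext z
  rw [gammaAdj, ← Matrix.mul_assoc, Matrix.trace_mul_comm]
  simp only [Matrix.mul_assoc]

theorem trace_mul_eq_integral_gammaAdj (hA : IsStable A) (hΦ : EssBdd Φ circleMeasure)
    {S : Matrix (Fin n) (Fin n) ℝ} (hS : moment A B Φ = toC S) (Λ : Matrix (Fin n) (Fin n) ℝ) :
    (Λ * S).trace = ∫ z, (gammaAdj A B Λ z * Φ z).trace.re ∂circleMeasure := by
  rw [← trace_toC_mul_moment hA hΦ, hS, ← toC_mul, trace_toC_re]

theorem moment_add (hA : IsStable A) (hΦ : EssBdd Φ circleMeasure)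
    (hΦ' : EssBdd Φ' circleMeasure) :
    moment A B (Φ + Φ') = moment A B Φ + moment A B Φ' := by
  ext i j
  simp only [moment, of_apply, Matrix.add_apply]
  rw [← integral_add ((hΦ.G_mul_mul_conjTranspose hA).integrable i j)
    ((hΦ'.G_mul_mul_conjTranspose hA).integrable i j)]
  simp only [Pi.add_apply, Matrix.mul_add, Matrix.add_mul, Matrix.add_apply]

theorem moment_smul (c : ℝ) (Φ : Circle → Matrix (Fin m) (Fin m) ℂ) :
    moment A B (c • Φ) = (c : ℂ) • moment A B Φ := by
  ext i j
  simp only [moment, of_apply, Matrix.smul_apply, Pi.smul_apply, Matrix.mul_smul, Matrix.smul_mul]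
  rw [integral_smul, Complex.real_smul, smul_eq_mul]

theorem moment_zero : moment A B (0 : Circle → Matrix (Fin m) (Fin m) ℂ) = 0 := by
  ext i j; simp [moment]

theorem isHermitian_moment (hΦ : ∀ z, (Φ z).IsHermitian) : (moment A B Φ).IsHermitian := by
  ext i j
  have hentry (z : Circle) : (starRingEnd ℂ) ((G A B z * Φ z * (G A B z)ᴴ) j i)
      = (G A B z * Φ z * (G A B z)ᴴ) i j :=
    (isHermitian_mul_mul_conjTranspose (G A B z) (hΦ z)).apply i j
  simp only [moment, conjTranspose_apply, of_apply]
  rw [RCLike.star_def, ← integral_conj]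
  simp only [hentry]

theorem ConjSymm.exists_toC_eq_moment (hΦ : ConjSymm Φ) :
    ∃ M : Matrix (Fin n) (Fin n) ℝ, toC M = moment A B Φ :=
  ((conjSymm_G.mul hΦ).mul conjSymm_G.conjTranspose).exists_toC_eq_integral

end Moments

section RangeGamma

variable {n m : ℕ} {A : Matrix (Fin n) (Fin n) ℝ} {B : Matrix (Fin n) (Fin m) ℝ}
  {M : Matrix (Fin n) (Fin n) ℝ} {Φ : Circle → Matrix (Fin m) (Fin m) ℂ}

theorem continuous_and_isHermitian_of_mem_contDensitySpan (hΦ : Φ ∈ contDensitySpan m) :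
    Continuous Φ ∧ ∀ z, (Φ z).IsHermitian := by
  induction hΦ using Submodule.span_induction with
  | mem Φ hΦ => exact ⟨hΦ.continuous, fun z => (hΦ.posSemidef z).1⟩
  | zero => exact ⟨continuous_const, fun _ => isHermitian_zero⟩
  | add Φ Φ' _ _ h h' => exact ⟨h.1.add h'.1, fun z => (h.2 z).add (h'.2 z)⟩
  | smul c Φ _ h => exact ⟨h.1.const_smul c, fun z => isHermitian_ofReal_smul (h.2 z) c⟩

theorem exists_continuous_density_of_mem_rangeGamma (hM : M ∈ rangeGamma A B) :
    ∃ Φ : Circle → Matrix (Fin m) (Fin m) ℂ,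
      Continuous Φ ∧ (∀ z, (Φ z).IsHermitian) ∧ moment A B Φ = toC M := by
  obtain ⟨Φ, hΦ, hMΦ⟩ := hM
  obtain ⟨hc, hH⟩ := continuous_and_isHermitian_of_mem_contDensitySpan hΦ
  exact ⟨Φ, hc, hH, hMΦ.symm⟩

/-- The range of `Γ` as a real subspace of the `n × n` matrices. -/
def rangeGammaSubmodule (hA : IsStable A) (B : Matrix (Fin n) (Fin m) ℝ) :
    Submodule ℝ (Matrix (Fin n) (Fin n) ℝ) where
  carrier := rangeGamma A B
  add_mem' := by
    rintro M N ⟨Φ, hΦ, hM⟩ ⟨Φ', hΦ', hN⟩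
    refine ⟨Φ + Φ', add_mem hΦ hΦ', ?_⟩
    rw [moment_add hA
      (.of_continuous (continuous_and_isHermitian_of_mem_contDensitySpan hΦ).1)
      (.of_continuous (continuous_and_isHermitian_of_mem_contDensitySpan hΦ').1), toC_add, hM, hN]
  zero_mem' := ⟨0, zero_mem _, by rw [toC_zero, moment_zero]⟩
  smul_mem' := by
    rintro c M ⟨Φ, hΦ, hM⟩
    exact ⟨c • Φ, Submodule.smul_mem _ c hΦ, by rw [moment_smul, toC_smul, hM]⟩

theorem isSymm_of_mem_rangeGamma (hM : M ∈ rangeGamma A B) : M.IsSymm := by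
  obtain ⟨Φ, -, hH, hMΦ⟩ := exists_continuous_density_of_mem_rangeGamma hM
  refine toC_injective ?_
  rw [toC_transpose, ← hMΦ]
  exact isHermitian_moment hH

theorem exists_mem_rangeGamma (hΦ : IsContDensity Φ) :
    ∃ M ∈ rangeGamma A B, moment A B Φ = toC M := by
  have hs : ConjSymm Φ := fun z => by rw [hΦ.real z, (hΦ.posSemidef z).1.eq]
  obtain ⟨M, hM⟩ := hs.exists_toC_eq_moment (A := A) (B := B)
  exact ⟨M, ⟨Φ, Submodule.subset_span hΦ, hM⟩, hM.symm⟩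

theorem eq_zero_of_gammaAdj_eq_zero (hA : IsStable A) (hM : M ∈ rangeGamma A B)
    (h : ∀ z, gammaAdj A B M z = 0) : M = 0 := by
  obtain ⟨Φ, hc, -, hMΦ⟩ := exists_continuous_density_of_mem_rangeGamma hM
  rw [← trace_conjTranspose_mul_self_eq_zero_iff, conjTranspose_eq_transpose_of_trivial,
    (isSymm_of_mem_rangeGamma hM).eq, trace_mul_eq_integral_gammaAdj hA (.of_continuous hc) hMΦ]
  simp only [h, Matrix.zero_mul, trace_zero, Complex.zero_re, integral_zero]

end RangeGamma

section StateFeedback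

section Algebra

variable {ν β 𝕜 : Type*} [Fintype ν] [DecidableEq ν] [Fintype β] [DecidableEq β] [CommRing 𝕜]
  {A S : Matrix ν ν 𝕜} {B : Matrix ν β 𝕜}

/-- The matrix `R = (Bᵀ S⁻¹ B)⁻¹`, the input covariance of the closed loop obtained with
`feedbackGain`. -/
def feedbackCovariance (B : Matrix ν β 𝕜) (S : Matrix ν ν 𝕜) : Matrix β β 𝕜 :=
  (Bᵀ * S⁻¹ * B)⁻¹

/-- The state feedback `F = -R Bᵀ S⁻¹ A` for which the closed loop `A + B F` has state
covariance `S`. -/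
def feedbackGain (A : Matrix ν ν 𝕜) (B : Matrix ν β 𝕜) (S : Matrix ν ν 𝕜) : Matrix β ν 𝕜 :=
  -(feedbackCovariance B S * Bᵀ * S⁻¹ * A)

theorem sub_closedLoop_mul_mul_transpose {H : Matrix β ν 𝕜} (hS : S.IsSymm) (hSu : IsUnit S.det)
    (hBu : IsUnit (Bᵀ * S⁻¹ * B).det) (hH : S - A * S * Aᵀ = B * H + Hᵀ * Bᵀ) :
    S - (A + B * feedbackGain A B S) * S * (A + B * feedbackGain A B S)ᵀ
      = B * feedbackCovariance B S * Bᵀ := by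
  set R := feedbackCovariance B S with hR
  -- `A + B F = P A` for a projection `P` along the range of `B`.
  set P : Matrix ν ν 𝕜 := 1 - B * R * Bᵀ * S⁻¹ with hP
  have hclosed : A + B * feedbackGain A B S = P * A := by
    rw [hP, feedbackGain, Matrix.sub_mul, Matrix.one_mul, Matrix.mul_neg, ← sub_eq_add_neg]
    simp only [Matrix.mul_assoc, hR]
  have hPB : P * B = 0 := by
    have hRB : R * (Bᵀ * S⁻¹ * B) = 1 := nonsing_inv_mul _ hBu
    rw [hP, Matrix.sub_mul, Matrix.one_mul, sub_eq_zero]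
    calc B = B * (R * (Bᵀ * S⁻¹ * B)) := by rw [hRB, Matrix.mul_one]
      _ = B * R * Bᵀ * S⁻¹ * B := by simp only [Matrix.mul_assoc]
  have hPS : P * S = S - B * R * Bᵀ := by
    rw [hP, Matrix.sub_mul, Matrix.one_mul, nonsing_inv_mul_cancel_right _ _ hSu]
  have hSP : S * Pᵀ = S - B * R * Bᵀ := by
    have hRs : Rᵀ = R := by
      rw [hR, feedbackCovariance, transpose_nonsing_inv, transpose_mul, transpose_mul,
        transpose_nonsing_inv, hS.eq, transpose_transpose, Matrix.mul_assoc]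
    calc S * Pᵀ = (P * S)ᵀ := by rw [transpose_mul, hS.eq]
      _ = S - B * R * Bᵀ := by
        rw [hPS, transpose_sub, hS.eq, transpose_mul, transpose_mul, transpose_transpose, hRs,
          ← Matrix.mul_assoc]
  clear_value P
  have hBP : Bᵀ * Pᵀ = 0 := by rw [← transpose_mul, hPB, transpose_zero]
  have hASA : A * S * Aᵀ = S - (B * H + Hᵀ * Bᵀ) := by rw [← hH, sub_sub_cancel]
  have hPHP : P * (B * H + Hᵀ * Bᵀ) * Pᵀ = 0 := by
    rw [Matrix.mul_add, ← Matrix.mul_assoc P B, hPB, Matrix.zero_mul, zero_add, Matrix.mul_assoc,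
      Matrix.mul_assoc, hBP, Matrix.mul_zero, Matrix.mul_zero]
  rw [hclosed, sub_eq_iff_eq_add, ← sub_eq_iff_eq_add']
  calc S - B * R * Bᵀ = P * S * Pᵀ := by
        rw [hPS, Matrix.sub_mul, hSP, Matrix.mul_assoc _ Bᵀ, hBP, Matrix.mul_zero, sub_zero]
    _ = P * (A * S * Aᵀ) * Pᵀ := by
        rw [hASA, Matrix.mul_sub, Matrix.sub_mul _ _ Pᵀ, hPHP, sub_zero]
    _ = P * A * S * (P * A)ᵀ := by rw [transpose_mul]; simp only [Matrix.mul_assoc]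

end Algebra

section Stability

variable {ν β : Type*} [Fintype ν] [Fintype β]

theorem mem_spectrum_iff_conjTranspose_mulVec [DecidableEq ν] {D : Matrix ν ν ℂ} {μ : ℂ} :
    μ ∈ spectrum ℂ D ↔ ∃ v ≠ 0, Dᴴ *ᵥ v = star μ • v := by
  rw [spectrum.mem_iff, Algebra.algebraMap_eq_smul_one, Matrix.isUnit_iff_isUnit_det,
    isUnit_iff_ne_zero, not_not, ← star_eq_zero, ← det_conjTranspose,
    ← exists_mulVec_eq_zero_iff]
  simp only [conjTranspose_sub, conjTranspose_smul, conjTranspose_one, sub_mulVec, smul_mulVec,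
    one_mulVec, sub_eq_zero, eq_comm]

theorem conjTranspose_mulVec_eq_zero_of_lyapunov {S D : Matrix ν ν ℂ} {B : Matrix ν β ℂ}
    {R : Matrix β β ℂ} (hS : S.PosSemidef) (hR : R.PosDef) (h : S - D * S * Dᴴ = B * R * Bᴴ)
    {μ : ℂ} (hμ : 1 ≤ ‖μ‖) {v : ν → ℂ} (hv : Dᴴ *ᵥ v = star μ • v) : Bᴴ *ᵥ v = 0 := by
  have hquad : quad S v - ‖μ‖ ^ 2 * quad S v = quad R (Bᴴ *ᵥ v) := by
    have := congrArg (quad · v) h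
    simpa [quad_sub, quad_mul_mul_conjTranspose, hv, quad_smul_vec] using this
  by_contra hne
  have hRpos := (posDef_iff_quad hR.1).mp hR _ hne
  have hSnonneg := (posSemidef_iff_quad hS.1).mp hS v
  nlinarith [mul_nonneg (show 0 ≤ ‖μ‖ ^ 2 - 1 by nlinarith) hSnonneg]

variable {n m : ℕ} {A S : Matrix (Fin n) (Fin n) ℝ} {B : Matrix (Fin n) (Fin m) ℝ}
  {R : Matrix (Fin m) (Fin m) ℝ} {F : Matrix (Fin m) (Fin n) ℝ}

theorem IsStable.add_mul_of_lyapunov (hA : IsStable A) (hS : S.PosSemidef) (hR : R.PosDef)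
    (h : S - (A + B * F) * S * (A + B * F)ᵀ = B * R * Bᵀ) : IsStable (A + B * F) := by
  intro μ hμ
  by_contra! hμ1
  obtain ⟨v, hv, hDv⟩ := mem_spectrum_iff_conjTranspose_mulVec.mp hμ
  have hC : toC S - toC (A + B * F) * toC S * (toC (A + B * F))ᴴ
      = toC B * toC R * (toC B)ᴴ := by
    simp only [← toC_transpose, ← toC_mul, ← toC_sub, h]
  have hBv : (toC B)ᴴ *ᵥ v = 0 :=
    conjTranspose_mulVec_eq_zero_of_lyapunov (posSemidef_toC hS) (posDef_toC hR) hC hμ1 hDv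
  have hAv : (toC A)ᴴ *ᵥ v = star μ • v := by
    rw [← hDv, toC_add, toC_mul, conjTranspose_add, conjTranspose_mul, add_mulVec,
      ← mulVec_mulVec, hBv, mulVec_zero, add_zero]
  exact (hA μ (mem_spectrum_iff_conjTranspose_mulVec.mpr ⟨v, hv, hAv⟩)).not_ge hμ1

end Stability

section SpectralIntegral

variable {n m : ℕ} {A : Matrix (Fin n) (Fin n) ℝ} {B : Matrix (Fin n) (Fin m) ℝ}

theorem IsStable.isUnit_det_one_sub_smul (hA : IsStable A) {w : ℂ} (hw : ‖w‖ ≤ 1) :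
    IsUnit (1 - w • toC A).det := by
  rcases eq_or_ne w 0 with rfl | hw0
  · simp
  have hfactor : (1 : Matrix (Fin n) (Fin n) ℂ) - w • toC A
      = w • (w⁻¹ • (1 : Matrix (Fin n) (Fin n) ℂ) - toC A) := by
    rw [smul_sub, smul_smul, mul_inv_cancel₀ hw0, one_smul]
  rw [hfactor, det_smul]
  refine ((isUnit_iff_ne_zero.mpr hw0).pow _).mul (hA.isUnit_det_sub ?_)
  rw [norm_inv]
  exact (one_le_inv₀ (norm_pos_iff.mpr hw0)).mpr hw

theorem circleResolvent_inv (hA : IsStable A) (z : Circle) :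
    circleResolvent A z⁻¹ = (z : ℂ) • (1 - (z : ℂ) • toC A)⁻¹ := by
  refine Matrix.inv_eq_right_inv ?_
  rw [Circle.coe_inv, Matrix.mul_smul, ← Matrix.smul_mul, smul_sub, smul_smul,
    mul_inv_cancel₀ z.coe_ne_zero, one_smul,
    Matrix.mul_nonsing_inv _ (hA.isUnit_det_one_sub_smul z.norm_coe.le)]

theorem integral_circleResolvent_mul {κ : Type*} (hA : IsStable A) (C : Matrix (Fin n) κ ℂ)
    (i : Fin n) (j : κ) : ∫ z, (circleResolvent A z * C) i j ∂circleMeasure = 0 := by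
  set f : ℂ → ℂ := fun w => ((w • (1 - w • toC A)⁻¹) * C) i j with hf
  have hdiff (w : ℂ) (hw : ‖w‖ ≤ 1) : DifferentiableAt ℂ f w := by
    refine differentiableAt_matrix_mul (F := fun w : ℂ => w • (1 - w • toC A)⁻¹)
      (H := fun _ : ℂ => C) (fun k l => ?_) (fun k l => differentiableAt_const (C k l)) i j
    refine differentiableAt_id.mul (differentiableAt_matrix_inv
      (F := fun w : ℂ => 1 - w • toC A) (fun a b => ?_) (hA.isUnit_det_one_sub_smul hw) k l)
    simp only [Matrix.sub_apply, Matrix.smul_apply, smul_eq_mul]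
    fun_prop
  calc ∫ z, (circleResolvent A z * C) i j ∂circleMeasure
      = ∫ z : Circle, f z ∂circleMeasure := by
        rw [← integral_inv_circle]
        simp only [circleResolvent_inv hA, hf]
    _ = f 0 := integral_circle_eq_center hdiff
    _ = 0 := by simp [hf]

theorem circleResolvent_mul_lyapunov_mul (hA : IsStable A) {S : Matrix (Fin n) (Fin n) ℂ}
    (hS : S.IsHermitian) (z : Circle) :
    circleResolvent A z * (S - toC A * S * (toC A)ᴴ) * (circleResolvent A z)ᴴ
      = S + circleResolvent A z * (toC A * S) + (circleResolvent A z * (toC A * S))ᴴ := by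
  set Z : Matrix (Fin n) (Fin n) ℂ := (z : ℂ) • (1 : Matrix (Fin n) (Fin n) ℂ) - toC A with hZ
  have hRZ : circleResolvent A z * Z = 1 := nonsing_inv_mul _ (hA.isUnit_det_circle_sub z)
  have hZR : Zᴴ * (circleResolvent A z)ᴴ = 1 := by
    rw [← conjTranspose_mul, hRZ, conjTranspose_one]
  have hzz : (z : ℂ) * (starRingEnd ℂ) (z : ℂ) = 1 := by
    rw [Complex.mul_conj, Circle.normSq_coe, Complex.ofReal_one]
  have hexpand : S - toC A * S * (toC A)ᴴ
      = Z * S * Zᴴ + toC A * S * Zᴴ + Z * S * (toC A)ᴴ := by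
    rw [show toC A = (z : ℂ) • (1 : Matrix (Fin n) (Fin n) ℂ) - Z by rw [hZ, sub_sub_cancel]]
    simp only [conjTranspose_sub, conjTranspose_smul, conjTranspose_one, Matrix.sub_mul,
      Matrix.mul_sub, Matrix.smul_mul, Matrix.mul_smul, Matrix.one_mul, Matrix.mul_one, smul_sub,
      smul_smul, RCLike.star_def]
    rw [mul_comm, hzz, one_smul]
    abel
  rw [hexpand, Matrix.mul_add, Matrix.mul_add, Matrix.add_mul, Matrix.add_mul]
  congr 2
  · rw [Matrix.mul_assoc Z, ← Matrix.mul_assoc _ Z, hRZ, Matrix.one_mul, Matrix.mul_assoc, hZR,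
      Matrix.mul_one]
  · rw [Matrix.mul_assoc, Matrix.mul_assoc (toC A * S), hZR, Matrix.mul_one]
  · rw [Matrix.mul_assoc Z, ← Matrix.mul_assoc _ Z, hRZ, Matrix.one_mul]
    simp only [conjTranspose_mul, hS.eq]

theorem integral_circleResolvent_lyapunov (hA : IsStable A) {S : Matrix (Fin n) (Fin n) ℂ}
    (hS : S.IsHermitian) (i j : Fin n) :
    ∫ z, (circleResolvent A z * (S - toC A * S * (toC A)ᴴ) * (circleResolvent A z)ᴴ) i j
      ∂circleMeasure = S i j := by
  have hT : Continuous fun z => circleResolvent A z * (toC A * S) :=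
    (continuous_circleResolvent hA).matrix_mul continuous_const
  have hconj : ∫ z, (circleResolvent A z * (toC A * S))ᴴ i j ∂circleMeasure = 0 := by
    simp only [conjTranspose_apply, RCLike.star_def]
    rw [integral_conj, integral_circleResolvent_mul hA, map_zero]
  simp only [circleResolvent_mul_lyapunov_mul hA hS, Matrix.add_apply]
  rw [integral_add, integral_add, integral_circleResolvent_mul hA, hconj]
  · simp
  · exact integrable_const _
  · exact integrable_of_continuous (hT.matrix_elem i j)
  · exact integrable_of_continuous (continuous_const.add (hT.matrix_elem i j))
  · exact integrable_of_continuous (hT.matrix_conjTranspose.matrix_elem i j)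

end SpectralIntegral

section FeasibleDensity

variable {n m : ℕ} {A S : Matrix (Fin n) (Fin n) ℝ} {B : Matrix (Fin n) (Fin m) ℝ}
  {F : Matrix (Fin m) (Fin n) ℝ}

/-- The transfer function `I + F (zI - A - B F)⁻¹ B` from the closed loop input to the plant
input. -/
def feedbackTransfer (A : Matrix (Fin n) (Fin n) ℝ) (B : Matrix (Fin n) (Fin m) ℝ)
    (F : Matrix (Fin m) (Fin n) ℝ) (z : Circle) : Matrix (Fin m) (Fin m) ℂ :=
  1 + toC F * G (A + B * F) B z

theorem continuous_feedbackTransfer (hF : IsStable (A + B * F)) :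
    Continuous (feedbackTransfer A B F) :=
  continuous_const.add (continuous_const.matrix_mul (continuous_G hF))

theorem conjSymm_feedbackTransfer : ConjSymm (feedbackTransfer A B F) := by
  have hone : ConjSymm fun _ => (1 : Matrix (Fin m) (Fin m) ℂ) := by
    simpa only [toC_one] using conjSymm_toC (1 : Matrix (Fin m) (Fin m) ℝ)
  exact hone.add ((conjSymm_toC F).mul conjSymm_G)

theorem G_mul_feedbackTransfer (hA : IsStable A) (hF : IsStable (A + B * F)) (z : Circle) :
    G A B z * feedbackTransfer A B F z = G (A + B * F) B z := by
  have hresolvent : circleResolvent A z * (toC B * toC F) * circleResolvent (A + B * F) z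
      = circleResolvent (A + B * F) z - circleResolvent A z := by
    have hBF : toC B * toC F = ((z : ℂ) • (1 : Matrix (Fin n) (Fin n) ℂ) - toC A) -
        ((z : ℂ) • (1 : Matrix (Fin n) (Fin n) ℂ) - toC (A + B * F)) := by
      rw [toC_add, toC_mul]; abel
    rw [hBF, Matrix.mul_sub, circleResolvent, circleResolvent,
      nonsing_inv_mul _ (hA.isUnit_det_circle_sub z), Matrix.sub_mul, Matrix.one_mul,
      mul_nonsing_inv_cancel_right _ _ (hF.isUnit_det_circle_sub z)]
  calc G A B z * feedbackTransfer A B F z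
      = circleResolvent A z * toC B
        + circleResolvent A z * (toC B * toC F) * circleResolvent (A + B * F) z * toC B := by
        simp only [G, feedbackTransfer, circleResolvent, Matrix.mul_add, Matrix.mul_one,
          Matrix.mul_assoc]
    _ = G (A + B * F) B z := by rw [hresolvent, Matrix.sub_mul, add_sub_cancel]; rfl

theorem isUnit_feedbackTransfer (hA : IsStable A) (hF : IsStable (A + B * F)) (z : Circle) :
    IsUnit (feedbackTransfer A B F z) := by
  have hinv : (1 - toC F * G A B z) * feedbackTransfer A B F z = 1 := by
    rw [Matrix.sub_mul, Matrix.one_mul, Matrix.mul_assoc, G_mul_feedbackTransfer hA hF,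
      feedbackTransfer, add_sub_cancel_right]
  exact IsUnit.of_mul_eq_one_right _ hinv

theorem moment_feedbackTransfer (hA : IsStable A) (hF : IsStable (A + B * F)) (hS : S.IsSymm)
    {R : Matrix (Fin m) (Fin m) ℝ} (h : S - (A + B * F) * S * (A + B * F)ᵀ = B * R * Bᵀ) :
    moment A B (fun z => feedbackTransfer A B F z * toC R * (feedbackTransfer A B F z)ᴴ)
      = toC S := by
  ext i j
  rw [← integral_circleResolvent_lyapunov hF (isHermitian_toC hS) i j, ← toC_transpose, ← toC_mul,
    ← toC_mul, ← toC_sub, h, moment, of_apply]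
  congr 1
  funext z
  calc (G A B z * (feedbackTransfer A B F z * toC R * (feedbackTransfer A B F z)ᴴ)
        * (G A B z)ᴴ) i j
      = ((G A B z * feedbackTransfer A B F z) * toC R
        * (G A B z * feedbackTransfer A B F z)ᴴ) i j := by
        simp only [conjTranspose_mul, Matrix.mul_assoc]
    _ = _ := by
        rw [G_mul_feedbackTransfer hA hF, G, ← circleResolvent]
        simp only [conjTranspose_mul, toC_mul, toC_transpose, Matrix.mul_assoc]

theorem mulVec_injective_of_rank {ν β K : Type*} [Fintype β] [Field K] {B : Matrix ν β K}
    (hB : B.rank = Fintype.card β) : Function.Injective B.mulVec := by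
  have hdim := LinearMap.finrank_range_add_finrank_ker B.mulVecLin
  rw [← Matrix.rank, hB, Module.finrank_fintype_fun_eq_card] at hdim
  have hker : Module.finrank K (LinearMap.ker B.mulVecLin) = 0 := by omega
  exact LinearMap.ker_eq_bot.mp (Submodule.finrank_eq_zero.mp hker)

theorem exists_posDef_moment_eq (hA : IsStable A) (hB : B.rank = m) (hS : S.PosDef)
    (hfeas : ∃ H : Matrix (Fin m) (Fin n) ℝ, S - A * S * Aᵀ = B * H + Hᵀ * Bᵀ) :
    ∃ Φ : Circle → Matrix (Fin m) (Fin m) ℂ, Continuous Φ ∧ ConjSymm Φ ∧ (∀ z, (Φ z).PosDef) ∧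
      moment A B Φ = toC S := by
  obtain ⟨H, hH⟩ := hfeas
  have hSs : S.IsSymm := isHermitian_iff_isSymm.mp hS.1
  have hRi : (Bᵀ * S⁻¹ * B).PosDef := by
    rw [← conjTranspose_eq_transpose_of_trivial]
    exact hS.inv.conjTranspose_mul_mul_same (mulVec_injective_of_rank (by simpa using hB))
  have hR : (feedbackCovariance B S).PosDef := hRi.inv
  have hlyap := sub_closedLoop_mul_mul_transpose hSs (isUnit_det_of_posDef hS)
    (isUnit_det_of_posDef hRi) hH
  have hF : IsStable (A + B * feedbackGain A B S) := hA.add_mul_of_lyapunov hS.posSemidef hR hlyap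
  have hN := continuous_feedbackTransfer hF
  refine ⟨_, (hN.matrix_mul continuous_const).matrix_mul hN.matrix_conjTranspose,
    (conjSymm_feedbackTransfer.mul (conjSymm_toC _)).mul conjSymm_feedbackTransfer.conjTranspose,
    fun z => ?_, moment_feedbackTransfer hA hF hSs hlyap⟩
  exact (posDef_toC hR).mul_mul_conjTranspose_same
    (Matrix.vecMul_injective_of_isUnit (isUnit_feedbackTransfer hA hF z))

end FeasibleDensity

end StateFeedback

section SpectralDensity

theorem continuous_of_continuous_comp_exp {X : Type*} [TopologicalSpace X] {f : Circle → X}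
    (hf : Continuous fun θ : ℝ => f (Circle.exp θ)) : Continuous f := by
  have hquot : Topology.IsQuotientMap Circle.exp :=
    isLocalHomeomorph_circleExp.isOpenMap.isQuotientMap Circle.exp.continuous
      fun z => ⟨_, Circle.exp_arg z⟩
  exact hquot.continuous_iff.mpr hf

variable {m : ℕ} {Φ Ψ : Circle → Matrix (Fin m) (Fin m) ℂ}

theorem continuous_of_differentiable_comp_exp
    (hΨ : ∀ i j, Differentiable ℝ fun θ : ℝ => Ψ (Circle.exp θ) i j) : Continuous Ψ :=
  continuous_of_continuous_comp_exp (continuous_matrix fun i j => (hΨ i j).continuous)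

theorem IsRational.differentiable (hΨ : IsRational Ψ) (i j : Fin m) :
    Differentiable ℝ fun θ : ℝ => Ψ (Circle.exp θ) i j := by
  obtain ⟨P, q, hPq⟩ := hΨ
  simp only [fun z => (hPq z).2 i j]
  have hpoly (p : Polynomial ℂ) :
      Differentiable ℝ fun θ : ℝ => p.eval ((Circle.exp θ : Circle) : ℂ) := by
    simp only [Circle.coe_exp]
    exact (p.differentiable.restrictScalars ℝ).comp (by fun_prop)
  exact (hpoly _).div (hpoly q) fun θ => (hPq _).1

theorem posDef_ofReal_smul_one {κ : Type*} [DecidableEq κ] {α : ℝ} (hα : 0 < α) :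
    ((α : ℂ) • (1 : Matrix κ κ ℂ)).PosDef :=
  PosDef.one.smul (by exact_mod_cast hα)

theorem IsBddCoerciveDensity.ae_posDef (hΦ : IsBddCoerciveDensity Φ) :
    ∀ᵐ z ∂circleMeasure, (Φ z).PosDef := by
  obtain ⟨α, hα, hαΦ⟩ := hΦ.coercive
  filter_upwards [hαΦ] with z hz
  simpa only [sub_add_cancel] using hz.add (posDef_ofReal_smul_one hα)

theorem IsBddCoerciveDensity.posDef_of_continuous (hΨ : IsBddCoerciveDensity Ψ)
    (hc : Continuous Ψ) (z : Circle) : (Ψ z).PosDef := by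
  obtain ⟨α, hα, hαΨ⟩ := hΨ.coercive
  have hz : (Ψ z - (α : ℂ) • (1 : Matrix (Fin m) (Fin m) ℂ)).PosSemidef :=
    forall_of_ae_of_isClosed (isClosed_posSemidef.preimage (hc.sub continuous_const))
      (hαΨ.mono fun _ h => h.posSemidef) z
  simpa only [sub_add_cancel] using PosDef.posSemidef_add hz (posDef_ofReal_smul_one hα)

theorem IsBddCoerciveDensity.conjSymm_of_continuous (hΨ : IsBddCoerciveDensity Ψ)
    (hc : Continuous Ψ) : ConjSymm Ψ := fun z => by
  rw [(hΨ.posDef_of_continuous hc z).1.eq]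
  exact forall_of_ae_of_isClosed (p := fun z => Ψ z⁻¹ = (Ψ z)ᵀ)
    (isClosed_eq (hc.comp continuous_inv) hc.matrix_transpose) hΨ.real z

theorem exists_posDef_sub_smul_one {T κ : Type*} [TopologicalSpace T] [CompactSpace T] [Finite κ]
    [DecidableEq κ] {X : T → Matrix κ κ ℂ} (hc : Continuous X) (hp : ∀ t, (X t).PosDef) :
    ∃ α : ℝ, 0 < α ∧ ∀ t, (X t - (α : ℂ) • (1 : Matrix κ κ ℂ)).PosDef := by
  cases nonempty_fintype κ
  obtain ⟨c, hc⟩ := exists_smul_sub_posSemidef hc hp (Y := fun _ => 1) continuous_const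
    fun _ => isHermitian_one
  have hc' : 0 < |c| + 1 := by positivity
  refine ⟨(|c| + 1)⁻¹, inv_pos.mpr hc', fun t => ?_⟩
  refine (posDef_iff_quad ((hp t).1.sub (isHermitian_ofReal_smul isHermitian_one _))).mpr
    fun v hv => ?_
  have hX := (posDef_iff_quad (hp t).1).mp (hp t) v hv
  have hcX := (posSemidef_iff_quad (hc t).1).mp (hc t) v
  rw [quad_sub, quad_smul] at hcX ⊢
  rw [sub_pos, inv_mul_lt_iff₀ hc']
  nlinarith [le_abs_self c]

theorem isBddCoerciveDensity_of_continuous (hc : Continuous Φ) (hp : ∀ z, (Φ z).PosDef)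
    (hs : ConjSymm Φ) : IsBddCoerciveDensity Φ where
  aemeasurable i j := (hc.matrix_elem i j).measurable.aemeasurable
  real := .of_forall fun z => by rw [hs z, (hp z).1.eq]
  bounded :=
    let ⟨β, hβ⟩ := exists_smul_sub_posSemidef (X := fun _ => 1) continuous_const
      (fun _ => PosDef.one) hc fun z => (hp z).1
    ⟨β, .of_forall hβ⟩
  coercive :=
    let ⟨α, hα, hαΦ⟩ := exists_posDef_sub_smul_one hc hp
    ⟨α, hα, .of_forall hαΦ⟩

theorem isContDensity_of_conjSymm (hc : Continuous Φ) (hp : ∀ z, (Φ z).PosSemidef)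
    (hs : ConjSymm Φ) : IsContDensity Φ where
  continuous := hc
  real z := by rw [hs z, (hp z).1.eq]
  posSemidef := hp

theorem IsBddCoerciveDensity.essBdd (hΦ : IsBddCoerciveDensity Φ) : EssBdd Φ circleMeasure :=
  fun i j => by
  obtain ⟨β, hβ⟩ := hΦ.bounded
  refine memLp_top_of_bound (hΦ.aemeasurable i j).aestronglyMeasurable (β * m) ?_
  filter_upwards [hβ, hΦ.ae_posDef] with z hβz hz
  have htrace := (Complex.nonneg_iff.mp hβz.trace_nonneg).1
  simp only [trace_sub, trace_smul, trace_one, Complex.sub_re, smul_eq_mul, Fintype.card_fin,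
    Complex.re_ofReal_mul, Complex.natCast_re] at htrace
  linarith [norm_apply_le_trace_re hz.posSemidef i j]

theorem IsBddCoerciveDensity.aestronglyMeasurable_logDet (hΦ : IsBddCoerciveDensity Φ) :
    AEStronglyMeasurable (fun z => logDet (Φ z)) circleMeasure := by
  have hdet : AEMeasurable (fun z => (Φ z).det) circleMeasure := by
    simp only [Matrix.det_apply']
    exact Finset.aemeasurable_fun_sum _ fun σ _ =>
      (Finset.aemeasurable_fun_prod _ fun k _ => hΦ.aemeasurable _ _).const_mul _
  exact (Complex.measurable_re.comp_aemeasurable hdet).log.aestronglyMeasurable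

theorem IsBddCoerciveDensity.integrable_logDet (hΦ : IsBddCoerciveDensity Φ) :
    Integrable (fun z => logDet (Φ z)) circleMeasure := by
  obtain ⟨α, hα, hαΦ⟩ := hΦ.coercive
  have hupper : Integrable (fun z => (Φ z).trace.re - Fintype.card (Fin m)) circleMeasure :=
    hΦ.essBdd.integrable_trace_re.sub (integrable_const _)
  refine integrable_of_le_of_le hΦ.aestronglyMeasurable_logDet
    (g₁ := fun _ => logDet ((α : ℂ) • (1 : Matrix (Fin m) (Fin m) ℂ))) ?_ ?_
    (integrable_const _) hupper
  · filter_upwards [hαΦ, hΦ.ae_posDef] with z hαz hz using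
      logDet_mono (posDef_ofReal_smul_one hα) hz hαz.posSemidef
  · filter_upwards [hΦ.ae_posDef] with z hz using logDet_le_trace_sub_card hz

end SpectralDensity

section DualDomain

variable {n m : ℕ} {A : Matrix (Fin n) (Fin n) ℝ} {B : Matrix (Fin n) (Fin m) ℝ}
  {Ψ : Circle → Matrix (Fin m) (Fin m) ℂ} {Λ Λ' : Matrix (Fin n) (Fin n) ℝ}

/-- The function `Ψ⁻¹ + G^* Λ G`, whose pointwise inverse is `Φ°(Λ)`. -/
def phiOptInv (A : Matrix (Fin n) (Fin n) ℝ) (B : Matrix (Fin n) (Fin m) ℝ)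
    (Ψ : Circle → Matrix (Fin m) (Fin m) ℂ) (Λ : Matrix (Fin n) (Fin n) ℝ) (z : Circle) :
    Matrix (Fin m) (Fin m) ℂ :=
  (Ψ z)⁻¹ + gammaAdj A B Λ z

/-- `Ψ⁻¹ + G^* Λ G` is positive definite on the unit circle. When `W` is a spectral factor of `Ψ`,
this is the positivity condition of `𝓛₊`, freed of `W`. -/
def IsDualFeasible (A : Matrix (Fin n) (Fin n) ℝ) (B : Matrix (Fin n) (Fin m) ℝ)
    (Ψ : Circle → Matrix (Fin m) (Fin m) ℂ) (Λ : Matrix (Fin n) (Fin n) ℝ) : Prop :=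
  ∀ z, (phiOptInv A B Ψ Λ z).PosDef

theorem continuous_phiOptInv {T : Type*} [TopologicalSpace T] {L : T → Matrix (Fin n) (Fin n) ℝ}
    {ζ : T → Circle} (hA : IsStable A) (hΨ : Continuous Ψ) (hΨp : ∀ z, (Ψ z).PosDef)
    (hL : Continuous L) (hζ : Continuous ζ) :
    Continuous fun t => phiOptInv A B Ψ (L t) (ζ t) := by
  have hG : Continuous fun t => G A B (ζ t) := (continuous_G hA).comp hζ
  exact ((continuous_inv_of_posDef hΨ hΨp).comp hζ).add
    ((hG.matrix_conjTranspose.matrix_mul (continuous_toC.comp hL)).matrix_mul hG)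

theorem isHermitian_phiOptInv (hΨp : ∀ z, (Ψ z).PosDef) (hΛ : Λ.IsSymm) (z : Circle) :
    (phiOptInv A B Ψ Λ z).IsHermitian :=
  (hΨp z).inv.1.add (isHermitian_gammaAdj hΛ z)

theorem conjSymm_phiOptInv (hΨs : ConjSymm Ψ) (Λ : Matrix (Fin n) (Fin n) ℝ) :
    ConjSymm (phiOptInv A B Ψ Λ) :=
  hΨs.inv.add (conjSymm_gammaAdj Λ)

theorem phiOptInv_sub_phiOptInv (Λ Λ' : Matrix (Fin n) (Fin n) ℝ) (z : Circle) :
    phiOptInv A B Ψ Λ' z - phiOptInv A B Ψ Λ z = gammaAdj A B (Λ' - Λ) z := by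
  rw [phiOptInv, phiOptInv, gammaAdj_sub, add_sub_add_left_eq_sub]

theorem phiOptInv_zero (z : Circle) : phiOptInv A B Ψ 0 z = (Ψ z)⁻¹ := by
  simp [phiOptInv, gammaAdj, toC_zero]

theorem phiOptInv_convexCombination {a b : ℝ} (hab : a + b = 1)
    (Λ Λ' : Matrix (Fin n) (Fin n) ℝ) (z : Circle) :
    phiOptInv A B Ψ (a • Λ + b • Λ') z
      = (a : ℂ) • phiOptInv A B Ψ Λ z + (b : ℂ) • phiOptInv A B Ψ Λ' z := by
  obtain rfl := eq_sub_of_add_eq hab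
  simp only [phiOptInv, gammaAdj_add, gammaAdj_smul, Complex.ofReal_sub, Complex.ofReal_one]
  module

theorem isDualFeasible_of_posSemidef (hΨp : ∀ z, (Ψ z).PosDef) (hΛ : (toC Λ).PosSemidef) :
    IsDualFeasible A B Ψ Λ := fun z =>
  (hΨp z).inv.add_posSemidef (hΛ.conjTranspose_mul_mul_same (G A B z))

theorem IsDualFeasible.convexCombination (hΛ' : IsDualFeasible A B Ψ Λ')
    (hΛ : ∀ z, (phiOptInv A B Ψ Λ z).PosSemidef) {a b : ℝ} (hab : a + b = 1) (ha : 0 ≤ a)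
    (hb : 0 < b) : IsDualFeasible A B Ψ (a • Λ + b • Λ') := fun z => by
  rw [phiOptInv_convexCombination hab]
  exact PosDef.posSemidef_add ((hΛ z).smul (by exact_mod_cast ha))
    ((hΛ' z).smul (by exact_mod_cast hb))

theorem PhiOpt_eq_inv (Λ : Matrix (Fin n) (Fin n) ℝ) (z : Circle) :
    PhiOpt A B Ψ Λ z = (phiOptInv A B Ψ Λ z)⁻¹ := rfl

theorem IsDualFeasible.inv_PhiOpt (hΛ : IsDualFeasible A B Ψ Λ) (z : Circle) :
    (PhiOpt A B Ψ Λ z)⁻¹ = phiOptInv A B Ψ Λ z :=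
  Matrix.nonsing_inv_nonsing_inv _ (isUnit_det_of_posDef (hΛ z))

theorem IsDualFeasible.posDef_PhiOpt (hΛ : IsDualFeasible A B Ψ Λ) (z : Circle) :
    (PhiOpt A B Ψ Λ z).PosDef := (hΛ z).inv

theorem IsDualFeasible.continuous_PhiOpt (hΛ : IsDualFeasible A B Ψ Λ) (hA : IsStable A)
    (hΨ : Continuous Ψ) (hΨp : ∀ z, (Ψ z).PosDef) : Continuous (PhiOpt A B Ψ Λ) :=
  continuous_inv_of_posDef (continuous_phiOptInv hA hΨ hΨp continuous_const continuous_id) hΛ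

theorem IsDualFeasible.isBddCoerciveDensity_PhiOpt (hΛ : IsDualFeasible A B Ψ Λ)
    (hA : IsStable A) (hΨ : Continuous Ψ) (hΨp : ∀ z, (Ψ z).PosDef) (hΨs : ConjSymm Ψ) :
    IsBddCoerciveDensity (PhiOpt A B Ψ Λ) :=
  isBddCoerciveDensity_of_continuous (hΛ.continuous_PhiOpt hA hΨ hΨp) hΛ.posDef_PhiOpt
    (conjSymm_phiOptInv hΨs Λ).inv

end DualDomain

section SpectralFactor

variable {n m : ℕ} {A : Matrix (Fin n) (Fin n) ℝ} {B : Matrix (Fin n) (Fin m) ℝ}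
  {Ψ W : Circle → Matrix (Fin m) (Fin m) ℂ}

theorem IsSpectralFactor.isUnit (hW : IsSpectralFactor W Ψ) (hΨp : ∀ z, (Ψ z).PosDef)
    (z : Circle) : IsUnit (W z) := by
  have h : IsUnit (W z * (W z)ᴴ).det := hW z ▸ isUnit_det_of_posDef (hΨp z)
  rw [det_mul] at h
  exact (Matrix.isUnit_iff_isUnit_det _).mpr (isUnit_of_mul_isUnit_left h)

theorem IsSpectralFactor.conjTranspose_mul_inv_mul (hW : IsSpectralFactor W Ψ)
    (hΨp : ∀ z, (Ψ z).PosDef) (z : Circle) : (W z)ᴴ * (Ψ z)⁻¹ * W z = 1 := by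
  have hu := (Matrix.isUnit_iff_isUnit_det _).mp (hW.isUnit hΨp z)
  have hu' : IsUnit ((W z)ᴴ).det := by rw [det_conjTranspose]; exact hu.star
  rw [← hW z, Matrix.mul_inv_rev, ← Matrix.mul_assoc, Matrix.mul_nonsing_inv _ hu', Matrix.one_mul,
    Matrix.nonsing_inv_mul _ hu]

theorem Q_eq_congruence (hW : IsSpectralFactor W Ψ) (hΨp : ∀ z, (Ψ z).PosDef)
    (Λ : Matrix (Fin n) (Fin n) ℝ) (z : Circle) :
    Q A B W Λ z = (W z)ᴴ * phiOptInv A B Ψ Λ z * W z := by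
  rw [phiOptInv, Matrix.mul_add, Matrix.add_mul, hW.conjTranspose_mul_inv_mul hΨp, Q, gammaAdj]
  simp only [conjTranspose_mul, Matrix.mul_assoc]

theorem Q_add_smul_one_eq_congruence (hW : IsSpectralFactor W Ψ) (hΨp : ∀ z, (Ψ z).PosDef)
    (Λ : Matrix (Fin n) (Fin n) ℝ) (c : ℂ) (z : Circle) :
    Q A B W Λ z + c • (1 : Matrix (Fin m) (Fin m) ℂ)
      = (W z)ᴴ * (phiOptInv A B Ψ Λ z + c • (Ψ z)⁻¹) * W z := by
  rw [Matrix.mul_add, Matrix.add_mul, Q_eq_congruence hW hΨp, Matrix.mul_smul, Matrix.smul_mul,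
    hW.conjTranspose_mul_inv_mul hΨp]

theorem IsSpectralFactor.logDet_congruence (hW : IsSpectralFactor W Ψ) (hΨp : ∀ z, (Ψ z).PosDef)
    {X : Matrix (Fin m) (Fin m) ℂ} (hX : X.PosDef) (z : Circle) :
    logDet ((W z)ᴴ * X * W z) = logDet (Ψ z) + logDet X := by
  rw [RER.logDet_congruence (hW.isUnit hΨp z) hX, ← hW z]
  simp only [logDet, det_mul_comm]

theorem posDef_Q_iff (hW : IsSpectralFactor W Ψ) (hΨp : ∀ z, (Ψ z).PosDef)
    (Λ : Matrix (Fin n) (Fin n) ℝ) (z : Circle) :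
    (Q A B W Λ z).PosDef ↔ (phiOptInv A B Ψ Λ z).PosDef := by
  rw [Q_eq_congruence hW hΨp, ← star_eq_conjTranspose]
  exact (hW.isUnit hΨp z).posDef_star_left_conjugate_iff

theorem mem_LplusGamma_iff (hW : IsSpectralFactor W Ψ) (hΨp : ∀ z, (Ψ z).PosDef)
    {Λ : rangeGamma A B} : Λ ∈ LplusGamma A B W ↔ IsDualFeasible A B Ψ Λ.1 :=
  ⟨fun h z => (posDef_Q_iff hW hΨp _ z).mp (h.2 z),
    fun h => ⟨isSymm_of_mem_rangeGamma Λ.2, fun z => (posDef_Q_iff hW hΨp _ z).mpr (h z)⟩⟩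

theorem isOpen_LplusGamma (hA : IsStable A) (hW : IsSpectralFactor W Ψ) (hΨ : Continuous Ψ)
    (hΨp : ∀ z, (Ψ z).PosDef) : IsOpen (LplusGamma A B W) := by
  have hcont : Continuous fun p : rangeGamma A B × Circle => phiOptInv A B Ψ p.1 p.2 :=
    continuous_phiOptInv hA hΨ hΨp (continuous_subtype_val.comp continuous_fst) continuous_snd
  convert isOpen_setOf_forall_posDef hcont fun p =>
    isHermitian_phiOptInv hΨp (isSymm_of_mem_rangeGamma p.1.2) p.2 using 1
  exact Set.ext fun Λ => mem_LplusGamma_iff hW hΨp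

theorem posSemidef_phiOptInv_of_mem_closure (hA : IsStable A) (hW : IsSpectralFactor W Ψ)
    (hΨ : Continuous Ψ) (hΨp : ∀ z, (Ψ z).PosDef) {Λ : rangeGamma A B}
    (hΛ : Λ ∈ closure (LplusGamma A B W)) (z : Circle) : (phiOptInv A B Ψ Λ z).PosSemidef := by
  have hcont : Continuous fun Λ : rangeGamma A B => phiOptInv A B Ψ Λ z :=
    continuous_phiOptInv hA hΨ hΨp continuous_subtype_val continuous_const
  exact closure_minimal (fun Λ h => ((mem_LplusGamma_iff hW hΨp).mp h z).posSemidef)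
    (isClosed_posSemidef.preimage hcont) hΛ

end SpectralFactor

section Unboundedness

variable {n m : ℕ} {A : Matrix (Fin n) (Fin n) ℝ} {B : Matrix (Fin n) (Fin m) ℝ}
  {Φ Ψ W : Circle → Matrix (Fin m) (Fin m) ℂ}

theorem posSemidef_moment (hA : IsStable A) (hΦ : EssBdd Φ circleMeasure)
    (hp : ∀ z, (Φ z).PosSemidef) : (moment A B Φ).PosSemidef := by
  refine (posSemidef_iff_quad (isHermitian_moment fun z => (hp z).1)).mpr fun v => ?_
  have hbdd : EssBdd (fun z => vecMulVec v (star v) * (G A B z * Φ z * (G A B z)ᴴ))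
      circleMeasure :=
    (EssBdd.of_continuous continuous_const).mul (hΦ.G_mul_mul_conjTranspose hA)
  have hre := integral_re hbdd.integrable_trace
  simp only [RCLike.re_to_complex] at hre
  rw [← trace_mul_vecMulVec_star_re, Matrix.trace_mul_comm, moment,
    (hΦ.G_mul_mul_conjTranspose hA).trace_mul_integral, ← hre]
  exact integral_nonneg fun z => trace_mul_nonneg (posSemidef_vecMulVec_self_star v)
    ((hp z).mul_mul_conjTranspose_same _)

theorem eq_zero_of_G_eq_zero (hA : IsStable A) {z : Circle} (h : G A B z = 0) : B = 0 := by
  refine toC_injective ?_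
  rw [toC_zero, ← Matrix.mul_nonsing_inv_cancel_left _ (toC B) (hA.isUnit_det_circle_sub z)]
  exact (congrArg _ h).trans (Matrix.mul_zero _)

theorem moment_one_ne_zero (hA : IsStable A) (hB : B ≠ 0) :
    moment A B (fun _ => (1 : Matrix (Fin m) (Fin m) ℂ)) ≠ 0 := fun hzero => hB <| by
  have hpos (z : Circle) : (gammaAdj A B 1 z).PosSemidef := by
    rw [gammaAdj, toC_one, Matrix.mul_one]
    exact posSemidef_conjTranspose_mul_self _
  have hint := trace_mul_eq_integral_gammaAdj hA (.of_continuous continuous_const)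
    (hzero.trans toC_zero.symm) 1
  simp only [Matrix.mul_one, Matrix.mul_zero, trace_zero] at hint
  have htrace : (gammaAdj A B 1 1).trace.re = 0 := eq_zero_of_integral_nonpos
    (Complex.continuous_re.comp (continuous_gammaAdj hA 1).matrix_trace)
    (fun z => (Complex.nonneg_iff.mp (hpos z).trace_nonneg).1) hint.ge 1
  have hnorm : ((G A B 1)ᴴ * G A B 1).trace = 0 := by
    rw [← Matrix.mul_one (G A B 1)ᴴ, ← toC_one]
    exact Complex.ext htrace (Complex.nonneg_iff.mp (hpos 1).trace_nonneg).2.symm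
  exact eq_zero_of_G_eq_zero hA (trace_conjTranspose_mul_self_eq_zero_iff.mp hnorm)

theorem exists_posSemidef_mem_rangeGamma (hA : IsStable A) (hB : B ≠ 0) :
    ∃ M ∈ rangeGamma A B, M ≠ 0 ∧ (toC M).PosSemidef := by
  obtain ⟨M, hM, hMone⟩ := exists_mem_rangeGamma (A := A) (B := B)
    ⟨continuous_const, fun _ => transpose_one.symm, fun _ => PosSemidef.one⟩
  refine ⟨M, hM, ?_, hMone ▸ posSemidef_moment hA (.of_continuous continuous_const)
    fun _ => PosSemidef.one⟩
  rintro rfl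
  exact moment_one_ne_zero hA hB (hMone.trans toC_zero)

theorem unbounded_LplusGamma (hA : IsStable A) (hB : B ≠ 0) (hW : IsSpectralFactor W Ψ)
    (hΨp : ∀ z, (Ψ z).PosDef) :
    ¬ ∃ C : ℝ, ∀ Λ ∈ LplusGamma A B W, ∀ i j, |Λ.1 i j| ≤ C := by
  rintro ⟨C, hC⟩
  obtain ⟨M, hM, hM0, hMp⟩ := exists_posSemidef_mem_rangeGamma hA hB
  obtain ⟨i, j, hij⟩ : ∃ i j, M i j ≠ 0 := by
    by_contra! h
    exact hM0 (Matrix.ext h)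
  have hray {c : ℝ} (hc : 0 ≤ c) : c * |M i j| ≤ C := by
    have hfeas : IsDualFeasible A B Ψ (c • M) := isDualFeasible_of_posSemidef hΨp <| by
      rw [toC_smul]
      exact hMp.smul (by exact_mod_cast hc)
    have hbound : |(c • M) i j| ≤ C := hC ⟨c • M, (rangeGammaSubmodule hA B).smul_mem c hM⟩
      ((mem_LplusGamma_iff hW hΨp).mpr hfeas) i j
    rwa [Matrix.smul_apply, smul_eq_mul, abs_mul, abs_of_nonneg hc] at hbound
  have h := hray (c := (|C| + 1) / |M i j|) (by positivity)
  rw [div_mul_cancel₀ _ (abs_pos.mpr hij).ne'] at h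
  linarith [le_abs_self C]

end Unboundedness

section DualFunctional

variable {n m : ℕ} {A : Matrix (Fin n) (Fin n) ℝ} {B : Matrix (Fin n) (Fin m) ℝ}
  {S : Matrix (Fin n) (Fin n) ℝ} {Ψ W : Circle → Matrix (Fin m) (Fin m) ℂ}
  {Λ Λ' : Matrix (Fin n) (Fin n) ℝ} {ε : ℝ}

theorem continuous_phiOptInv_add_smul_inv (hA : IsStable A) (hΨ : Continuous Ψ)
    (hΨp : ∀ z, (Ψ z).PosDef) (Λ : Matrix (Fin n) (Fin n) ℝ) (ε : ℝ) :
    Continuous fun z => phiOptInv A B Ψ Λ z + (ε : ℂ) • (Ψ z)⁻¹ :=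
  (continuous_phiOptInv hA hΨ hΨp continuous_const continuous_id).add
    ((continuous_inv_of_posDef hΨ hΨp).fun_const_smul (ε : ℂ))

theorem Jreg_eq (hA : IsStable A) (hW : IsSpectralFactor W Ψ) (hΨ : Continuous Ψ)
    (hΨp : ∀ z, (Ψ z).PosDef) (hΛ : ∀ z, (phiOptInv A B Ψ Λ z + (ε : ℂ) • (Ψ z)⁻¹).PosDef) :
    Jreg A B S W ε Λ = (Λ * S).trace - ∫ z, logDet (Ψ z) ∂circleMeasure
      - ∫ z, logDet (phiOptInv A B Ψ Λ z + (ε : ℂ) • (Ψ z)⁻¹) ∂circleMeasure := by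
  have hΨl : Integrable (fun z => logDet (Ψ z)) circleMeasure :=
    integrable_of_continuous (continuous_logDet hΨ hΨp)
  have hdiff : Integrable (fun z => (Λ * S).trace - logDet (Ψ z)) circleMeasure :=
    (integrable_const _).sub hΨl
  have hΛl := integrable_of_continuous (μ := circleMeasure)
    (continuous_logDet (continuous_phiOptInv_add_smul_inv hA hΨ hΨp Λ ε) hΛ)
  have hpt (z : Circle) : (Λ * S).trace
        - Real.log (Q A B W Λ z + (ε : ℂ) • (1 : Matrix (Fin m) (Fin m) ℂ)).det.re
      = (Λ * S).trace - logDet (Ψ z) - logDet (phiOptInv A B Ψ Λ z + (ε : ℂ) • (Ψ z)⁻¹) := by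
    rw [Q_add_smul_one_eq_congruence hW hΨp, ← logDet, hW.logDet_congruence hΨp (hΛ z), sub_sub]
  simp only [Jreg, hpt]
  rw [integral_sub hdiff hΛl, integral_sub (integrable_const _) hΨl,
    integral_const, probReal_univ, one_smul]

theorem Jreg_zero (Λ : Matrix (Fin n) (Fin n) ℝ) : Jreg A B S W 0 Λ = J A B S W Λ := by
  simp [J, Jreg]

theorem J_eq (hA : IsStable A) (hW : IsSpectralFactor W Ψ) (hΨ : Continuous Ψ)
    (hΨp : ∀ z, (Ψ z).PosDef) (hΛ : IsDualFeasible A B Ψ Λ) :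
    J A B S W Λ = (Λ * S).trace - ∫ z, logDet (Ψ z) ∂circleMeasure
      - ∫ z, logDet (phiOptInv A B Ψ Λ z) ∂circleMeasure := by
  rw [← Jreg_zero, Jreg_eq hA hW hΨ hΨp (ε := 0) fun z => by simpa using hΛ z]
  simp

/-- The derivative of the dual functional at `Λ` in the direction `D`, that is
`tr (D S) - tr (D ∫ G Φ°(Λ) G^*)`. -/
def dualDeriv (A : Matrix (Fin n) (Fin n) ℝ) (B : Matrix (Fin n) (Fin m) ℝ)
    (S : Matrix (Fin n) (Fin n) ℝ) (Ψ : Circle → Matrix (Fin m) (Fin m) ℂ)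
    (Λ D : Matrix (Fin n) (Fin n) ℝ) : ℝ :=
  (D * S).trace - (toC D * moment A B (PhiOpt A B Ψ Λ)).trace.re

theorem continuous_dualDeriv (Λ : Matrix (Fin n) (Fin n) ℝ) :
    Continuous (dualDeriv A B S Ψ Λ) :=
  (continuous_id.matrix_mul continuous_const).matrix_trace.sub
    (Complex.continuous_re.comp (continuous_toC.matrix_mul continuous_const).matrix_trace)

theorem dualDeriv_smul (Λ D : Matrix (Fin n) (Fin n) ℝ) (c : ℝ) :
    dualDeriv A B S Ψ Λ (c • D) = c * dualDeriv A B S Ψ Λ D := by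
  simp only [dualDeriv, toC_smul, Matrix.smul_mul, trace_smul, smul_eq_mul, Complex.re_ofReal_mul]
  ring

theorem dualDeriv_eq_zero (hΛ : moment A B (PhiOpt A B Ψ Λ) = toC S)
    (D : Matrix (Fin n) (Fin n) ℝ) : dualDeriv A B S Ψ Λ D = 0 := by
  rw [dualDeriv, hΛ, ← toC_mul, trace_toC_re, sub_self]

theorem dualDeriv_eq (hA : IsStable A) (hΨ : Continuous Ψ) (hΨp : ∀ z, (Ψ z).PosDef)
    (hΛ : IsDualFeasible A B Ψ Λ) (D : Matrix (Fin n) (Fin n) ℝ) :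
    dualDeriv A B S Ψ Λ D = (D * S).trace
      - ∫ z, ((phiOptInv A B Ψ Λ z)⁻¹ * gammaAdj A B D z).trace.re ∂circleMeasure := by
  rw [dualDeriv, trace_toC_mul_moment hA (.of_continuous (hΛ.continuous_PhiOpt hA hΨ hΨp))]
  simp only [Matrix.trace_mul_comm (gammaAdj A B D _), PhiOpt_eq_inv]

theorem integral_trace_inv_mul_add_smul_inv_sub (hA : IsStable A) (hΨ : Continuous Ψ)
    (hΨp : ∀ z, (Ψ z).PosDef) (hΛ : IsDualFeasible A B Ψ Λ) (Λ' : Matrix (Fin n) (Fin n) ℝ)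
    (ε : ℝ) :
    ∫ z, ((phiOptInv A B Ψ Λ z)⁻¹ *
        (phiOptInv A B Ψ Λ' z + (ε : ℂ) • (Ψ z)⁻¹ - phiOptInv A B Ψ Λ z)).trace.re ∂circleMeasure
      = ((Λ' - Λ) * S).trace - dualDeriv A B S Ψ Λ (Λ' - Λ)
        + ε * ∫ z, ((phiOptInv A B Ψ Λ z)⁻¹ * (Ψ z)⁻¹).trace.re ∂circleMeasure := by
  have hpt (z : Circle) : ((phiOptInv A B Ψ Λ z)⁻¹ *
      (phiOptInv A B Ψ Λ' z + (ε : ℂ) • (Ψ z)⁻¹ - phiOptInv A B Ψ Λ z)).trace.re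
      = ((phiOptInv A B Ψ Λ z)⁻¹ * gammaAdj A B (Λ' - Λ) z).trace.re
        + ε * ((phiOptInv A B Ψ Λ z)⁻¹ * (Ψ z)⁻¹).trace.re := by
    rw [add_sub_right_comm, phiOptInv_sub_phiOptInv, Matrix.mul_add, trace_add, Complex.add_re,
      Matrix.mul_smul, trace_smul, smul_eq_mul, Complex.re_ofReal_mul]
  have hint {Y : Circle → Matrix (Fin m) (Fin m) ℂ} (hY : Continuous Y) :
      Integrable (fun z => ((phiOptInv A B Ψ Λ z)⁻¹ * Y z).trace.re) circleMeasure :=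
    (EssBdd.of_continuous ((hΛ.continuous_PhiOpt hA hΨ hΨp).matrix_mul hY)).integrable_trace_re
  simp only [hpt]
  rw [integral_add (hint (continuous_gammaAdj hA _))
    ((hint (continuous_inv_of_posDef hΨ hΨp)).const_mul ε), integral_const_mul,
    dualDeriv_eq hA hΨ hΨp hΛ, sub_sub_cancel]

theorem J_add_dualDeriv_le_Jreg (hA : IsStable A) (hW : IsSpectralFactor W Ψ) (hΨ : Continuous Ψ)
    (hΨp : ∀ z, (Ψ z).PosDef) (hΛ : IsDualFeasible A B Ψ Λ)
    (hΛ' : ∀ z, (phiOptInv A B Ψ Λ' z + (ε : ℂ) • (Ψ z)⁻¹).PosDef) :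
    J A B S W Λ + dualDeriv A B S Ψ Λ (Λ' - Λ)
      - ε * ∫ z, ((phiOptInv A B Ψ Λ z)⁻¹ * (Ψ z)⁻¹).trace.re ∂circleMeasure
      ≤ Jreg A B S W ε Λ' := by
  have hc : Continuous (phiOptInv A B Ψ Λ) :=
    continuous_phiOptInv hA hΨ hΨp continuous_const continuous_id
  have hc' := continuous_phiOptInv_add_smul_inv (B := B) hA hΨ hΨp Λ' ε
  have htangent := integral_logDet_le (μ := circleMeasure) hc hΛ (.of_continuous hc')
    (.of_forall hΛ') (integrable_of_continuous (continuous_logDet hc' hΛ'))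
  rw [integral_trace_inv_mul_add_smul_inv_sub (S := S) hA hΨ hΨp hΛ, Matrix.sub_mul,
    trace_sub] at htangent
  rw [J_eq hA hW hΨ hΨp hΛ, Jreg_eq hA hW hΨ hΨp hΛ']
  linarith

theorem J_add_dualDeriv_le (hA : IsStable A) (hW : IsSpectralFactor W Ψ) (hΨ : Continuous Ψ)
    (hΨp : ∀ z, (Ψ z).PosDef) (hΛ : IsDualFeasible A B Ψ Λ) (hΛ' : IsDualFeasible A B Ψ Λ') :
    J A B S W Λ + dualDeriv A B S Ψ Λ (Λ' - Λ) ≤ J A B S W Λ' := by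
  have h := J_add_dualDeriv_le_Jreg (S := S) (ε := 0) hA hW hΨ hΨp hΛ (Λ' := Λ')
    fun z => by simpa using hΛ' z
  rwa [zero_mul, sub_zero, Jreg_zero] at h

theorem eq_of_J_add_dualDeriv_eq (hA : IsStable A) (hW : IsSpectralFactor W Ψ)
    (hΨ : Continuous Ψ) (hΨp : ∀ z, (Ψ z).PosDef) (hΛ : IsDualFeasible A B Ψ Λ)
    (hΛ' : IsDualFeasible A B Ψ Λ') (hmem : Λ ∈ rangeGamma A B) (hmem' : Λ' ∈ rangeGamma A B)
    (h : J A B S W Λ + dualDeriv A B S Ψ Λ (Λ' - Λ) = J A B S W Λ') : Λ' = Λ := by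
  have hc (L : Matrix (Fin n) (Fin n) ℝ) : Continuous (phiOptInv A B Ψ L) :=
    continuous_phiOptInv hA hΨ hΨp continuous_const continuous_id
  rw [J_eq hA hW hΨ hΨp hΛ, J_eq hA hW hΨ hΨp hΛ', dualDeriv_eq hA hΨ hΨp hΛ, Matrix.sub_mul,
    trace_sub] at h
  have hae : phiOptInv A B Ψ Λ' =ᵐ[circleMeasure] phiOptInv A B Ψ Λ :=
    ae_eq_of_integral_logDet_eq (hc Λ) hΛ (.of_continuous (hc Λ')) (.of_forall hΛ')
      (integrable_of_continuous (continuous_logDet (hc Λ') hΛ')) <| by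
        simp only [phiOptInv_sub_phiOptInv]
        linarith
  have heq := ((hc Λ').ae_eq_iff_eq circleMeasure (hc Λ)).mp hae
  refine sub_eq_zero.mp (eq_zero_of_gammaAdj_eq_zero hA
    ((rangeGammaSubmodule hA B).sub_mem hmem' hmem) fun z => ?_)
  rw [← phiOptInv_sub_phiOptInv (Ψ := Ψ), heq, sub_self]

end DualFunctional

section SublevelSets

open Filter Topology

variable {n m : ℕ} {A : Matrix (Fin n) (Fin n) ℝ} {B : Matrix (Fin n) (Fin m) ℝ}
  {S : Matrix (Fin n) (Fin n) ℝ} {Ψ W Φ X : Circle → Matrix (Fin m) (Fin m) ℂ}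

theorem trace_mul_eq_integral_phiOptInv (hA : IsStable A) (hΨ : Continuous Ψ)
    (hΨp : ∀ z, (Ψ z).PosDef) (hX : EssBdd X circleMeasure) {M : Matrix (Fin n) (Fin n) ℝ}
    (hXM : moment A B X = toC M) (Λ : Matrix (Fin n) (Fin n) ℝ) :
    (Λ * M).trace = ∫ z, (phiOptInv A B Ψ Λ z * X z).trace.re ∂circleMeasure
      - ∫ z, ((Ψ z)⁻¹ * X z).trace.re ∂circleMeasure := by
  have hint {Y : Circle → Matrix (Fin m) (Fin m) ℂ} (hY : Continuous Y) :
      Integrable (fun z => (Y z * X z).trace.re) circleMeasure :=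
    ((EssBdd.of_continuous hY).mul hX).integrable_trace_re
  have hc : Continuous (phiOptInv A B Ψ Λ) :=
    continuous_phiOptInv hA hΨ hΨp continuous_const continuous_id
  rw [trace_mul_eq_integral_gammaAdj hA hX hXM,
    ← integral_sub (hint hc) (hint (continuous_inv_of_posDef hΨ hΨp))]
  simp only [phiOptInv, Matrix.add_mul, trace_add, Complex.add_re, add_sub_cancel_left]

theorem integral_trace_mul_nonneg {F : Circle → Matrix (Fin m) (Fin m) ℂ}
    (hF : ∀ z, (F z).PosSemidef) (hX : ∀ z, (X z).PosSemidef) :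
    0 ≤ ∫ z, (F z * X z).trace.re ∂circleMeasure :=
  integral_nonneg fun z => trace_mul_nonneg (hF z) (hX z)

theorem exists_abs_integral_trace_mul_le (hΦ : Continuous Φ) (hΦp : ∀ z, (Φ z).PosDef)
    (hX : Continuous X) (hXh : ∀ z, (X z).IsHermitian) :
    ∃ κ : ℝ, ∀ F : Circle → Matrix (Fin m) (Fin m) ℂ, Continuous F → (∀ z, (F z).PosSemidef) →
      |∫ z, (F z * X z).trace.re ∂circleMeasure|
        ≤ |κ| * ∫ z, (F z * Φ z).trace.re ∂circleMeasure := by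
  obtain ⟨κ₁, hκ₁⟩ := exists_smul_sub_posSemidef hΦ hΦp hX hXh
  obtain ⟨κ₂, hκ₂⟩ :=
    exists_smul_sub_posSemidef (Y := fun z => -X z) hΦ hΦp hX.neg fun z => (hXh z).neg
  refine ⟨max κ₁ κ₂, fun F hF hFp => ?_⟩
  have hle {κ : ℝ} {Y : Circle → Matrix (Fin m) (Fin m) ℂ} (hY : Continuous Y)
      (hκ : ∀ z, ((κ : ℂ) • Φ z - Y z).PosSemidef) : ∫ z, (F z * Y z).trace.re ∂circleMeasure
        ≤ κ * ∫ z, (F z * Φ z).trace.re ∂circleMeasure := by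
    rw [← integral_const_mul]
    refine integral_mono (EssBdd.of_continuous (hF.matrix_mul hY)).integrable_trace_re
      ((EssBdd.of_continuous (hF.matrix_mul hΦ)).integrable_trace_re.const_mul κ) fun z => ?_
    simpa only [Matrix.mul_smul, trace_smul, smul_eq_mul, Complex.re_ofReal_mul] using
      trace_mul_mono_right (hFp z) (hκ z)
  have hneg := hle (Y := fun z => -X z) hX.neg hκ₂
  simp only [Matrix.mul_neg, trace_neg, Complex.neg_re, integral_neg] at hneg
  have hΦnonneg := integral_trace_mul_nonneg hFp fun z => (hΦp z).posSemidef
  exact abs_le'.mpr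
    ⟨(hle hX hκ₁).trans (mul_le_mul_of_nonneg_right
      ((le_max_left _ _).trans (le_abs_self _)) hΦnonneg),
    hneg.trans (mul_le_mul_of_nonneg_right ((le_max_right _ _).trans (le_abs_self _)) hΦnonneg)⟩

theorem exists_abs_trace_mul_le (hA : IsStable A) (hΨ : Continuous Ψ)
    (hΨp : ∀ z, (Ψ z).PosDef) (hΦ : Continuous Φ) (hΦp : ∀ z, (Φ z).PosDef) (c : ℝ)
    {M : Matrix (Fin n) (Fin n) ℝ} (hM : M ∈ rangeGamma A B) :
    ∃ C : ℝ, ∀ Λ, IsDualFeasible A B Ψ Λ →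
      ∫ z, (phiOptInv A B Ψ Λ z * Φ z).trace.re ∂circleMeasure ≤ c → |(Λ * M).trace| ≤ C := by
  obtain ⟨X, hX, hXh, hXM⟩ := exists_continuous_density_of_mem_rangeGamma hM
  obtain ⟨κ, hκ⟩ := exists_abs_integral_trace_mul_le hΦ hΦp hX hXh
  refine ⟨|κ| * c + |∫ z, ((Ψ z)⁻¹ * X z).trace.re ∂circleMeasure|, fun Λ hΛ hc => ?_⟩
  have hbound := hκ _ (continuous_phiOptInv hA hΨ hΨp continuous_const continuous_id)
    fun z => (hΛ z).posSemidef
  rw [trace_mul_eq_integral_phiOptInv hA hΨ hΨp (.of_continuous hX) hXM]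
  exact (abs_sub _ _).trans (add_le_add_left (hbound.trans
    (mul_le_mul_of_nonneg_left hc (abs_nonneg κ))) _)

/- The trace form is positive definite on symmetric matrices, hence nondegenerate on `Range Γ`. -/
theorem exists_forall_apply_eq_trace_mul (hA : IsStable A) (B : Matrix (Fin n) (Fin m) ℝ)
    (i j : Fin n) :
    ∃ M ∈ rangeGamma A B, ∀ Λ ∈ rangeGamma A B, Λ i j = (Λ * M).trace := by
  let V := rangeGammaSubmodule hA B
  let T : V →ₗ[ℝ] Module.Dual ℝ V := LinearMap.mk₂ ℝ (fun M Λ : V => (Λ.1 * M.1).trace)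
    (fun _ _ _ => by simp [Matrix.mul_add]) (fun _ _ _ => by simp)
    (fun _ _ _ => by simp [Matrix.add_mul]) (fun _ _ _ => by simp)
  have hinj : Function.Injective T := by
    rw [← LinearMap.ker_eq_bot, LinearMap.ker_eq_bot']
    intro M hM
    have htrace : (M.1 * M.1).trace = 0 := LinearMap.congr_fun hM M
    refine Subtype.ext (trace_conjTranspose_mul_self_eq_zero_iff.mp ?_)
    rw [conjTranspose_eq_transpose_of_trivial, (isSymm_of_mem_rangeGamma M.2).eq, htrace]
  have hsurj : Function.Surjective T :=
    (LinearMap.injective_iff_surjective_of_finrank_eq_finrank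
      (Subspace.dual_finrank_eq (K := ℝ) (V := V)).symm).mp hinj
  obtain ⟨M, hM⟩ := hsurj ((Matrix.entryLinearMap ℝ ℝ i j).comp V.subtype)
  exact ⟨M.1, M.2, fun Λ hΛ => (LinearMap.congr_fun hM ⟨Λ, hΛ⟩).symm⟩

/- The first-order inequality for `log det` at the base point `2 Φ⁻¹`. -/
theorem exists_half_integral_sub_le_J (hA : IsStable A) (hW : IsSpectralFactor W Ψ)
    (hΨ : Continuous Ψ) (hΨp : ∀ z, (Ψ z).PosDef) (hΦ : Continuous Φ) (hΦp : ∀ z, (Φ z).PosDef)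
    (hΦS : moment A B Φ = toC S) :
    ∃ C : ℝ, ∀ Λ, IsDualFeasible A B Ψ Λ →
      1 / 2 * ∫ z, (phiOptInv A B Ψ Λ z * Φ z).trace.re ∂circleMeasure - C ≤ J A B S W Λ := by
  let X : Circle → Matrix (Fin m) (Fin m) ℂ := fun z => (2 : ℂ) • (Φ z)⁻¹
  have hX : Continuous X := (continuous_inv_of_posDef hΦ hΦp).const_smul (2 : ℂ)
  have hXp (z : Circle) : (X z).PosDef := (hΦp z).inv.smul two_pos
  have hXinv (z : Circle) : (X z)⁻¹ = ((1 / 2 : ℝ) : ℂ) • Φ z := by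
    refine Matrix.inv_eq_left_inv ?_
    rw [Matrix.smul_mul, Matrix.mul_smul, smul_smul,
      Matrix.mul_nonsing_inv _ (isUnit_det_of_posDef (hΦp z))]
    norm_num
  refine ⟨∫ z, ((Ψ z)⁻¹ * Φ z).trace.re ∂circleMeasure + ∫ z, logDet (Ψ z) ∂circleMeasure
    + ∫ z, logDet (X z) ∂circleMeasure - m, fun Λ hΛ => ?_⟩
  have hc : Continuous (phiOptInv A B Ψ Λ) :=
    continuous_phiOptInv hA hΨ hΨp continuous_const continuous_id
  have hpt (z : Circle) : ((X z)⁻¹ * (phiOptInv A B Ψ Λ z - X z)).trace.re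
      = 1 / 2 * (phiOptInv A B Ψ Λ z * Φ z).trace.re - m := by
    rw [trace_inv_mul_sub (hXp z), hXinv, Matrix.smul_mul, trace_smul, Matrix.trace_mul_comm,
      smul_eq_mul, Complex.re_ofReal_mul, Fintype.card_fin]
  have htangent := integral_logDet_le (μ := circleMeasure) hX hXp (.of_continuous hc)
    (.of_forall hΛ) (integrable_of_continuous (continuous_logDet hc hΛ))
  simp only [hpt] at htangent
  rw [integral_sub ((EssBdd.of_continuous (hc.matrix_mul hΦ)).integrable_trace_re.const_mul _)
    (integrable_const _), integral_const_mul, integral_const, probReal_univ, one_smul] at htangent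
  rw [J_eq hA hW hΨ hΨp hΛ,
    trace_mul_eq_integral_phiOptInv hA hΨ hΨp (.of_continuous hΦ) hΦS]
  linarith

theorem exists_forall_le_J (hA : IsStable A) (hW : IsSpectralFactor W Ψ)
    (hΨ : Continuous Ψ) (hΨp : ∀ z, (Ψ z).PosDef) (hΦ : Continuous Φ) (hΦp : ∀ z, (Φ z).PosDef)
    (hΦS : moment A B Φ = toC S) :
    ∃ C : ℝ, ∀ Λ, IsDualFeasible A B Ψ Λ → C ≤ J A B S W Λ := by
  obtain ⟨C, hC⟩ := exists_half_integral_sub_le_J hA hW hΨ hΨp hΦ hΦp hΦS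
  refine ⟨-C, fun Λ hΛ => ?_⟩
  have hnonneg := integral_trace_mul_nonneg (fun z => (hΛ z).posSemidef)
    fun z => (hΦp z).posSemidef
  linarith [hC Λ hΛ]

theorem exists_abs_apply_le_of_J_le (hA : IsStable A) (hW : IsSpectralFactor W Ψ)
    (hΨ : Continuous Ψ) (hΨp : ∀ z, (Ψ z).PosDef) (hΦ : Continuous Φ) (hΦp : ∀ z, (Φ z).PosDef)
    (hΦS : moment A B Φ = toC S) (c : ℝ) (i j : Fin n) :
    ∃ K : ℝ, ∀ Λ ∈ rangeGamma A B, IsDualFeasible A B Ψ Λ → J A B S W Λ ≤ c → |Λ i j| ≤ K := by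
  obtain ⟨C, hC⟩ := exists_half_integral_sub_le_J hA hW hΨ hΨp hΦ hΦp hΦS
  obtain ⟨M, hM, hentry⟩ := exists_forall_apply_eq_trace_mul hA B i j
  obtain ⟨K, hK⟩ := exists_abs_trace_mul_le hA hΨ hΨp hΦ hΦp (2 * (c + C)) hM
  refine ⟨K, fun Λ hmem hΛ hJ => ?_⟩
  rw [hentry Λ hmem]
  exact hK Λ hΛ (by linarith [hC Λ hΛ])

end SublevelSets

section Minty

open Filter Topology

variable {n m : ℕ} {A : Matrix (Fin n) (Fin n) ℝ} {B : Matrix (Fin n) (Fin m) ℝ}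
  {S : Matrix (Fin n) (Fin n) ℝ} {Ψ W Φ : Circle → Matrix (Fin m) (Fin m) ℂ}

/-- `Λ` solves the Minty variational inequality of the dual problem: `Ψ⁻¹ + G^* Λ G`
is positive semidefinite, and from every feasible `Λ'` the dual functional is, to first order,
nonincreasing towards `Λ`. Unlike minimality, this does not involve the functional at `Λ`, which
may be infinite if `Λ` is a boundary point. -/
structure IsMintySolution (A : Matrix (Fin n) (Fin n) ℝ) (B : Matrix (Fin n) (Fin m) ℝ)
    (S : Matrix (Fin n) (Fin n) ℝ) (Ψ : Circle → Matrix (Fin m) (Fin m) ℂ)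
    (Λ : Matrix (Fin n) (Fin n) ℝ) : Prop where
  mem : Λ ∈ rangeGamma A B
  posSemidef : ∀ z, (phiOptInv A B Ψ Λ z).PosSemidef
  dualDeriv_nonpos : ∀ Λ' ∈ rangeGamma A B, IsDualFeasible A B Ψ Λ' →
    dualDeriv A B S Ψ Λ' (Λ - Λ') ≤ 0

theorem exists_subseq_tendsto_of_abs_apply_le {p q : Type*} [Finite p] [Finite q]
    {x : ℕ → Matrix p q ℝ} {K : p → q → ℝ} (hK : ∀ k i j, |x k i j| ≤ K i j) :
    ∃ (a : Matrix p q ℝ) (φ : ℕ → ℕ), StrictMono φ ∧ Tendsto (x ∘ φ) atTop (𝓝 a) := by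
  have hcomp : IsCompact (Set.univ.pi fun i : p => Set.univ.pi fun j : q =>
      Set.Icc (-K i j) (K i j) : Set (p → q → ℝ)) :=
    isCompact_univ_pi fun i => isCompact_univ_pi fun j => isCompact_Icc
  obtain ⟨a, -, h⟩ := hcomp.tendsto_subseq (x := fun k i j => x k i j)
    fun k i _ j _ => abs_le.mp (hK k i j)
  exact ⟨Matrix.of a, h⟩

theorem isClosed_rangeGamma (hA : IsStable A) (B : Matrix (Fin n) (Fin m) ℝ) :
    IsClosed (rangeGamma A B) :=
  (rangeGammaSubmodule hA B).closed_of_finiteDimensional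

theorem isMintySolution_of_tendsto (hA : IsStable A) (hW : IsSpectralFactor W Ψ)
    (hΨ : Continuous Ψ) (hΨp : ∀ z, (Ψ z).PosDef) {x : ℕ → Matrix (Fin n) (Fin n) ℝ}
    {Λ : Matrix (Fin n) (Fin n) ℝ} {l : ℝ} (hmem : ∀ k, x k ∈ rangeGamma A B)
    (hx : ∀ k, IsDualFeasible A B Ψ (x k))
    (hl : ∀ Λ' ∈ rangeGamma A B, IsDualFeasible A B Ψ Λ' → l ≤ J A B S W Λ')
    (hJ : Tendsto (fun k => J A B S W (x k)) atTop (𝓝 l)) (hΛ : Tendsto x atTop (𝓝 Λ)) :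
    IsMintySolution A B S Ψ Λ where
  mem := (isClosed_rangeGamma hA B).mem_of_tendsto hΛ (.of_forall hmem)
  posSemidef z := isClosed_posSemidef.mem_of_tendsto
    (((continuous_phiOptInv hA hΨ hΨp continuous_id continuous_const).tendsto Λ).comp hΛ)
    (.of_forall fun k => (hx k z).posSemidef)
  dualDeriv_nonpos Λ' hmem' hΛ' := by
    have hderiv : Tendsto (fun k => dualDeriv A B S Ψ Λ' (x k - Λ')) atTop
        (𝓝 (dualDeriv A B S Ψ Λ' (Λ - Λ'))) :=
      ((continuous_dualDeriv Λ').tendsto _).comp (hΛ.sub_const Λ')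
    refine le_of_tendsto_of_tendsto' hderiv (sub_self l ▸ hJ.sub_const l) fun k => ?_
    linarith [J_add_dualDeriv_le (S := S) hA hW hΨ hΨp hΛ' (hx k), hl Λ' hmem' hΛ']

theorem exists_isMintySolution (hA : IsStable A) (hW : IsSpectralFactor W Ψ) (hΨ : Continuous Ψ)
    (hΨp : ∀ z, (Ψ z).PosDef) (hΦ : Continuous Φ) (hΦp : ∀ z, (Φ z).PosDef)
    (hΦS : moment A B Φ = toC S) : ∃ Λ, IsMintySolution A B S Ψ Λ := by
  let D : Set (Matrix (Fin n) (Fin n) ℝ) := {Λ | Λ ∈ rangeGamma A B ∧ IsDualFeasible A B Ψ Λ}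
  have hzero : (0 : Matrix (Fin n) (Fin n) ℝ) ∈ D :=
    ⟨(rangeGammaSubmodule hA B).zero_mem, fun z => phiOptInv_zero (Ψ := Ψ) z ▸ (hΨp z).inv⟩
  obtain ⟨C, hC⟩ := exists_forall_le_J hA hW hΨ hΨp hΦ hΦp hΦS
  have hbdd : BddBelow (J A B S W '' D) := ⟨C, by rintro _ ⟨Λ, hΛ, rfl⟩; exact hC Λ hΛ.2⟩
  obtain ⟨u, -, hu, huD⟩ := exists_seq_tendsto_sInf ⟨_, Set.mem_image_of_mem _ hzero⟩ hbdd
  choose x hxD hxu using huD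
  obtain ⟨c, hc⟩ := hu.bddAbove_range
  choose K hK using exists_abs_apply_le_of_J_le hA hW hΨ hΨp hΦ hΦp hΦS c
  obtain ⟨Λ, φ, hφ, hlim⟩ := exists_subseq_tendsto_of_abs_apply_le (x := x) fun k i j =>
    hK i j (x k) (hxD k).1 (hxD k).2 (hxu k ▸ hc ⟨k, rfl⟩)
  refine ⟨Λ, isMintySolution_of_tendsto hA hW hΨ hΨp (fun k => (hxD (φ k)).1)
    (fun k => (hxD (φ k)).2) (fun Λ' hmem hΛ' => csInf_le hbdd ⟨Λ', ⟨hmem, hΛ'⟩, rfl⟩) ?_ hlim⟩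
  simpa only [Function.comp_def, hxu] using hu.comp hφ.tendsto_atTop

end Minty

section LogarithmicDivergence

open Filter Topology

theorem integral_inv_sub_add (θ₀ : ℝ) {δ t : ℝ} (hδ : 0 < δ) (ht : 0 < t) :
    ∫ θ in (θ₀ - δ)..θ₀, (θ₀ - θ + t)⁻¹ = Real.log ((δ + t) / t) := by
  have h := intervalIntegral.integral_comp_sub_left (a := θ₀ - δ) (b := θ₀)
    (fun x : ℝ => x⁻¹) (θ₀ + t)
  rw [add_sub_cancel_left, show θ₀ + t - (θ₀ - δ) = δ + t by ring,
    integral_inv_of_pos ht (by linarith)] at h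
  simp only [sub_add_eq_add_sub, h]

theorem tendsto_log_add_div_nhdsGT_zero {δ : ℝ} (hδ : 0 < δ) :
    Tendsto (fun t => Real.log ((δ + t) / t)) (𝓝[>] 0) atTop := by
  have h : Tendsto (fun t : ℝ => δ * t⁻¹ + 1) (𝓝[>] 0) atTop :=
    tendsto_atTop_add_const_right _ _ (tendsto_inv_nhdsGT_zero.const_mul_atTop hδ)
  refine (Real.tendsto_log_atTop.comp h).congr' ?_
  filter_upwards [self_mem_nhdsWithin] with t ht
  rw [Function.comp_apply, add_div, div_self ht.ne', div_eq_mul_inv]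

theorem mul_log_le_integral_of_inv_le {g : Circle → ℝ} (hg : Continuous g) (hg0 : ∀ z, 0 ≤ g z)
    {θ₀ δ t c : ℝ} (hθ : θ₀ ≤ Real.pi) (hδ : 0 < δ) (hθδ : -Real.pi ≤ θ₀ - δ) (ht : 0 < t)
    (h : ∀ θ ∈ Set.Icc (θ₀ - δ) θ₀, c * (θ₀ - θ + t)⁻¹ ≤ g (Circle.exp θ)) :
    c * Real.log ((δ + t) / t) ≤ 2 * Real.pi * ∫ z, g z ∂circleMeasure := by
  have hgc : Continuous fun θ : ℝ => g (Circle.exp θ) := hg.comp Circle.exp.continuous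
  have hci : IntervalIntegrable (fun θ => c * (θ₀ - θ + t)⁻¹) volume (θ₀ - δ) θ₀ := by
    refine ContinuousOn.intervalIntegrable (continuousOn_const.mul
      (ContinuousOn.inv₀ (by fun_prop) fun θ hθ' => ?_))
    rw [Set.uIcc_of_le (by linarith)] at hθ'
    linarith [hθ'.2]
  calc c * Real.log ((δ + t) / t) = ∫ θ in (θ₀ - δ)..θ₀, c * (θ₀ - θ + t)⁻¹ := by
        rw [intervalIntegral.integral_const_mul, integral_inv_sub_add θ₀ hδ ht]
    _ ≤ ∫ θ in (θ₀ - δ)..θ₀, g (Circle.exp θ) :=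
        intervalIntegral.integral_mono_on (by linarith) hci (hgc.intervalIntegrable _ _) h
    _ ≤ ∫ θ in (-Real.pi)..Real.pi, g (Circle.exp θ) :=
        intervalIntegral.integral_mono_interval hθδ (by linarith) hθ
          (.of_forall fun θ => hg0 _) (hgc.intervalIntegrable _ _)
    _ = 2 * Real.pi * ∫ z, g z ∂circleMeasure := by
        rw [integral_circleMeasure hg, smul_eq_mul]
        field_simp

theorem exists_le_mul_abs_sub {f : ℝ → ℝ} {θ₀ : ℝ} (hf : DifferentiableAt ℝ f θ₀)
    (h0 : f θ₀ = 0) : ∃ K δ : ℝ, 0 < δ ∧ ∀ θ, |θ - θ₀| ≤ δ → f θ ≤ K * |θ - θ₀| := by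
  obtain ⟨K, hK⟩ := hf.isBigO_sub.bound
  obtain ⟨δ, hδ, h⟩ := Metric.nhds_basis_closedBall.eventually_iff.mp hK
  refine ⟨K, δ, hδ, fun θ hθ => ?_⟩
  have hle : ‖f θ - f θ₀‖ ≤ K * ‖θ - θ₀‖ := h (mem_closedBall_iff_norm.mpr hθ)
  rw [h0, sub_zero] at hle
  exact (Real.le_norm_self _).trans hle

theorem exists_convexCombination_le_mul {q r : ℝ → ℝ} {θ₀ δ₀ : ℝ} (hδ₀ : 0 < δ₀)
    (hq : DifferentiableAt ℝ q θ₀) (hq0 : ∀ θ, 0 ≤ q θ) (hqθ₀ : q θ₀ = 0)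
    (hr : BddAbove (Set.range r)) :
    ∃ K δ : ℝ, 0 < K ∧ 0 < δ ∧ δ ≤ δ₀ ∧ ∀ t, 0 < t →
      ∀ θ ∈ Set.Icc (θ₀ - δ) θ₀, (1 - t) * q θ + t * r θ ≤ K * (θ₀ - θ + t) := by
  obtain ⟨K₁, δ, hδ, hK₁⟩ := exists_le_mul_abs_sub hq hqθ₀
  obtain ⟨K₂, hK₂⟩ := hr
  let K := max 1 (max K₁ K₂)
  refine ⟨K, min δ δ₀, lt_max_of_lt_left one_pos, lt_min hδ hδ₀, min_le_right _ _,
    fun t ht θ hθ => ?_⟩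
  have hθ₀ : 0 ≤ θ₀ - θ := sub_nonneg.mpr hθ.2
  have habs : |θ - θ₀| = θ₀ - θ := by rw [abs_sub_comm, abs_of_nonneg hθ₀]
  have hqθ : q θ ≤ K * (θ₀ - θ) := by
    refine ((hK₁ θ ?_).trans_eq (by rw [habs])).trans
      (mul_le_mul_of_nonneg_right ((le_max_left K₁ K₂).trans (le_max_right 1 _)) hθ₀)
    linarith [hθ.1, min_le_left δ δ₀]
  have hrθ : r θ ≤ K :=
    (hK₂ (Set.mem_range_self θ)).trans ((le_max_right K₁ K₂).trans (le_max_right 1 _))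
  nlinarith [mul_nonneg ht.le (hq0 θ), mul_le_mul_of_nonneg_left hrθ ht.le]

/- Near a zero `θ₀` of `q` the integrand is at least a multiple of `(|θ - θ₀| + t)⁻¹`. -/
theorem exists_lt_integral_inv_convexCombination {q r : Circle → ℝ} {z₀ : Circle}
    (hq : Continuous q) (hr : Continuous r) (hq0 : ∀ z, 0 ≤ q z) (hr0 : ∀ z, 0 < r z)
    (hqd : DifferentiableAt ℝ (fun θ => q (Circle.exp θ)) (Complex.arg z₀)) (hqz₀ : q z₀ = 0)
    (C : ℝ) :
    ∃ t, 0 < t ∧ t < 1 ∧ C < ∫ z, ((1 - t) * q z + t * r z)⁻¹ ∂circleMeasure := by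
  have hrange : BddAbove (Set.range fun θ : ℝ => r (Circle.exp θ)) :=
    (isCompact_range hr).bddAbove.mono (Set.range_comp_subset_range _ _)
  obtain ⟨K, δ, hK, hδ, hδ₀, hle⟩ := exists_convexCombination_le_mul
    (δ₀ := Complex.arg z₀ + Real.pi) (by linarith [Complex.neg_pi_lt_arg (z₀ : ℂ)]) hqd
    (fun _ => hq0 _) (by rwa [Circle.exp_arg]) hrange
  obtain ⟨t, hlog, ht0, ht1⟩ := ((tendsto_log_add_div_nhdsGT_zero hδ).eventually_gt_atTop
    (K * (2 * Real.pi * C)) |>.and (Ioo_mem_nhdsGT one_pos)).exists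
  have hpos (z : Circle) : 0 < (1 - t) * q z + t * r z :=
    add_pos_of_nonneg_of_pos (mul_nonneg (by linarith) (hq0 z)) (mul_pos ht0 (hr0 z))
  have hcont : Continuous fun z => ((1 - t) * q z + t * r z)⁻¹ :=
    Continuous.inv₀ (by fun_prop) fun z => (hpos z).ne'
  have hint := mul_log_le_integral_of_inv_le (c := K⁻¹) hcont (fun z => (inv_pos.mpr (hpos z)).le)
    (Complex.arg_le_pi _) hδ (by linarith) ht0 fun θ hθ => by
      rw [← mul_inv]
      exact inv_anti₀ (hpos _) (hle t ht0 θ hθ)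
  refine ⟨t, ht0, ht1, lt_of_mul_lt_mul_left ?_ Real.two_pi_pos.le⟩
  exact ((lt_inv_mul_iff₀ hK).mpr hlog).trans_le hint

end LogarithmicDivergence

section Interiority

variable {n m : ℕ} {A : Matrix (Fin n) (Fin n) ℝ} {B : Matrix (Fin n) (Fin m) ℝ}
  {S : Matrix (Fin n) (Fin n) ℝ} {Ψ : Circle → Matrix (Fin m) (Fin m) ℂ}
  {Λ : Matrix (Fin n) (Fin n) ℝ} {t : ℝ}

theorem differentiable_G_comp_exp (hA : IsStable A) (B : Matrix (Fin n) (Fin m) ℝ) (i j) :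
    Differentiable ℝ fun θ : ℝ => G A B (Circle.exp θ) i j := fun θ => by
  have hresolvent := differentiableAt_matrix_inv (x := θ) (F := fun θ : ℝ =>
      ((Circle.exp θ : Circle) : ℂ) • (1 : Matrix (Fin n) (Fin n) ℂ) - toC A) (fun k l => by
    simp only [Matrix.sub_apply, Matrix.smul_apply, smul_eq_mul, Circle.coe_exp]
    fun_prop) (hA.isUnit_det_circle_sub _)
  exact differentiableAt_matrix_mul (H := fun _ : ℝ => toC B) hresolvent
    (fun k l => differentiableAt_const (toC B k l)) i j

theorem differentiable_phiOptInv_comp_exp (hA : IsStable A) (hΨp : ∀ z, (Ψ z).PosDef)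
    (hΨd : ∀ i j, Differentiable ℝ fun θ : ℝ => Ψ (Circle.exp θ) i j)
    (Λ : Matrix (Fin n) (Fin n) ℝ) (i j) :
    Differentiable ℝ fun θ : ℝ => phiOptInv A B Ψ Λ (Circle.exp θ) i j := fun θ =>
  (differentiableAt_matrix_inv (F := fun θ : ℝ => Ψ (Circle.exp θ)) (fun k l => hΨd k l θ)
    (isUnit_det_of_posDef (hΨp _)) i j).add
  (differentiableAt_matrix_mul (F := fun θ : ℝ => (G A B (Circle.exp θ))ᴴ * toC Λ)
    (differentiableAt_matrix_mul (H := fun _ : ℝ => toC Λ)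
      (fun k l => (differentiable_G_comp_exp hA B l k θ).star)
      fun k l => differentiableAt_const (toC Λ k l))
    (fun k l => differentiable_G_comp_exp hA B k l θ) i j)

theorem differentiable_quad {ι : Type*} [Fintype ι] {F : ℝ → Matrix ι ι ℂ}
    (hF : ∀ i j, Differentiable ℝ fun θ => F θ i j) (v : ι → ℂ) :
    Differentiable ℝ fun θ => quad (F θ) v := by
  refine Complex.reCLM.differentiable.comp ?_
  simp only [dotProduct, mulVec]
  exact .fun_sum fun i _ => (Differentiable.fun_sum fun j _ => (hF i j).mul_const _).const_mul _

theorem phiOptInv_one_sub_smul (t : ℝ) (Λ : Matrix (Fin n) (Fin n) ℝ) (z : Circle) :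
    phiOptInv A B Ψ ((1 - t) • Λ) z
      = ((1 - t : ℝ) : ℂ) • phiOptInv A B Ψ Λ z + (t : ℂ) • (Ψ z)⁻¹ := by
  rw [← phiOptInv_zero (A := A) (B := B), ← phiOptInv_convexCombination (sub_add_cancel 1 t),
    smul_zero, add_zero]

theorem dualDeriv_self (hA : IsStable A) (hΨ : Continuous Ψ) (hΨp : ∀ z, (Ψ z).PosDef)
    (hΛ : IsDualFeasible A B Ψ Λ) :
    dualDeriv A B S Ψ Λ Λ = (Λ * S).trace
      + ∫ z, ((phiOptInv A B Ψ Λ z)⁻¹ * (Ψ z)⁻¹).trace.re ∂circleMeasure - m := by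
  have hpt (z : Circle) : ((phiOptInv A B Ψ Λ z)⁻¹ * gammaAdj A B Λ z).trace.re
      = m - ((phiOptInv A B Ψ Λ z)⁻¹ * (Ψ z)⁻¹).trace.re := by
    rw [← add_sub_cancel_left (Ψ z)⁻¹ (gammaAdj A B Λ z), ← phiOptInv, Matrix.mul_sub,
      Matrix.nonsing_inv_mul _ (isUnit_det_of_posDef (hΛ z)), trace_sub, trace_one, Complex.sub_re,
      Fintype.card_fin, Complex.natCast_re]
  have hint : Integrable (fun z => ((phiOptInv A B Ψ Λ z)⁻¹ * (Ψ z)⁻¹).trace.re) circleMeasure :=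
    (EssBdd.of_continuous ((hΛ.continuous_PhiOpt hA hΨ hΨp).matrix_mul
      (continuous_inv_of_posDef hΨ hΨp))).integrable_trace_re
  simp only [dualDeriv_eq hA hΨ hΨp hΛ, hpt]
  rw [integral_sub (integrable_const _) hint, integral_const, probReal_univ, one_smul]
  ring

theorem IsMintySolution.isDualFeasible_one_sub_smul (hΛ : IsMintySolution A B S Ψ Λ)
    (hΨp : ∀ z, (Ψ z).PosDef) (ht : 0 < t) (ht1 : t ≤ 1) :
    IsDualFeasible A B Ψ ((1 - t) • Λ) := by
  have hzero : IsDualFeasible A B Ψ 0 := fun z => phiOptInv_zero (Ψ := Ψ) z ▸ (hΨp z).inv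
  have h := hzero.convexCombination hΛ.posSemidef (sub_add_cancel 1 t) (sub_nonneg.mpr ht1) ht
  rwa [smul_zero, add_zero] at h

theorem IsMintySolution.integral_trace_inv_le (hΛ : IsMintySolution A B S Ψ Λ) (hA : IsStable A)
    (hΨ : Continuous Ψ) (hΨp : ∀ z, (Ψ z).PosDef) (ht : 0 < t) (ht1 : t ≤ 1) :
    ∫ z, ((phiOptInv A B Ψ ((1 - t) • Λ) z)⁻¹ * (Ψ z)⁻¹).trace.re ∂circleMeasure
      ≤ m + |(Λ * S).trace| := by
  have hfeas := hΛ.isDualFeasible_one_sub_smul hΨp ht ht1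
  have hminty := hΛ.dualDeriv_nonpos _ ((rangeGammaSubmodule hA B).smul_mem (1 - t) hΛ.mem) hfeas
  rw [show Λ - (1 - t) • Λ = t • Λ by module, dualDeriv_smul] at hminty
  have hself : dualDeriv A B S Ψ ((1 - t) • Λ) ((1 - t) • Λ) ≤ 0 := by
    rw [dualDeriv_smul]
    exact mul_nonpos_of_nonneg_of_nonpos (sub_nonneg.mpr ht1)
      (nonpos_of_mul_nonpos_right hminty ht)
  rw [dualDeriv_self hA hΨ hΨp hfeas, Matrix.smul_mul, trace_smul, smul_eq_mul] at hself
  nlinarith [neg_abs_le (Λ * S).trace, abs_nonneg (Λ * S).trace]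

theorem IsMintySolution.exists_integral_inv_quad_le (hΛ : IsMintySolution A B S Ψ Λ)
    (hA : IsStable A) (hΨ : Continuous Ψ) (hΨp : ∀ z, (Ψ z).PosDef) {v : Fin m → ℂ} (hv : v ≠ 0) :
    ∃ C : ℝ, ∀ t : ℝ, 0 < t → t ≤ 1 →
      ∫ z, (quad (phiOptInv A B Ψ ((1 - t) • Λ) z) v)⁻¹ ∂circleMeasure ≤ C := by
  have hΨi := continuous_inv_of_posDef hΨ hΨp
  obtain ⟨κ, hκ⟩ := exists_smul_sub_posSemidef hΨi (fun z => (hΨp z).inv)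
    (Y := fun _ => vecMulVec v (star v)) continuous_const
    fun _ => (posSemidef_vecMulVec_self_star v).1
  have hpos : 0 < (star v ⬝ᵥ v).re := (Complex.pos_iff.mp (dotProduct_star_self_pos_iff.mpr hv)).1
  refine ⟨((star v ⬝ᵥ v).re ^ 2)⁻¹ * (|κ| * (m + |(Λ * S).trace|)), fun t ht ht1 => ?_⟩
  have hfeas := hΛ.isDualFeasible_one_sub_smul hΨp ht ht1
  have hc : Continuous (phiOptInv A B Ψ ((1 - t) • Λ)) :=
    continuous_phiOptInv hA hΨ hΨp continuous_const continuous_id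
  have hinv : Integrable (fun z => (quad (phiOptInv A B Ψ ((1 - t) • Λ) z) v)⁻¹) circleMeasure :=
    integrable_of_continuous <| (continuous_quad hc continuous_const).inv₀
      fun z => ((hfeas z).re_dotProduct_pos hv).ne'
  have htr : Integrable (fun z => ((phiOptInv A B Ψ ((1 - t) • Λ) z)⁻¹ * (Ψ z)⁻¹).trace.re)
      circleMeasure :=
    (EssBdd.of_continuous ((continuous_inv_of_posDef hc hfeas).matrix_mul hΨi)).integrable_trace_re
  rw [le_inv_mul_iff₀ (pow_pos hpos 2), ← integral_const_mul]
  calc ∫ z, (star v ⬝ᵥ v).re ^ 2 * (quad (phiOptInv A B Ψ ((1 - t) • Λ) z) v)⁻¹ ∂circleMeasure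
      ≤ ∫ z, κ * ((phiOptInv A B Ψ ((1 - t) • Λ) z)⁻¹ * (Ψ z)⁻¹).trace.re ∂circleMeasure :=
        integral_mono (hinv.const_mul _) (htr.const_mul _) fun z =>
          sq_div_quad_le_trace_inv_mul (hfeas z) hv (hκ z)
    _ ≤ |κ| * ∫ z, ((phiOptInv A B Ψ ((1 - t) • Λ) z)⁻¹ * (Ψ z)⁻¹).trace.re ∂circleMeasure := by
        rw [integral_const_mul]
        exact mul_le_mul_of_nonneg_right (le_abs_self κ) (integral_trace_mul_nonneg
          (fun z => (hfeas z).inv.posSemidef) fun z => (hΨp z).inv.posSemidef)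
    _ ≤ |κ| * (m + |(Λ * S).trace|) :=
        mul_le_mul_of_nonneg_left (hΛ.integral_trace_inv_le hA hΨ hΨp ht ht1) (abs_nonneg κ)

theorem IsMintySolution.isDualFeasible (hΛ : IsMintySolution A B S Ψ Λ) (hA : IsStable A)
    (hΨ : Continuous Ψ) (hΨp : ∀ z, (Ψ z).PosDef)
    (hΨd : ∀ i j, Differentiable ℝ fun θ : ℝ => Ψ (Circle.exp θ) i j) :
    IsDualFeasible A B Ψ Λ := fun z₀ => by
  refine (posDef_iff_quad (hΛ.posSemidef z₀).1).mpr fun v hv => ?_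
  have hq0 (z : Circle) : 0 ≤ quad (phiOptInv A B Ψ Λ z) v :=
    (hΛ.posSemidef z).re_dotProduct_nonneg v
  refine (hq0 z₀).lt_of_ne' fun hzero => ?_
  have hc : Continuous (phiOptInv A B Ψ Λ) :=
    continuous_phiOptInv hA hΨ hΨp continuous_const continuous_id
  obtain ⟨C, hC⟩ := hΛ.exists_integral_inv_quad_le hA hΨ hΨp hv
  obtain ⟨t, ht, ht1, hlt⟩ := exists_lt_integral_inv_convexCombination
    (continuous_quad hc continuous_const)
    (continuous_quad (continuous_inv_of_posDef hΨ hΨp) continuous_const) hq0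
    (fun z => (hΨp z).inv.re_dotProduct_pos hv)
    (differentiable_quad (differentiable_phiOptInv_comp_exp hA hΨp hΨd Λ) v _) hzero C
  refine hlt.not_ge ((hC t ht ht1.le).trans' (le_of_eq ?_))
  simp only [phiOptInv_one_sub_smul, quad_add, quad_smul]

end Interiority

section Stationarity

open Topology

variable {n m : ℕ} {A : Matrix (Fin n) (Fin n) ℝ} {B : Matrix (Fin n) (Fin m) ℝ}
  {S : Matrix (Fin n) (Fin n) ℝ} {Ψ W Φ : Circle → Matrix (Fin m) (Fin m) ℂ}
  {Λ Λ' : Matrix (Fin n) (Fin n) ℝ}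

theorem continuous_dualDeriv_left {T : Type*} [TopologicalSpace T] [FirstCountableTopology T]
    [LocallyCompactSpace T] {L : T → Matrix (Fin n) (Fin n) ℝ} (hA : IsStable A)
    (hΨ : Continuous Ψ) (hΨp : ∀ z, (Ψ z).PosDef) (hL : Continuous L)
    (hLf : ∀ s, IsDualFeasible A B Ψ (L s)) (D : Matrix (Fin n) (Fin n) ℝ) :
    Continuous fun s => dualDeriv A B S Ψ (L s) D := by
  simp only [fun s => dualDeriv_eq (S := S) hA hΨ hΨp (hLf s) D]
  have hc : Continuous fun p : T × Circle => phiOptInv A B Ψ (L p.1) p.2 :=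
    continuous_phiOptInv hA hΨ hΨp (hL.comp continuous_fst) continuous_snd
  have hint : Continuous (Function.uncurry fun (s : T) (z : Circle) =>
      ((phiOptInv A B Ψ (L s) z)⁻¹ * gammaAdj A B D z).trace.re) :=
    Complex.continuous_re.comp ((continuous_inv_of_posDef hc fun p =>
      hLf p.1 p.2).matrix_mul ((continuous_gammaAdj hA D).comp continuous_snd)).matrix_trace
  have h := continuous_parametric_integral_of_continuous (μ := circleMeasure) hint isCompact_univ
  simp only [Measure.restrict_univ] at h
  exact continuous_const.sub h

theorem IsDualFeasible.convexCombination_unitInterval (hΛ : IsDualFeasible A B Ψ Λ)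
    (hΛ' : IsDualFeasible A B Ψ Λ') (s : unitInterval) :
    IsDualFeasible A B Ψ ((s : ℝ) • Λ' + (1 - s : ℝ) • Λ) := by
  rcases s.2.2.lt_or_eq with hs | hs
  · exact hΛ.convexCombination (fun z => (hΛ' z).posSemidef) (add_sub_cancel _ _) s.2.1
      (sub_pos.mpr hs)
  · simpa only [hs, one_smul, sub_self, zero_smul, add_zero] using hΛ'

theorem IsMintySolution.dualDeriv_nonneg (hΛ : IsMintySolution A B S Ψ Λ) (hA : IsStable A)
    (hΨ : Continuous Ψ) (hΨp : ∀ z, (Ψ z).PosDef) (hΛf : IsDualFeasible A B Ψ Λ)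
    (hmem : Λ' ∈ rangeGamma A B) (hΛ' : IsDualFeasible A B Ψ Λ') :
    0 ≤ dualDeriv A B S Ψ Λ (Λ' - Λ) := by
  let L (s : unitInterval) : Matrix (Fin n) (Fin n) ℝ := (s : ℝ) • Λ' + (1 - s : ℝ) • Λ
  have hLf := hΛf.convexCombination_unitInterval hΛ'
  have hLmem (s : unitInterval) : L s ∈ rangeGamma A B := (rangeGammaSubmodule hA B).add_mem
    ((rangeGammaSubmodule hA B).smul_mem _ hmem) ((rangeGammaSubmodule hA B).smul_mem _ hΛ.mem)
  have hcont : Continuous fun s => dualDeriv A B S Ψ (L s) (Λ' - Λ) :=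
    continuous_dualDeriv_left hA hΨ hΨp (by fun_prop) hLf _
  have hpos (s : unitInterval) (hs : s ∈ Set.Ioi 0) : 0 ≤ dualDeriv A B S Ψ (L s) (Λ' - Λ) := by
    have hminty := hΛ.dualDeriv_nonpos (L s) (hLmem s) (hLf s)
    rw [show Λ - L s = (-s : ℝ) • (Λ' - Λ) by module, dualDeriv_smul, neg_mul,
      neg_nonpos] at hminty
    exact nonneg_of_mul_nonneg_right hminty hs
  have hclosure : (0 : unitInterval) ∈ closure (Set.Ioi 0) := by
    rw [closure_Ioi' ⟨1, zero_lt_one⟩]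
    exact Set.self_mem_Ici
  have hzero : 0 ≤ dualDeriv A B S Ψ (L 0) (Λ' - Λ) :=
    closure_minimal hpos (isClosed_le continuous_const hcont) hclosure
  simpa only [L, Set.Icc.coe_zero, zero_smul, zero_add, sub_zero, one_smul] using hzero

theorem IsDualFeasible.exists_pos_add_smul (hΛ : IsDualFeasible A B Ψ Λ) (hA : IsStable A)
    (hΨ : Continuous Ψ) (hΨp : ∀ z, (Ψ z).PosDef) (hΛs : Λ.IsSymm)
    {D : Matrix (Fin n) (Fin n) ℝ} (hD : D.IsSymm) :
    ∃ s : ℝ, 0 < s ∧ IsDualFeasible A B Ψ (Λ + s • D) := by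
  have hopen : IsOpen {s : ℝ | IsDualFeasible A B Ψ (Λ + s • D)} :=
    isOpen_setOf_forall_posDef (X := fun p : ℝ × Circle => phiOptInv A B Ψ (Λ + p.1 • D) p.2)
      (continuous_phiOptInv hA hΨ hΨp (by fun_prop) continuous_snd)
      fun p => isHermitian_phiOptInv hΨp (hΛs.add (hD.smul p.1)) p.2
  have hzero : IsDualFeasible A B Ψ (Λ + (0 : ℝ) • D) := by rwa [zero_smul, add_zero]
  have hev : ∀ᶠ s in 𝓝[>] (0 : ℝ), 0 < s ∧ IsDualFeasible A B Ψ (Λ + s • D) :=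
    Filter.eventually_and.mpr
      ⟨self_mem_nhdsWithin, mem_nhdsWithin_of_mem_nhds (hopen.mem_nhds hzero)⟩
  exact hev.exists

theorem IsMintySolution.moment_PhiOpt_eq (hΛ : IsMintySolution A B S Ψ Λ) (hA : IsStable A)
    (hΨ : Continuous Ψ) (hΨp : ∀ z, (Ψ z).PosDef) (hΨs : ConjSymm Ψ)
    (hΛf : IsDualFeasible A B Ψ Λ) (hS : S ∈ rangeGamma A B) :
    moment A B (PhiOpt A B Ψ Λ) = toC S := by
  obtain ⟨M, hM, hmoment⟩ := exists_mem_rangeGamma (A := A) (B := B)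
    (isContDensity_of_conjSymm (hΛf.continuous_PhiOpt hA hΨ hΨp)
      (fun z => (hΛf.posDef_PhiOpt z).posSemidef) (conjSymm_phiOptInv hΨs Λ).inv)
  have hD : M - S ∈ rangeGamma A B := (rangeGammaSubmodule hA B).sub_mem hM hS
  have hDs := isSymm_of_mem_rangeGamma hD
  obtain ⟨s, hs, hfeas⟩ :=
    hΛf.exists_pos_add_smul hA hΨ hΨp (isSymm_of_mem_rangeGamma hΛ.mem) hDs
  have hnonneg := hΛ.dualDeriv_nonneg hA hΨ hΨp hΛf ((rangeGammaSubmodule hA B).add_mem hΛ.mem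
    ((rangeGammaSubmodule hA B).smul_mem s hD)) hfeas
  rw [add_sub_cancel_left, dualDeriv_smul] at hnonneg
  have hderiv : dualDeriv A B S Ψ Λ (M - S) = -((M - S)ᴴ * (M - S)).trace := by
    rw [conjTranspose_eq_transpose_of_trivial, hDs.eq, dualDeriv, hmoment, ← toC_mul, trace_toC_re,
      Matrix.mul_sub (M - S), trace_sub, neg_sub]
  have htrace : ((M - S)ᴴ * (M - S)).trace = 0 := le_antisymm
    (neg_nonneg.mp (hderiv ▸ nonneg_of_mul_nonneg_right hnonneg hs))
    (posSemidef_conjTranspose_mul_self _).trace_nonneg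
  rw [hmoment, sub_eq_zero.mp (trace_conjTranspose_mul_self_eq_zero_iff.mp htrace)]

theorem exists_isDualFeasible_moment_PhiOpt_eq (hA : IsStable A) (hW : IsSpectralFactor W Ψ)
    (hΨp : ∀ z, (Ψ z).PosDef) (hΨs : ConjSymm Ψ)
    (hΨd : ∀ i j, Differentiable ℝ fun θ : ℝ => Ψ (Circle.exp θ) i j) (hΦ : Continuous Φ)
    (hΦp : ∀ z, (Φ z).PosDef) (hΦs : ConjSymm Φ) (hΦS : moment A B Φ = toC S) :
    ∃ Λ : rangeGamma A B, IsDualFeasible A B Ψ Λ.1 ∧ moment A B (PhiOpt A B Ψ Λ) = toC S := by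
  have hΨ := continuous_of_differentiable_comp_exp hΨd
  obtain ⟨Λ, hΛ⟩ := exists_isMintySolution hA hW hΨ hΨp hΦ hΦp hΦS
  obtain ⟨M, hM, hMΦ⟩ := exists_mem_rangeGamma (A := A) (B := B)
    (isContDensity_of_conjSymm hΦ (fun z => (hΦp z).posSemidef) hΦs)
  have hS : S ∈ rangeGamma A B := toC_injective (hΦS.symm.trans hMΦ) ▸ hM
  have hΛf := hΛ.isDualFeasible hA hΨ hΨp hΨd
  exact ⟨⟨Λ, hΛ.mem⟩, hΛf, hΛ.moment_PhiOpt_eq hA hΨ hΨp hΨs hΛf hS⟩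

end Stationarity

section Optimality

open Filter Topology

variable {n m : ℕ} {A : Matrix (Fin n) (Fin n) ℝ} {B : Matrix (Fin n) (Fin m) ℝ}
  {S : Matrix (Fin n) (Fin n) ℝ} {Ψ W Φ : Circle → Matrix (Fin m) (Fin m) ℂ}
  {Λ Λ' Λ₀ : Matrix (Fin n) (Fin n) ℝ}

theorem J_le_of_moment_PhiOpt_eq (hA : IsStable A) (hW : IsSpectralFactor W Ψ)
    (hΨ : Continuous Ψ) (hΨp : ∀ z, (Ψ z).PosDef) (hΛ₀ : IsDualFeasible A B Ψ Λ₀)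
    (hmom : moment A B (PhiOpt A B Ψ Λ₀) = toC S) (hΛ : IsDualFeasible A B Ψ Λ) :
    J A B S W Λ₀ ≤ J A B S W Λ := by
  simpa only [dualDeriv_eq_zero hmom, add_zero] using
    J_add_dualDeriv_le (S := S) hA hW hΨ hΨp hΛ₀ hΛ

theorem J_lt_of_moment_PhiOpt_eq (hA : IsStable A) (hW : IsSpectralFactor W Ψ)
    (hΨ : Continuous Ψ) (hΨp : ∀ z, (Ψ z).PosDef) (hΛ₀ : IsDualFeasible A B Ψ Λ₀)
    (hmom : moment A B (PhiOpt A B Ψ Λ₀) = toC S) (hΛ : IsDualFeasible A B Ψ Λ)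
    (hmem₀ : Λ₀ ∈ rangeGamma A B) (hmem : Λ ∈ rangeGamma A B) (hne : Λ ≠ Λ₀) :
    J A B S W Λ₀ < J A B S W Λ :=
  (J_le_of_moment_PhiOpt_eq hA hW hΨ hΨp hΛ₀ hmom hΛ).lt_of_ne fun h =>
    hne <| eq_of_J_add_dualDeriv_eq (S := S) hA hW hΨ hΨp hΛ₀ hΛ hmem₀ hmem <| by
      rw [dualDeriv_eq_zero hmom, add_zero, h]

theorem J_add_dualDeriv_le_Jinf (hA : IsStable A) (hW : IsSpectralFactor W Ψ)
    (hΨ : Continuous Ψ) (hΨp : ∀ z, (Ψ z).PosDef) (hΛ : IsDualFeasible A B Ψ Λ)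
    (hΛ' : ∀ z, (phiOptInv A B Ψ Λ' z).PosSemidef) :
    ((J A B S W Λ + dualDeriv A B S Ψ Λ (Λ' - Λ) : ℝ) : EReal) ≤ Jinf A B S W Λ' := by
  let c := ∫ z, ((phiOptInv A B Ψ Λ z)⁻¹ * (Ψ z)⁻¹).trace.re ∂circleMeasure
  have hlim : Tendsto (fun k : ℕ => J A B S W Λ + dualDeriv A B S Ψ Λ (Λ' - Λ)
      - 1 / ((k : ℝ) + 1) * c) atTop (𝓝 (J A B S W Λ + dualDeriv A B S Ψ Λ (Λ' - Λ))) := by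
    simpa only [zero_mul, sub_zero] using
      ((tendsto_one_div_add_atTop_nhds_zero_nat (𝕜 := ℝ)).mul_const c).const_sub _
  refine le_of_tendsto' (EReal.tendsto_coe.mpr hlim) fun k => ?_
  have hε : 0 < 1 / ((k : ℝ) + 1) := by positivity
  refine (EReal.coe_le_coe_iff.mpr (J_add_dualDeriv_le_Jreg hA hW hΨ hΨp hΛ fun z => ?_)).trans
    (le_iSup (fun k : ℕ => ((Jreg A B S W (1 / ((k : ℝ) + 1)) Λ' : ℝ) : EReal)) k)
  exact PosDef.posSemidef_add (hΛ' z) ((hΨp z).inv.smul (by exact_mod_cast hε))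

/- The midpoint of `Λ₀` and `Λ` is feasible even when `Λ` is a boundary point, and `J_Ψ` is strictly
larger there than at `Λ₀`; by convexity it keeps growing beyond the midpoint. -/
theorem J_lt_Jinf (hA : IsStable A) (hW : IsSpectralFactor W Ψ) (hΨ : Continuous Ψ)
    (hΨp : ∀ z, (Ψ z).PosDef) (hΛ₀ : IsDualFeasible A B Ψ Λ₀)
    (hmom : moment A B (PhiOpt A B Ψ Λ₀) = toC S) (hΛ : ∀ z, (phiOptInv A B Ψ Λ z).PosSemidef)
    (hmem₀ : Λ₀ ∈ rangeGamma A B) (hmem : Λ ∈ rangeGamma A B) (hne : Λ ≠ Λ₀) :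
    ((J A B S W Λ₀ : ℝ) : EReal) < Jinf A B S W Λ := by
  let M : Matrix (Fin n) (Fin n) ℝ := (1 / 2 : ℝ) • Λ + (1 / 2 : ℝ) • Λ₀
  have hM : IsDualFeasible A B Ψ M :=
    hΛ₀.convexCombination hΛ (by norm_num) (by norm_num) (by norm_num)
  have hMmem : M ∈ rangeGamma A B := (rangeGammaSubmodule hA B).add_mem
    ((rangeGammaSubmodule hA B).smul_mem _ hmem) ((rangeGammaSubmodule hA B).smul_mem _ hmem₀)
  have hsub : Λ₀ - M = (-1 : ℝ) • (Λ - M) := by module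
  have hMne : M ≠ Λ₀ := fun h => hne <| sub_eq_zero.mp <| by
    rw [show Λ - Λ₀ = (2 : ℝ) • (M - Λ₀) by module, h, sub_self, smul_zero]
  have hlt : J A B S W Λ₀ < J A B S W M :=
    J_lt_of_moment_PhiOpt_eq hA hW hΨ hΨp hΛ₀ hmom hM hmem₀ hMmem hMne
  have htangent := J_add_dualDeriv_le (S := S) hA hW hΨ hΨp hM hΛ₀
  rw [hsub, dualDeriv_smul] at htangent
  exact (EReal.coe_lt_coe_iff.mpr (by linarith)).trans_le
    (J_add_dualDeriv_le_Jinf (S := S) hA hW hΨ hΨp hM hΛ)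

theorem dRER_eq (hΨ : Continuous Ψ) (hΨp : ∀ z, (Ψ z).PosDef) (hΦ : IsBddCoerciveDensity Φ) :
    dRER Φ Ψ = 1 / 2 * (∫ z, logDet (Ψ z) ∂circleMeasure - ∫ z, logDet (Φ z) ∂circleMeasure
      + ∫ z, ((Ψ z)⁻¹ * Φ z).trace.re ∂circleMeasure - m) := by
  have hΨl : Integrable (fun z => logDet (Ψ z)) circleMeasure :=
    integrable_of_continuous (continuous_logDet hΨ hΨp)
  have htr : Integrable (fun z => ((Ψ z)⁻¹ * Φ z).trace.re) circleMeasure :=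
    ((EssBdd.of_continuous (continuous_inv_of_posDef hΨ hΨp)).mul hΦ.essBdd).integrable_trace_re
  have hlog : Integrable (fun z => logDet (Ψ z) - logDet (Φ z)) circleMeasure :=
    hΨl.sub hΦ.integrable_logDet
  have hsum : Integrable (fun z => logDet (Ψ z) - logDet (Φ z) + ((Ψ z)⁻¹ * Φ z).trace.re)
      circleMeasure := hlog.add htr
  have hpt : (fun z => Real.log ((Φ z)⁻¹ * Ψ z).det.re + ((Ψ z)⁻¹ * (Φ z - Ψ z)).trace.re)
      =ᵐ[circleMeasure] fun z => logDet (Ψ z) - logDet (Φ z) + ((Ψ z)⁻¹ * Φ z).trace.re - m := by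
    filter_upwards [hΦ.ae_posDef] with z hz
    rw [log_det_mul hz.inv (hΨp z), logDet_inv hz, trace_inv_mul_sub (hΨp z), Fintype.card_fin]
    ring
  rw [dRER, integral_congr_ae hpt, integral_sub hsum (integrable_const _),
    integral_add hlog htr, integral_sub hΨl hΦ.integrable_logDet, integral_const, probReal_univ,
    one_smul]

theorem integral_trace_inv_PhiOpt_mul_sub (hA : IsStable A) (hΨ : Continuous Ψ)
    (hΨp : ∀ z, (Ψ z).PosDef) (hΛ : IsDualFeasible A B Ψ Λ)
    (hmom : moment A B (PhiOpt A B Ψ Λ) = toC S) (hΦ : EssBdd Φ circleMeasure)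
    (hΦS : moment A B Φ = toC S) :
    ∫ z, ((PhiOpt A B Ψ Λ z)⁻¹ * (Φ z - PhiOpt A B Ψ Λ z)).trace.re ∂circleMeasure
      = ∫ z, ((Ψ z)⁻¹ * Φ z).trace.re ∂circleMeasure
        - ∫ z, ((Ψ z)⁻¹ * PhiOpt A B Ψ Λ z).trace.re ∂circleMeasure := by
  have hX : EssBdd (PhiOpt A B Ψ Λ) circleMeasure :=
    .of_continuous (hΛ.continuous_PhiOpt hA hΨ hΨp)
  have hc : Continuous (phiOptInv A B Ψ Λ) :=
    continuous_phiOptInv hA hΨ hΨp continuous_const continuous_id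
  have hΦtr := trace_mul_eq_integral_phiOptInv hA hΨ hΨp hΦ hΦS Λ
  have hXtr := trace_mul_eq_integral_phiOptInv hA hΨ hΨp hX hmom Λ
  simp only [hΛ.inv_PhiOpt, Matrix.mul_sub, trace_sub, Complex.sub_re]
  rw [integral_sub ((EssBdd.of_continuous hc).mul hΦ).integrable_trace_re
    ((EssBdd.of_continuous hc).mul hX).integrable_trace_re]
  linarith

theorem dRER_PhiOpt_le (hA : IsStable A) (hΨ : Continuous Ψ) (hΨp : ∀ z, (Ψ z).PosDef)
    (hΨs : ConjSymm Ψ) (hΛ : IsDualFeasible A B Ψ Λ)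
    (hmom : moment A B (PhiOpt A B Ψ Λ) = toC S) (hΦ : Φ ∈ feasible A B S) :
    dRER (PhiOpt A B Ψ Λ) Ψ ≤ dRER Φ Ψ := by
  have hle := integral_logDet_le (hΛ.continuous_PhiOpt hA hΨ hΨp) hΛ.posDef_PhiOpt hΦ.1.essBdd
    hΦ.1.ae_posDef hΦ.1.integrable_logDet
  rw [integral_trace_inv_PhiOpt_mul_sub hA hΨ hΨp hΛ hmom hΦ.1.essBdd hΦ.2] at hle
  rw [dRER_eq hΨ hΨp hΦ.1, dRER_eq hΨ hΨp (hΛ.isBddCoerciveDensity_PhiOpt hA hΨ hΨp hΨs)]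
  linarith

theorem ae_eq_PhiOpt_of_dRER_eq (hA : IsStable A) (hΨ : Continuous Ψ) (hΨp : ∀ z, (Ψ z).PosDef)
    (hΨs : ConjSymm Ψ) (hΛ : IsDualFeasible A B Ψ Λ)
    (hmom : moment A B (PhiOpt A B Ψ Λ) = toC S) (hΦ : Φ ∈ feasible A B S)
    (h : dRER Φ Ψ = dRER (PhiOpt A B Ψ Λ) Ψ) : Φ =ᵐ[circleMeasure] PhiOpt A B Ψ Λ := by
  refine ae_eq_of_integral_logDet_eq (hΛ.continuous_PhiOpt hA hΨ hΨp) hΛ.posDef_PhiOpt hΦ.1.essBdd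
    hΦ.1.ae_posDef hΦ.1.integrable_logDet ?_
  rw [dRER_eq hΨ hΨp hΦ.1, dRER_eq hΨ hΨp (hΛ.isBddCoerciveDensity_PhiOpt hA hΨ hΨp hΨs)] at h
  rw [integral_trace_inv_PhiOpt_mul_sub hA hΨ hΨp hΛ hmom hΦ.1.essBdd hΦ.2]
  linarith

theorem isSolution_PhiOpt (hA : IsStable A) (hΨ : Continuous Ψ) (hΨp : ∀ z, (Ψ z).PosDef)
    (hΨs : ConjSymm Ψ) (hΛ : IsDualFeasible A B Ψ Λ)
    (hmom : moment A B (PhiOpt A B Ψ Λ) = toC S) : IsSolution A B S Ψ (PhiOpt A B Ψ Λ) :=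
  ⟨⟨hΛ.isBddCoerciveDensity_PhiOpt hA hΨ hΨp hΨs, hmom⟩,
    fun _ hΦ => dRER_PhiOpt_le hA hΨ hΨp hΨs hΛ hmom hΦ⟩

theorem IsSolution.ae_eq_PhiOpt (hΦ : IsSolution A B S Ψ Φ) (hA : IsStable A)
    (hΨ : Continuous Ψ) (hΨp : ∀ z, (Ψ z).PosDef) (hΨs : ConjSymm Ψ)
    (hΛ : IsDualFeasible A B Ψ Λ) (hmom : moment A B (PhiOpt A B Ψ Λ) = toC S) :
    Φ =ᵐ[circleMeasure] PhiOpt A B Ψ Λ :=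
  have hX := isSolution_PhiOpt hA hΨ hΨp hΨs hΛ hmom
  ae_eq_PhiOpt_of_dRER_eq hA hΨ hΨp hΨs hΛ hmom hΦ.1 (le_antisymm (hΦ.2 _ hX.1) (hX.2 _ hΦ.1))

end Optimality

end

end RER

theorem mainTheorem2_general (m n : ℕ) (hm : 0 < m)
    (A : Matrix (Fin n) (Fin n) ℝ) (B : Matrix (Fin n) (Fin m) ℝ)
    (hA : RER.IsStable A) (hB : B.rank = m)
    (S : Matrix (Fin n) (Fin n) ℝ) (hS : S.PosDef)
    (hfeas : ∃ H : Matrix (Fin m) (Fin n) ℝ, S - A * S * Aᵀ = B * H + Hᵀ * Bᵀ)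
    (Ψ : Circle → Matrix (Fin m) (Fin m) ℂ) (hΨ : RER.IsBddCoerciveDensity Ψ)
    (hΨd : ∀ i j, Differentiable ℝ fun θ : ℝ => Ψ (Circle.exp θ) i j)
    (W : Circle → Matrix (Fin m) (Fin m) ℂ) (hW : RER.IsSpectralFactor W Ψ) :
    IsOpen (RER.LplusGamma A B W) ∧
    (¬ ∃ C : ℝ, ∀ Λ ∈ RER.LplusGamma A B W, ∀ i j, |Λ.1 i j| ≤ C) ∧
    ∃ Λ₀ : RER.rangeGamma A B,
      Λ₀ ∈ RER.LplusGamma A B W ∧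
      (∀ Λ ∈ RER.LplusGamma A B W, RER.J A B S W Λ₀ ≤ RER.J A B S W Λ) ∧
      (∀ Λ₁ ∈ RER.LplusGamma A B W,
        (∀ Λ ∈ RER.LplusGamma A B W, RER.J A B S W Λ₁ ≤ RER.J A B S W Λ) → Λ₁ = Λ₀) ∧
      Λ₀ ∈ interior (RER.LplusGamma A B W) ∧
      Λ₀ ∉ frontier (RER.LplusGamma A B W) ∧
      (∀ Λ ∈ closure (RER.LplusGamma A B W), Λ ≠ Λ₀ →
        ((RER.J A B S W Λ₀ : ℝ) : EReal) < RER.Jinf A B S W Λ) ∧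
      RER.moment A B (RER.PhiOpt A B Ψ Λ₀) = RER.toC S ∧
      RER.IsSolution A B S Ψ (RER.PhiOpt A B Ψ Λ₀) ∧
      (∀ Φ, RER.IsSolution A B S Ψ Φ → Φ =ᵐ[RER.circleMeasure] RER.PhiOpt A B Ψ Λ₀) := by
  have hΨc := RER.continuous_of_differentiable_comp_exp hΨd
  have hΨp := hΨ.posDef_of_continuous hΨc
  have hΨs := hΨ.conjSymm_of_continuous hΨc
  have hB₀ : B ≠ 0 := fun h => hm.ne (by rw [← hB, h, rank_zero])
  have hopen : IsOpen (RER.LplusGamma A B W) := RER.isOpen_LplusGamma hA hW hΨc hΨp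
  obtain ⟨Φ, hΦ, hΦs, hΦp, hΦS⟩ := RER.exists_posDef_moment_eq hA hB hS hfeas
  obtain ⟨Λ₀, hΛ₀, hmom⟩ :=
    RER.exists_isDualFeasible_moment_PhiOpt_eq hA hW hΨp hΨs hΨd hΦ hΦp hΦs hΦS
  have hfeasible {Λ} := RER.mem_LplusGamma_iff (A := A) (B := B) hW hΨp (Λ := Λ)
  have hmem : Λ₀ ∈ RER.LplusGamma A B W := hfeasible.mpr hΛ₀
  have hint : Λ₀ ∈ interior (RER.LplusGamma A B W) := hopen.interior_eq.symm ▸ hmem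
  refine ⟨hopen, RER.unbounded_LplusGamma hA hB₀ hW hΨp, Λ₀, hmem, fun Λ hΛ => ?_,
    fun Λ₁ hΛ₁ hmin => ?_, hint, fun h => h.2 hint, fun Λ hΛ hne => ?_, hmom,
    RER.isSolution_PhiOpt hA hΨc hΨp hΨs hΛ₀ hmom,
    fun Φ hΦ => hΦ.ae_eq_PhiOpt hA hΨc hΨp hΨs hΛ₀ hmom⟩
  · exact RER.J_le_of_moment_PhiOpt_eq hA hW hΨc hΨp hΛ₀ hmom (hfeasible.mp hΛ)
  · by_contra hne
    exact (hmin Λ₀ hmem).not_gt <| RER.J_lt_of_moment_PhiOpt_eq hA hW hΨc hΨp hΛ₀ hmom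
      (hfeasible.mp hΛ₁) Λ₀.2 Λ₁.2 (Subtype.coe_ne_coe.mpr hne)
  · exact RER.J_lt_Jinf hA hW hΨc hΨp hΛ₀ hmom
      (RER.posSemidef_phiOptInv_of_mem_closure hA hW hΨc hΨp hΛ) Λ₀.2 Λ.2
      (Subtype.coe_ne_coe.mpr hne)

theorem mainTheorem2 (m n : ℕ) (hm : 0 < m) (hmn : m ≤ n)
    (A : Matrix (Fin n) (Fin n) ℝ) (B : Matrix (Fin n) (Fin m) ℝ)
    (hA : RER.IsStable A) (hB : B.rank = m) (hAB : RER.IsReachable A B)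
    (S : Matrix (Fin n) (Fin n) ℝ) (hS : S.PosDef)
    (hfeas : ∃ H : Matrix (Fin m) (Fin n) ℝ, S - A * S * Aᵀ = B * H + Hᵀ * Bᵀ)
    (Ψ : Circle → Matrix (Fin m) (Fin m) ℂ)
    (hΨ : RER.IsBddCoerciveDensity Ψ) (hΨrat : RER.IsRational Ψ)
    (W : Circle → Matrix (Fin m) (Fin m) ℂ) (hW : RER.IsSpectralFactor W Ψ) :
    -- the domain of the dual problem is open in `Range Γ` and unbounded
    IsOpen (RER.LplusGamma A B W) ∧
    (¬ ∃ C : ℝ, ∀ Λ ∈ RER.LplusGamma A B W, ∀ i j, |Λ.1 i j| ≤ C) ∧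
    ∃ Λ₀ : RER.rangeGamma A B,
      -- `Λ₀` is the unique minimizer of the dual functional
      Λ₀ ∈ RER.LplusGamma A B W ∧
      (∀ Λ ∈ RER.LplusGamma A B W, RER.J A B S W Λ₀ ≤ RER.J A B S W Λ) ∧
      (∀ Λ₁ ∈ RER.LplusGamma A B W,
        (∀ Λ ∈ RER.LplusGamma A B W, RER.J A B S W Λ₁ ≤ RER.J A B S W Λ) → Λ₁ = Λ₀) ∧
      -- it is an interior point, and the minimum over the closure is attained only there
      Λ₀ ∈ interior (RER.LplusGamma A B W) ∧
      Λ₀ ∉ frontier (RER.LplusGamma A B W) ∧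
      (∀ Λ ∈ closure (RER.LplusGamma A B W), Λ ≠ Λ₀ →
        ((RER.J A B S W Λ₀ : ℝ) : EReal) < RER.Jinf A B S W Λ) ∧
      -- `Φ°` satisfies the moment constraint and is the unique solution of the primal problem
      RER.moment A B (RER.PhiOpt A B Ψ Λ₀) = RER.toC S ∧
      RER.IsSolution A B S Ψ (RER.PhiOpt A B Ψ Λ₀) ∧
      (∀ Φ, RER.IsSolution A B S Ψ Φ → Φ =ᵐ[RER.circleMeasure] RER.PhiOpt A B Ψ Λ₀) :=
  mainTheorem2_general m n hm A B hA hB S hS hfeas Ψ hΨ hΨrat.differentiable W hW
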